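/- Let $N_1,N_2\ge 1$, $N=N_1+N_2$ and $\xi=N_1N_2/N^2$. Let the $N\times N$ scattering matrix $$S=\begin{pmatrix} r & t'\\ t & r'\end{pmatrix},\qquad t\in\mathbb{C}^{N_2\times N_1},$$ be drawn from the circular orthogonal ensemble (that is, $S=U^{T}U$ with $U$ Haar distributed on $U(N)$), and let $\langle\cdot\rangle$ denote the average. The generating function of the autocorrelation of the transmission eigenvalues is the series $$\tilde P_{[t,t]}(s_1,s_2)=\sum_{n_1,n_2\ge1}s_1^{n_1}s_2^{n_2}\Big(\big\langle \mathrm{Tr}(t^\dagger t)^{n_1}\,\mathrm{Tr}(t^\dagger t)^{n_2}\big\rangle-\big\langle \mathrm{Tr}(t^\dagger t)^{n_1}\big\rangle\big\langle \mathrm{Tr}(t^\dagger t)^{n_2}\big\rangle\Big).$$ Then, coefficient by coefficient in $s_1,s_2$, it has an asymptotic expansion $$\tilde P_{[t,t]}=\tilde P_{[t,t],1}+N^{-1}\tilde P_{[t,t],2}^{O}+N^{-2}\tilde P_{[t,t],3}+\cdots,$$ in which the coefficient of $s_1^{n_1}s_2^{n_2}$ in each term is a polynomial in $\xi$; for each $(n_1,n_2)$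 and each $K\ge0$ the error after $K$ terms is $O(N^{-K})$ uniformly in $N_1,N_2\ge1$. These polynomials are unique, and for all real $0<\xi\le\frac14$ and all real $s_1\ne s_2$ with $|s_1|,|s_2|<1$ the double power series $\tilde P_{[t,t],2}^{O}(s_1,s_2)$ converges absolutely, with $$\tilde P_{[t,t],2}^{O}(s_1,s_2)=F(s_1,s_2)+F(s_2,s_1),$$ $$F(s_1,s_2)=\Big[(s_1+s_2)(1-s_2)(1-s_1)^2+8s_1^2\xi\,(s_2^2+s_1s_2+1)-2\xi\,(9s_1^2s_2+4s_1s_2^2-3s_1s_2+3s_1^3-s_2^2)+8s_1^2\xi^2(s_1+3s_2-2s_1s_2-2s_2^2)\Big]\frac{s_1s_2}{(s_1-s_2)^3(1-s_1+4\xi s_1)^2\sqrt{1-s_2}\,\sqrt{1-s_2+4\xi s_2}}.$$ Its expansion up to total degree $4$ in $s_1,s_2$ is $$\tilde P_{[t,t],2}^{O}=2s_1s_2\,\xi(1-5\xi)+4s_1s_2(s_1+s_2)\,\xi(1-9\xi+18\xi^2)+8s_1^2s_2^2\,\xi(1-13\xi+50\xi^2-61\xi^3)+6s_1s_2(s_1^2+s_2^2)\,\xi(1-13\xi+52\xi^2-69\xi^3)+\cdots.$$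 -/

import Mathlib

open MeasureTheory
open scoped Polynomial

namespace ChaoticTransport

noncomputable section

/-- Complex matrices carry the Borel sigma-algebra of their usual topology. -/
instance instMeasurableSpaceMatrix (m n : Type*) : MeasurableSpace (Matrix m n ℂ) := borel _

instance instBorelSpaceMatrix (m n : Type*) : BorelSpace (Matrix m n ℂ) := ⟨rfl⟩

/-- The unitary group is compact. -/
instance instCompactSpaceUnitaryGroup (n : Type*) [Fintype n] [DecidableEq n] :
    CompactSpace (Matrix.unitaryGroup n ℂ) := by
  apply isCompact_iff_compactSpace.mp
  have hK : IsCompact (Set.univ.pi fun _ : n => Set.univ.pi fun _ : n =>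
      Metric.closedBall (0 : ℂ) 1) :=
    isCompact_univ_pi fun _ => isCompact_univ_pi fun _ => isCompact_closedBall 0 1
  refine hK.of_isClosed_subset ?_ ?_
  · have h : ((Matrix.unitaryGroup n ℂ : Submonoid (Matrix n n ℂ)) : Set (Matrix n n ℂ)) =
        {A : Matrix n n ℂ | A * star A = 1} := by
      ext A
      exact Matrix.mem_unitaryGroup_iff
    rw [h]
    exact isClosed_eq (by fun_prop) continuous_const
  · intro A hA i _ j _
    simpa using entry_norm_bound_of_unitary hA i j

/-- The Haar probability measure on the unitary group (total mass one). -/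
def haarUnitary (n : Type*) [Fintype n] [DecidableEq n] : Measure (Matrix.unitaryGroup n ℂ) :=
  Measure.haarMeasure ⊤

/-- The circular orthogonal ensemble: the law of `Uᵀ U` with `U` Haar distributed on the
unitary group. -/
def circularOrthogonalEnsemble (n : Type*) [Fintype n] [DecidableEq n] :
    Measure (Matrix n n ℂ) :=
  (haarUnitary n).map fun U : Matrix.unitaryGroup n ℂ =>
    (U : Matrix n n ℂ).transpose * (U : Matrix n n ℂ)

/-- The law of the scattering matrix of a chaotic cavity with time-reversal symmetry whose two
leads carry `N₁` and `N₂` channels. -/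
abbrev scatteringLaw (N₁ N₂ : ℕ) :
    Measure (Matrix (Fin N₁ ⊕ Fin N₂) (Fin N₁ ⊕ Fin N₂) ℂ) :=
  circularOrthogonalEnsemble (Fin N₁ ⊕ Fin N₂)

/-- The transmission block `t` of the scattering matrix `S = (r, t'; t, r')`. -/
def transmissionBlock {N₁ N₂ : ℕ} (S : Matrix (Fin N₁ ⊕ Fin N₂) (Fin N₁ ⊕ Fin N₂) ℂ) :
    Matrix (Fin N₂) (Fin N₁) ℂ :=
  S.toBlocks₂₁

/-- `Tr (X† X) ^ n`, as a real number. -/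
def powerTrace {m k : ℕ} (X : Matrix (Fin m) (Fin k) ℂ) (n : ℕ) : ℝ :=
  (Matrix.trace ((X.conjTranspose * X) ^ n)).re

/-- Nothing is lost by taking the real part in `powerTrace`. -/
theorem coe_powerTrace {m k : ℕ} (X : Matrix (Fin m) (Fin k) ℂ) (n : ℕ) :
    ((powerTrace X n : ℝ) : ℂ) = Matrix.trace ((X.conjTranspose * X) ^ n) := by
  have h : ((X.conjTranspose * X) ^ n).IsHermitian :=
    (Matrix.isHermitian_conjTranspose_mul_self X).pow n
  have h2 := congrArg Matrix.trace h.eq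
  rw [Matrix.trace_conjTranspose] at h2
  exact Complex.conj_eq_iff_re.mp h2

/-- The linear moment `M_n(t)`. -/
def linearMoment (N₁ N₂ n : ℕ) : ℝ :=
  ∫ S, powerTrace (transmissionBlock S) n ∂(scatteringLaw N₁ N₂)

/-- The nonlinear moment `M_{n₁,n₂}(t,t)`. -/
def nonlinearMoment (N₁ N₂ n₁ n₂ : ℕ) : ℝ :=
  ∫ S, powerTrace (transmissionBlock S) n₁ * powerTrace (transmissionBlock S) n₂
    ∂(scatteringLaw N₁ N₂)

/-- The coefficient of `s₁ ^ n₁ * s₂ ^ n₂` in the autocorrelation generating function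
of the transmission eigenvalues. -/
def autocorrelation (N₁ N₂ n₁ n₂ : ℕ) : ℝ :=
  nonlinearMoment N₁ N₂ n₁ n₂ - linearMoment N₁ N₂ n₁ * linearMoment N₁ N₂ n₂

/-- The parameter `ξ = N₁ N₂ / N²`, where `N = N₁ + N₂`. -/
def xiParam (N₁ N₂ : ℕ) : ℝ := (N₁ : ℝ) * N₂ / ((N₁ : ℝ) + N₂) ^ 2

/-- `P j n₁ n₂` (for `j, n₁, n₂ ≥ 1`) is the coefficient of `s₁ ^ n₁ * s₂ ^ n₂` in the `j`-th term
of the expansion `P₁ + N⁻¹ P₂ + N⁻² P₃ + …` of the autocorrelation generating function in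
inverse powers of `N = N₁ + N₂`, as a polynomial in `ξ`. The error after `K` terms is of order
`N ^ (-K)`, uniformly in `N₁, N₂`. This determines these polynomials uniquely. -/
def IsAutocorrelationExpansion (P : ℕ → ℕ → ℕ → ℝ[X]) : Prop :=
  ∀ n₁ n₂ : ℕ, 1 ≤ n₁ → 1 ≤ n₂ → ∀ K : ℕ, ∃ C : ℝ, ∀ N₁ N₂ : ℕ, 1 ≤ N₁ → 1 ≤ N₂ →
    |autocorrelation N₁ N₂ n₁ n₂ -
        ∑ j ∈ Finset.range K,
          (P (j + 1) n₁ n₂).eval (xiParam N₁ N₂) / ((N₁ : ℝ) + N₂) ^ j| ≤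
      C / ((N₁ : ℝ) + N₂) ^ K

/-- The unsymmetrised algebraic function in the formula for the second term. -/
def secondTermHalf (ξ s₁ s₂ : ℝ) : ℝ :=
  ((s₁ + s₂) * (1 - s₂) * (1 - s₁) ^ 2 + 8 * s₁ ^ 2 * ξ * (s₂ ^ 2 + s₁ * s₂ + 1)
      - 2 * ξ * (9 * s₁ ^ 2 * s₂ + 4 * s₁ * s₂ ^ 2 - 3 * s₁ * s₂ + 3 * s₁ ^ 3 - s₂ ^ 2)
      + 8 * s₁ ^ 2 * ξ ^ 2 * (s₁ + 3 * s₂ - 2 * s₁ * s₂ - 2 * s₂ ^ 2))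
    * (s₁ * s₂ / ((s₁ - s₂) ^ 3 * (1 - s₁ + 4 * ξ * s₁) ^ 2
        * √(1 - s₂) * √(1 - s₂ + 4 * ξ * s₂)))

end

end ChaoticTransport

/-!
The average over the circular orthogonal ensemble is an average over Haar distributed `U`, with
`S = Uᵀ U`. Let `P` be the projection onto the modes of the first lead and `Q = S† (1 - P) S`. Only
the upper row of blocks of `P Q` is nonzero, and it starts with `t† t`, so that the traces
`p_k = Tr (t† t) ^ k` are the power traces of a product of two projections
(`complexTrace_leadProj_succ`). Right translations of `U` by `exp (x A)` preserve Haar measure, and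
so the average of a divergence vanishes (`complexMean_divergence`). For the vector field
`A = (P Q) ^ k` the divergence can be computed in terms of the `p_l` alone. The symmetry of `S`
enters through the involution `σ X = S† Xᵀ S`, which exchanges `P` with `1 - Q` and is responsible
for the terms `k p_k`. The results are the loop equations (`complexMean_loop`): with `N = N₁ + N₂`
and a product `F` of shifted traces `p_m - c_m`, the average of
`((N + k) p_k + ∑_{0 < l < k} p_l p_{k-l} - N₁ N₂) F` is the average of the sum, over the factors
`p_m - c_m` of `F`, of `2 m (p_m - p_{m+k})` times the product of the other factors.

Taking for the `c_m` the means turns them into equations for the means, divided by `N`, and for the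
central moments (`meanDensity_loop`, `centralMoment_loop`), in which every term besides the leading
one either has smaller weight (sum of the indices), or a factor `1 / N`, or is explicit. Only the
mean of the same weight enters the equations for the central moments without such a factor, and its
own equation comes first. All these quantities grow at most polynomially in `N`. Iterating the
equations therefore gives, by induction on the weight, asymptotic expansions in `1 / N` with
coefficients polynomial in `ξ` and uniform errors
(`le_expandable_of_le_expandableAdd`, `mem_expandable_of_weight_le`). Uniqueness of the expansions
(`HasExpansion.unique`) turns the loop equations into recursions for the coefficients. Third central
moments are `O(1 / N)`, and so the recursions for the first two coefficients of the means and of the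
covariances close (`meanCoeff_one_loop`, `covCoeff_one_loop`).

At fixed `ξ` the leading mean series `M` satisfies a quadratic equation, with the solution
`1 + 2 M = √(1 - a X) / √(1 - X)`, where `a = 1 - 4 ξ`. The recursions in the first index of the
covariances are linear, with the operator of multiplication by `1 + 2 M` on the left hand side. They
express the subleading covariances by their source terms and explicit algebraic series
(`covGen_one`). The source terms `2 m (g_m - g_{k+m})` are summed over `k` and `m` along the
antidiagonals, which produces the powers of `s₁ - s₂` in the denominators
(`hasSum_snd_mul_coeff_add`, `hasSum_fst_mul_snd_mul_coeff_add`). All series involved have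
coefficients of polynomial growth, hence converge absolutely for `|s₁|, |s₂| < 1`, and the sum is
identified in `secondTerm_eq`.
-/

namespace ChaoticTransport

/-! ### Haar measure on the unitary group -/

section HaarMeasure

variable (n : Type*) [Fintype n] [DecidableEq n]

instance isHaarMeasure_haarUnitary : (haarUnitary n).IsHaarMeasure := by
  unfold haarUnitary; infer_instance

instance isProbabilityMeasure_haarUnitary : IsProbabilityMeasure (haarUnitary n) := by
  constructor
  have := Measure.haarMeasure_self
    (K₀ := (⊤ : TopologicalSpace.PositiveCompacts (Matrix.unitaryGroup n ℂ)))
  simpa [haarUnitary] using this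

/-- The unitary group is compact, hence unimodular. -/
instance isMulRightInvariant_haarUnitary : (haarUnitary n).IsMulRightInvariant := by
  constructor
  intro g
  have : IsProbabilityMeasure (Measure.map (· * g) (haarUnitary n)) :=
    Measure.isProbabilityMeasure_map (by fun_prop)
  have : (Measure.map (· * g) (haarUnitary n)).IsHaarMeasure := inferInstance
  exact Measure.isHaarMeasure_eq_of_isProbabilityMeasure _ _

end HaarMeasure

/-! ### One-parameter subgroups of the unitary group -/

section Flow

variable {n : Type*} [Fintype n] [DecidableEq n]

/-- The one-parameter group generated by a skew-Hermitian matrix. -/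
noncomputable def unitaryFlow (A : Matrix n n ℂ) (hA : A.conjTranspose = -A) (x : ℝ) :
    Matrix.unitaryGroup n ℂ :=
  ⟨NormedSpace.exp (x • A), by
    rw [Matrix.mem_unitaryGroup_iff, Matrix.star_eq_conjTranspose, ← Matrix.exp_conjTranspose,
      Matrix.conjTranspose_smul, hA, star_trivial, smul_neg, Matrix.exp_neg]
    exact Matrix.mul_nonsing_inv _ ((Matrix.isUnit_iff_isUnit_det _).1 (Matrix.isUnit_exp _))⟩

theorem unitaryFlow_zero (A : Matrix n n ℂ) (hA : A.conjTranspose = -A) :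
    unitaryFlow A hA 0 = 1 := by
  apply Subtype.ext
  simp [unitaryFlow]

theorem unitaryFlow_add (A : Matrix n n ℂ) (hA : A.conjTranspose = -A) (x y : ℝ) :
    unitaryFlow A hA (x + y) = unitaryFlow A hA x * unitaryFlow A hA y := by
  apply Subtype.ext
  simp only [unitaryFlow, add_smul, Submonoid.mk_mul_mk]
  exact Matrix.exp_add_of_commute _ _ (((Commute.refl A).smul_left x).smul_right y)

open scoped Matrix.Norms.Operator in
theorem hasDerivAt_unitaryFlow_apply (A : Matrix n n ℂ) (hA : A.conjTranspose = -A) (i j : n) :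
    HasDerivAt (fun x : ℝ => (unitaryFlow A hA x : Matrix n n ℂ) i j) (A i j) 0 := by
  have h := hasDerivAt_exp_smul_const (𝕂 := ℝ) A 0
  rw [zero_smul, NormedSpace.exp_zero, one_mul] at h
  exact (hasDerivAt_pi.1 ((hasDerivAt_pi.1 h) i)) j

end Flow

/-! ### Derivatives of observables on the unitary group -/

section Observables

variable {n : Type*} [Fintype n] [DecidableEq n]

variable (n) in
/-- Continuous complex observables on the unitary group. -/
abbrev Observable := C(Matrix.unitaryGroup n ℂ, ℂ)

/-- A constant matrix, seen as a matrix of observables. -/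
noncomputable def constMatrix (A : Matrix n n ℂ) : Matrix n n (Observable n) :=
  A.map (algebraMap ℂ (Observable n))

/-- `IsDerivative F D` says that, for each skew-Hermitian matrix `A`, the derivative at `x = 0` of
the observable `F` along `U ↦ U exp (x A)` is `D A`. The map `D` is required to be linear over the
observables, so that it can be evaluated at matrices which depend on `U`. -/
structure IsDerivative (F : Observable n) (D : Matrix n n (Observable n) → Observable n) :
    Prop where
  isLinearMap : IsLinearMap (Observable n) D
  hasDerivAt : ∀ (A : Matrix n n ℂ) (hA : A.conjTranspose = -A) (U : Matrix.unitaryGroup n ℂ),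
    HasDerivAt (fun x : ℝ => F (U * unitaryFlow A hA x)) (D (constMatrix A) U) 0

namespace IsDerivative

variable {F G : Observable n} {D D' : Matrix n n (Observable n) → Observable n}

theorem const (c : ℂ) : IsDerivative (algebraMap ℂ (Observable n) c) (fun _ => 0) where
  isLinearMap := ⟨fun _ _ => by simp, fun _ _ => by simp⟩
  hasDerivAt A hA U := by simpa using hasDerivAt_const (0 : ℝ) c

theorem zero : IsDerivative (0 : Observable n) (fun _ => 0) := by
  simpa using const (n := n) 0

theorem add (hF : IsDerivative F D) (hG : IsDerivative G D') :
    IsDerivative (F + G) (fun A => D A + D' A) where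
  isLinearMap := ⟨fun A B => by rw [hF.1.map_add, hG.1.map_add]; ring,
    fun c A => by rw [hF.1.map_smul, hG.1.map_smul, smul_add]⟩
  hasDerivAt A hA U := (hF.2 A hA U).add (hG.2 A hA U)

theorem mul (hF : IsDerivative F D) (hG : IsDerivative G D') :
    IsDerivative (F * G) (fun A => D A * G + F * D' A) where
  isLinearMap := ⟨fun A B => by rw [hF.1.map_add, hG.1.map_add]; ring,
    fun c A => by rw [hF.1.map_smul, hG.1.map_smul]; simp only [smul_eq_mul]; ring⟩
  hasDerivAt A hA U := by
    have := (hF.2 A hA U).mul (hG.2 A hA U)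
    simpa [unitaryFlow_zero] using! this

theorem sum {ι : Type*} (s : Finset ι) {F : ι → Observable n}
    {D : ι → Matrix n n (Observable n) → Observable n} (h : ∀ i ∈ s, IsDerivative (F i) (D i)) :
    IsDerivative (∑ i ∈ s, F i) (fun A => ∑ i ∈ s, D i A) := by
  classical
  induction s using Finset.induction_on with
  | empty => simpa using zero (n := n)
  | insert a s ha ih =>
    simp only [Finset.sum_insert ha]
    exact (h a (by simp)).add (ih fun i hi => h i (by simp [hi]))

/-- Haar averages of derivatives vanish in skew-Hermitian directions, because the average of `F` is
invariant under right translations. -/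
theorem integral_eq_zero_of_skew (hF : IsDerivative F D) (A : Matrix n n ℂ)
    (hA : A.conjTranspose = -A) :
    ∫ U, D (constMatrix A) U ∂haarUnitary n = 0 := by
  have hder : ∀ (U : Matrix.unitaryGroup n ℂ) (x : ℝ),
      HasDerivAt (fun y : ℝ => F (U * unitaryFlow A hA y))
        (D (constMatrix A) (U * unitaryFlow A hA x)) x := by
    intro U x
    have h := hF.2 A hA (U * unitaryFlow A hA x)
    have h2 : HasDerivAt (fun y : ℝ => y - x) 1 x := (hasDerivAt_id x).sub_const x
    have h3 := HasDerivAt.scomp_of_eq (x := x) h h2 (by simp)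
    rw [one_smul] at h3
    refine h3.congr_of_eventuallyEq (Filter.Eventually.of_forall fun y => ?_)
    simp [mul_assoc, ← unitaryFlow_add]
  have key := (hasDerivAt_integral_of_dominated_loc_of_deriv_le (μ := haarUnitary n)
    (F := fun (x : ℝ) U => F (U * unitaryFlow A hA x))
    (F' := fun (x : ℝ) U => D (constMatrix A) (U * unitaryFlow A hA x))
    (bound := fun _ => ‖D (constMatrix A)‖) (x₀ := 0) Filter.univ_mem
    (Filter.Eventually.of_forall fun x => Continuous.aestronglyMeasurable (by fun_prop))
    ((ContinuousMap.continuous _).comp (continuous_mul_const _) |>.integrable_of_hasCompactSupport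
      (HasCompactSupport.of_compactSpace _))
    (Continuous.aestronglyMeasurable (by fun_prop))
    (Filter.Eventually.of_forall fun U x _ => ContinuousMap.norm_coe_le_norm _ _)
    (integrable_const _)
    (Filter.Eventually.of_forall fun U x _ => hder U x)).2
  have hconst : (fun x : ℝ => ∫ U, F (U * unitaryFlow A hA x) ∂haarUnitary n) =
      fun _ => ∫ U, F U ∂haarUnitary n := by
    funext x
    exact integral_mul_right_eq_self _ _
  rw [hconst] at key
  have := key.unique (hasDerivAt_const (0 : ℝ) _)
  simpa [unitaryFlow_zero] using this

theorem _root_.ChaoticTransport.integrable_observable (F : Observable n) :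
    Integrable (fun U => F U) (haarUnitary n) :=
  F.continuous.integrable_of_hasCompactSupport (HasCompactSupport.of_compactSpace _)

/-- Both sides being complex linear in `A`, the vanishing extends from skew-Hermitian matrices to
all complex matrices. -/
theorem integral_eq_zero (hF : IsDerivative F D) (A : Matrix n n ℂ) :
    ∫ U, D (constMatrix A) U ∂haarUnitary n = 0 := by
  set B : Matrix n n ℂ := (2⁻¹ : ℂ) • (A - A.conjTranspose) with hB
  set C : Matrix n n ℂ := (-(Complex.I * 2⁻¹)) • (A + A.conjTranspose) with hC
  have hBs : B.conjTranspose = -B := by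
    rw [hB, Matrix.conjTranspose_smul, Matrix.conjTranspose_sub, Matrix.conjTranspose_conjTranspose,
      ← smul_neg, neg_sub]
    simp
  have hCs : C.conjTranspose = -C := by
    rw [hC, Matrix.conjTranspose_smul, Matrix.conjTranspose_add, Matrix.conjTranspose_conjTranspose,
      ← neg_smul, add_comm]
    simp
  have hA : constMatrix A =
      constMatrix B + algebraMap ℂ (Observable n) Complex.I • constMatrix C := by
    ext i j U
    have halg : ∀ c : ℂ, algebraMap ℂ (Observable n) c U = c := fun c => rfl
    simp only [constMatrix, hB, hC, Matrix.map_apply, Matrix.add_apply, Matrix.smul_apply,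
      Matrix.sub_apply, smul_eq_mul, ContinuousMap.add_apply, ContinuousMap.mul_apply, halg]
    linear_combination ((2⁻¹ : ℂ) * (A i j + A.conjTranspose i j)) * Complex.I_mul_I
  rw [hA, hF.1.map_add, hF.1.map_smul]
  have h1 : ∀ U, (D (constMatrix B) + algebraMap ℂ (Observable n) Complex.I • D (constMatrix C)) U
      = D (constMatrix B) U + Complex.I * D (constMatrix C) U := fun U => by simp
  simp only [h1]
  rw [integral_add (integrable_observable _) ((integrable_observable _).const_mul _),
    integral_const_mul, hF.integral_eq_zero_of_skew B hBs, hF.integral_eq_zero_of_skew C hCs]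
  simp

end IsDerivative

/-- `IsDerivative`, entry by entry, for a matrix of observables. -/
def IsMatrixDerivative (X : Matrix n n (Observable n))
    (D : Matrix n n (Observable n) → Matrix n n (Observable n)) : Prop :=
  ∀ i j, IsDerivative (X i j) (fun A => D A i j)

namespace IsMatrixDerivative

variable {X Y : Matrix n n (Observable n)}
  {D D' : Matrix n n (Observable n) → Matrix n n (Observable n)}

theorem mul (hX : IsMatrixDerivative X D) (hY : IsMatrixDerivative Y D') :
    IsMatrixDerivative (X * Y) (fun A => D A * Y + X * D' A) := by
  intro i j
  have := IsDerivative.sum Finset.univ fun k _ => (hX i k).mul (hY k j)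
  simpa only [Matrix.mul_apply, Matrix.add_apply, Finset.sum_add_distrib] using this

theorem const (A : Matrix n n ℂ) : IsMatrixDerivative (constMatrix A) (fun _ => 0) :=
  fun i j => IsDerivative.const (A i j)

theorem one : IsMatrixDerivative (1 : Matrix n n (Observable n)) (fun _ => 0) := by
  have := const (1 : Matrix n n ℂ)
  rwa [constMatrix, Matrix.map_one _ (map_zero _) (map_one _)] at this

theorem transpose (hX : IsMatrixDerivative X D) :
    IsMatrixDerivative X.transpose (fun A => (D A).transpose) :=
  fun i j => hX j i

theorem pow (hX : IsMatrixDerivative X D) (k : ℕ) :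
    IsMatrixDerivative (X ^ k)
      (fun A => ∑ l ∈ Finset.range k, X ^ l * D A * X ^ (k - 1 - l)) := by
  induction k with
  | zero => simpa using one
  | succ k ih =>
    have := ih.mul hX
    rw [← pow_succ] at this
    convert this using 2 with A
    rw [Finset.sum_range_succ, Finset.sum_mul]
    congr 1
    · refine Finset.sum_congr rfl fun l hl => ?_
      rw [Finset.mem_range] at hl
      rw [mul_assoc _ _ X, ← pow_succ]
      congr 2
      omega
    · simp

theorem trace (hX : IsMatrixDerivative X D) :
    IsDerivative X.trace (fun A => (D A).trace) :=
  IsDerivative.sum Finset.univ fun i _ => hX i i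

end IsMatrixDerivative

/-- The matrix of coordinate functions on the unitary group. -/
noncomputable def coordMatrix (n : Type*) [Fintype n] [DecidableEq n] :
    Matrix n n (Observable n) :=
  Matrix.of fun i j => ⟨fun U => (U : Matrix n n ℂ) i j,
    continuous_subtype_val.matrix_elem i j⟩

/-- The entrywise conjugate of `coordMatrix`. -/
noncomputable def coordConjMatrix (n : Type*) [Fintype n] [DecidableEq n] :
    Matrix n n (Observable n) :=
  Matrix.of fun i j => ⟨fun U => star ((U : Matrix n n ℂ) i j),
    (continuous_subtype_val.matrix_elem i j).star⟩

theorem isMatrixDerivative_coordMatrix :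
    IsMatrixDerivative (coordMatrix n) (fun A => coordMatrix n * A) := by
  refine fun i j => ⟨⟨fun A B => ?_, fun c A => ?_⟩, fun A hA U => ?_⟩
  · beta_reduce
    rw [mul_add, Matrix.add_apply]
  · beta_reduce
    rw [Matrix.mul_smul, Matrix.smul_apply]
  · have h := HasDerivAt.fun_sum (u := Finset.univ) fun k _ =>
      (hasDerivAt_unitaryFlow_apply A hA k j).const_mul ((U : Matrix n n ℂ) i k)
    convert! h using 1
    simp [coordMatrix, constMatrix, Matrix.mul_apply, ContinuousMap.sum_apply]

/-- Here the skew-Hermitian symmetry is used: the conjugate of `A` is `-Aᵀ`, and so the derivative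
becomes linear, not antilinear, in `A`. -/
theorem isMatrixDerivative_coordConjMatrix :
    IsMatrixDerivative (coordConjMatrix n) (fun A => -(coordConjMatrix n * A.transpose)) := by
  refine fun i j => ⟨⟨fun A B => ?_, fun c A => ?_⟩, fun A hA U => ?_⟩
  · beta_reduce
    rw [Matrix.transpose_add, mul_add, neg_add, Matrix.add_apply]
  · beta_reduce
    rw [Matrix.transpose_smul, Matrix.mul_smul, ← smul_neg, Matrix.smul_apply]
  · have h := (HasDerivAt.fun_sum (u := Finset.univ) fun k _ =>
      (hasDerivAt_unitaryFlow_apply A hA k j).const_mul ((U : Matrix n n ℂ) i k)).star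
    have hA' : ∀ k l, star (A k l) = -A l k := fun k l => by
      rw [← Matrix.conjTranspose_apply, hA, Matrix.neg_apply]
    convert! h using 1
    rw [star_sum]
    simp only [star_mul', hA', coordConjMatrix, constMatrix, Matrix.mul_apply, Matrix.neg_apply,
      ContinuousMap.neg_apply, ContinuousMap.sum_apply, Matrix.transpose_apply, mul_neg,
      Finset.sum_neg_distrib]
    rfl

end Observables

/-! ### Traces of words in two projections with a time-reversal involution -/

section TraceIdentities

open Matrix

variable {n R : Type*} [Fintype n] [DecidableEq n] [CommRing R]

theorem sum_mul_single_mul_apply (X Y : Matrix n n R) :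
    ∑ i, ∑ j, (X * single i j 1 * Y : Matrix n n R) i j = X.trace * Y.trace := by
  have h : ∀ i j, (X * single i j 1 * Y : Matrix n n R) i j = X i i * Y j j := by
    intro i j
    rw [mul_assoc, mul_apply, Finset.sum_eq_single i]
    · simp
    · intro k _ hk
      rw [single_mul_apply_of_ne _ _ _ _ _ hk, mul_zero]
    · simp
  simp only [h, trace, diag_apply, Finset.sum_mul_sum]

/-- The map `X ↦ S' Xᵀ S`. When `S` is symmetric with inverse `S'`, this is the involution which
time-reversal symmetry adds to the algebra generated by two projections. -/
def timeReversal (S S' X : Matrix n n R) : Matrix n n R := S' * Xᵀ * S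

theorem sum_mul_timeReversal_single_mul_apply {S S' : Matrix n n R} (hS : Sᵀ = S)
    (X Y : Matrix n n R) :
    ∑ i, ∑ j, (X * timeReversal S S' (single i j 1) * Y : Matrix n n R) i j =
      (X * timeReversal S S' Y).trace := by
  have h : ∀ i j, (X * timeReversal S S' (single i j 1) * Y : Matrix n n R) i j =
      (X * S') i j * (S * Y) i j := by
    intro i j
    rw [timeReversal, transpose_single, ← mul_assoc, ← mul_assoc, mul_assoc, mul_apply,
      Finset.sum_eq_single i]
    · simp
    · intro k _ hk
      rw [mul_single_apply_of_ne _ _ _ _ _ hk, zero_mul]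
    · simp
  have h2 : X * timeReversal S S' Y = (X * S') * (S * Y)ᵀ := by
    rw [timeReversal, transpose_mul, hS, mul_assoc, mul_assoc]
  simp only [h, h2, trace, diag_apply, mul_apply (M := X * S'), transpose_apply]

/-- The algebraic data behind the loop equations: a symmetric invertible matrix `S` with symmetric
inverse `S'`, and a symmetric projection `P`. -/
structure ScatteringData (P S S' : Matrix n n R) : Prop where
  proj_mul_proj : P * P = P
  transpose_proj : Pᵀ = P
  transpose_scat : Sᵀ = S
  transpose_inv : S'ᵀ = S'
  inv_mul : S' * S = 1
  mul_inv : S * S' = 1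

/-- The projection `S' (1 - P) S`. For the scattering matrix `S`, its compression to the range
of `P` is `t† t`. -/
def transmittedProj (P S S' : Matrix n n R) : Matrix n n R := S' * (1 - P) * S

/-- The variation `P [Q, A + σ A]`, with `Q` the transmitted projection and `σ` the time reversal:
the derivative of `P Q` when `S` moves by `Aᵀ S + S A`. -/
def transmittedVariation (P S S' A : Matrix n n R) : Matrix n n R :=
  P * (transmittedProj P S S' * (A + timeReversal S S' A) -
    (A + timeReversal S S' A) * transmittedProj P S S')

/-- The left hand side `(N + k) p_k + ∑ p_l p_(k-l)` of the `k`-th loop equation. -/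
def loopTerm (N : R) (p : ℕ → R) (k : ℕ) : R :=
  (N + k) * p k + ∑ l ∈ Finset.Ico 1 k, p l * p (k - l)

namespace ScatteringData

variable {P S S' : Matrix n n R}

local notation "Q" => transmittedProj P S S'
local notation "M" => P * transmittedProj P S S'
local notation "Z" => (1 - P) * (1 - transmittedProj P S S')
local notation "σ" => timeReversal S S'

theorem transmittedProj_mul_self (h : ScatteringData P S S') : Q * Q = Q := by
  have h1 : (1 - P) * (1 - P) = 1 - P := by
    rw [mul_sub, sub_mul, sub_mul, h.proj_mul_proj]; noncomm_ring
  calc S' * (1 - P) * S * (S' * (1 - P) * S) = S' * ((1 - P) * (S * S') * (1 - P)) * S := by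
        noncomm_ring
    _ = S' * (1 - P) * S := by rw [h.mul_inv, mul_one, h1]

theorem trace_transmittedProj (h : ScatteringData P S S') :
    (Q).trace = (1 : Matrix n n R).trace - P.trace := by
  rw [transmittedProj, trace_mul_comm, ← mul_assoc, h.mul_inv, one_mul, trace_sub]

theorem timeReversal_mul (h : ScatteringData P S S') (X Y : Matrix n n R) :
    σ (X * Y) = σ Y * σ X := by
  simp only [timeReversal, transpose_mul]
  calc S' * (Yᵀ * Xᵀ) * S = S' * Yᵀ * 1 * Xᵀ * S := by noncomm_ring
    _ = _ := by rw [← h.mul_inv]; noncomm_ring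

theorem timeReversal_proj (h : ScatteringData P S S') : σ P = 1 - Q := by
  rw [timeReversal, transmittedProj, h.transpose_proj, mul_sub, sub_mul, mul_one, h.inv_mul,
    sub_sub_cancel]

theorem timeReversal_transmittedProj (h : ScatteringData P S S') : σ Q = 1 - P := by
  have h1 : (1 - P)ᵀ = 1 - P := by rw [transpose_sub, transpose_one, h.transpose_proj]
  rw [timeReversal, transmittedProj, transpose_mul, transpose_mul, h.transpose_scat,
    h.transpose_inv, h1]
  calc S' * (S * ((1 - P) * S')) * S = (S' * S) * (1 - P) * (S' * S) := by noncomm_ring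
    _ = _ := by rw [h.inv_mul, one_mul, mul_one]

theorem timeReversal_pow (h : ScatteringData P S S') (k : ℕ) : σ (M ^ k) = Z ^ k := by
  induction k with
  | zero => simp [timeReversal, h.inv_mul]
  | succ k ih =>
    rw [pow_succ, h.timeReversal_mul, ih, h.timeReversal_mul, h.timeReversal_proj,
      h.timeReversal_transmittedProj, ← pow_succ']

theorem proj_mul_pow (h : ScatteringData P S S') (k : ℕ) : P * M ^ (k + 1) = M ^ (k + 1) := by
  rw [pow_succ', ← mul_assoc, ← mul_assoc, h.proj_mul_proj]

theorem pow_mul_transmittedProj (h : ScatteringData P S S') (k : ℕ) :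
    M ^ (k + 1) * Q = M ^ (k + 1) := by
  rw [pow_succ, mul_assoc, mul_assoc, h.transmittedProj_mul_self]

theorem proj_mul_reversed_pow (h : ScatteringData P S S') (k : ℕ) : P * Z ^ (k + 1) = 0 := by
  rw [pow_succ', ← mul_assoc, ← mul_assoc, mul_sub P, h.proj_mul_proj, mul_one, sub_self, zero_mul,
    zero_mul]

/-- Together with `proj_mul_reversed_pow`, this removes the complementary projections: a trace of a
word in `P Q` and its time reversal reduces to power traces of `P Q`. -/
theorem mul_reversed_pow_mul_proj (h : ScatteringData P S S') (k : ℕ) :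
    M * Z ^ (k + 1) * P = M ^ (k + 1) * (M - 1) * P := by
  have h1 : M * Z = M * M - M * P := by
    have h2 := h.transmittedProj_mul_self
    calc P * Q * ((1 - P) * (1 - Q)) = P * Q - P * (Q * Q) - P * Q * P + P * Q * (P * Q) := by
          noncomm_ring
      _ = _ := by rw [h2]; noncomm_ring
  have h3 : M * P * P = M * P := by rw [mul_assoc, h.proj_mul_proj]
  induction k with
  | zero =>
    rw [zero_add, pow_one, pow_one, h1, sub_mul, h3, mul_sub, mul_one, sub_mul]
  | succ k ih =>
    calc M * Z ^ (k + 2) * P = M * Z * Z ^ (k + 1) * P := by rw [pow_succ' _ (k + 1)]; noncomm_ring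
      _ = M * (M * Z ^ (k + 1) * P) - M * (P * Z ^ (k + 1)) * P := by rw [h1]; noncomm_ring
      _ = _ := by
        rw [ih, h.proj_mul_reversed_pow, pow_succ' _ (k + 1)]
        noncomm_ring

theorem trace_pow_mul_proj (h : ScatteringData P S S') (k : ℕ) :
    (M ^ (k + 1) * P).trace = (M ^ (k + 1)).trace := by
  rw [trace_mul_comm, h.proj_mul_pow]

theorem trace_transmittedProj_mul_pow (h : ScatteringData P S S') (k : ℕ) :
    (Q * M ^ (k + 1)).trace = (M ^ (k + 1)).trace := by
  rw [trace_mul_comm, h.pow_mul_transmittedProj]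

theorem trace_pow_mul_reversed_pow (h : ScatteringData P S S') (l k : ℕ) :
    (M ^ (l + 1) * Z ^ (k + 1)).trace = (M ^ (l + k + 2)).trace - (M ^ (l + k + 1)).trace := by
  have h1 : M ^ (l + 1) * Z ^ (k + 1) * P = M ^ (l + k + 2) * P - M ^ (l + k + 1) * P := by
    rw [pow_succ, mul_assoc, mul_assoc, ← mul_assoc M, h.mul_reversed_pow_mul_proj, ← mul_assoc,
      ← mul_assoc, ← pow_add, mul_sub, mul_one, ← pow_succ, sub_mul]
    rfl
  rw [← h.proj_mul_pow l, mul_assoc, trace_mul_comm, h1, trace_sub, h.trace_pow_mul_proj,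
    h.trace_pow_mul_proj]

/-- The divergence of the vector field `(P Q) ^ k`. The time-reversed part of the variation is
responsible for the terms `k p_k`. -/
theorem divergence_pow (h : ScatteringData P S S') (k : ℕ) :
    ∑ i, ∑ j, (∑ l ∈ Finset.range (k + 1),
        M ^ l * transmittedVariation P S S' (single i j 1) * M ^ (k - l) : Matrix n n R) i j =
      ∑ l ∈ Finset.range (k + 1), ((M ^ (l + 1)).trace * (M ^ (k - l)).trace
        - (M ^ l * P).trace * (Q * M ^ (k - l)).trace + (M ^ (l + 1) * Z ^ (k - l)).trace) := by
  have hl : ∀ l, ∑ i, ∑ j, (M ^ l * transmittedVariation P S S' (single i j 1) * M ^ (k - l) :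
      Matrix n n R) i j = (M ^ (l + 1)).trace * (M ^ (k - l)).trace
        - (M ^ l * P).trace * (Q * M ^ (k - l)).trace + (M ^ (l + 1) * Z ^ (k - l)).trace := by
    intro l
    have hexp : ∀ E : Matrix n n R, M ^ l * transmittedVariation P S S' E * M ^ (k - l) =
        (M ^ (l + 1)) * E * M ^ (k - l) - (M ^ l * P) * E * (Q * M ^ (k - l))
        + ((M ^ (l + 1)) * σ E * M ^ (k - l) - (M ^ l * P) * σ E * (Q * M ^ (k - l))) := by
      intro E
      rw [transmittedVariation, pow_succ]
      noncomm_ring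
    have hzero : (M ^ l * P * σ (Q * M ^ (k - l))).trace = 0 := by
      have h1 : (1 - P) * (M ^ l * P) = 0 := by
        cases l with
        | zero => rw [pow_zero, one_mul, sub_mul, one_mul, h.proj_mul_proj, sub_self]
        | succ l => rw [← mul_assoc, sub_mul, h.proj_mul_pow, one_mul, sub_self, zero_mul]
      rw [h.timeReversal_mul, h.timeReversal_transmittedProj, ← mul_assoc, trace_mul_comm,
        ← mul_assoc, h1, zero_mul, trace_zero]
    simp only [hexp, Matrix.add_apply, Matrix.sub_apply, Finset.sum_add_distrib,
      Finset.sum_sub_distrib, sum_mul_single_mul_apply,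
      sum_mul_timeReversal_single_mul_apply h.transpose_scat, hzero, sub_zero, h.timeReversal_pow]
  simp only [← hl, Matrix.sum_apply]
  rw [Finset.sum_comm (s := Finset.range (k + 1))]
  refine Finset.sum_congr rfl fun i _ => ?_
  rw [Finset.sum_comm (s := Finset.range (k + 1))]

/-- The divergence of `P Q` itself brings in `Tr P Tr Q`, the source of the loop equations. -/
theorem divergence_pow_zero (h : ScatteringData P S S') :
    ∑ i, ∑ j, (∑ l ∈ Finset.range 1,
        M ^ l * transmittedVariation P S S' (single i j 1) * M ^ (0 - l) : Matrix n n R) i j =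
      loopTerm (1 : Matrix n n R).trace (fun l => (M ^ l).trace) 1 - P.trace * (Q).trace := by
  rw [h.divergence_pow 0]
  simp [loopTerm]
  ring

/-- The divergence of `(P Q) ^ (k + 2)` is a difference of consecutive loop terms, so that the
divergences telescope. -/
theorem divergence_pow_succ (h : ScatteringData P S S') (k : ℕ) :
    ∑ i, ∑ j, (∑ l ∈ Finset.range (k + 2),
        M ^ l * transmittedVariation P S S' (single i j 1) * M ^ (k + 1 - l) : Matrix n n R) i j =
      loopTerm (1 : Matrix n n R).trace (fun l => (M ^ l).trace) (k + 2) -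
        loopTerm (1 : Matrix n n R).trace (fun l => (M ^ l).trace) (k + 1) := by
  rw [h.divergence_pow (k + 1), Finset.sum_add_distrib, Finset.sum_sub_distrib]
  have h1 : ∑ l ∈ Finset.range (k + 2), (M ^ (l + 1)).trace * (M ^ (k + 1 - l)).trace =
      (∑ l ∈ Finset.Ico 1 (k + 2), (M ^ l).trace * (M ^ (k + 2 - l)).trace) +
        (M ^ (k + 2)).trace * (1 : Matrix n n R).trace := by
    rw [Finset.sum_range_succ, Finset.sum_Ico_eq_sum_range]
    congr 1
    · refine Finset.sum_congr rfl fun l _ => ?_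
      rw [add_comm 1 l, show k + 2 - (l + 1) = k + 1 - l by omega]
    · simp
  have h2 : ∑ l ∈ Finset.range (k + 2), (M ^ l * P).trace * (Q * M ^ (k + 1 - l)).trace =
      (∑ l ∈ Finset.Ico 1 (k + 1), (M ^ l).trace * (M ^ (k + 1 - l)).trace) +
        (M ^ (k + 1)).trace * (1 : Matrix n n R).trace := by
    rw [Finset.sum_range_succ, Finset.sum_range_succ', Finset.sum_Ico_eq_sum_range]
    simp only [pow_zero, one_mul, Nat.sub_zero, Nat.sub_self, mul_one, h.trace_pow_mul_proj,
      h.trace_transmittedProj_mul_pow, h.trace_transmittedProj, Nat.add_sub_cancel]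
    have h3 : ∀ l ∈ Finset.range k, (M ^ (l + 1)).trace * (Q * M ^ (k + 1 - (l + 1))).trace =
        (M ^ (1 + l)).trace * (M ^ (k + 1 - (1 + l))).trace := by
      intro l hl
      rw [Finset.mem_range] at hl
      rw [show k + 1 - (l + 1) = (k - l - 1) + 1 by omega, h.trace_transmittedProj_mul_pow,
        show k + 1 - (1 + l) = (k - l - 1) + 1 by omega, add_comm 1 l]
    rw [Finset.sum_congr rfl h3]
    ring
  have h4 : ∑ l ∈ Finset.range (k + 2), (M ^ (l + 1) * Z ^ (k + 1 - l)).trace =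
      (k + 2) * (M ^ (k + 2)).trace - (k + 1) * (M ^ (k + 1)).trace := by
    rw [Finset.sum_range_succ]
    have h3 : ∀ l ∈ Finset.range (k + 1), (M ^ (l + 1) * Z ^ (k + 1 - l)).trace =
        (M ^ (k + 2)).trace - (M ^ (k + 1)).trace := by
      intro l hl
      rw [Finset.mem_range] at hl
      rw [show k + 1 - l = (k - l) + 1 by omega, h.trace_pow_mul_reversed_pow,
        show l + (k - l) = k by omega]
    rw [Finset.sum_congr rfl h3]
    simp
    ring
  rw [h1, h2, h4, loopTerm, loopTerm]
  push_cast
  ring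

/-- The derivative of the power trace `p_m` along the vector field `(P Q) ^ k`. -/
theorem trace_pow_derivative (h : ScatteringData P S S') (m k : ℕ) :
    (∑ l ∈ Finset.range m,
      M ^ l * transmittedVariation P S S' (M ^ (k + 1)) * M ^ (m - 1 - l)).trace =
      2 * m * ((M ^ (m + k + 1)).trace - (M ^ (m + k)).trace) := by
  cases m with
  | zero => simp
  | succ m =>
  have key : (M ^ m * transmittedVariation P S S' (M ^ (k + 1))).trace =
      2 * ((M ^ (m + 1 + k + 1)).trace - (M ^ (m + 1 + k)).trace) := by
    have e : M ^ m * transmittedVariation P S S' (M ^ (k + 1)) =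
        M ^ (m + 1) * M ^ (k + 1) - M ^ m * (P * M ^ (k + 1) * Q)
        + (M ^ (m + 1) * Z ^ (k + 1) - M ^ m * (P * Z ^ (k + 1)) * Q) := by
      rw [transmittedVariation, h.timeReversal_pow, pow_succ _ m]
      noncomm_ring
    rw [e, h.proj_mul_reversed_pow, h.proj_mul_pow, h.pow_mul_transmittedProj, ← pow_add, ← pow_add,
      mul_zero, zero_mul, sub_zero, trace_add, trace_sub, h.trace_pow_mul_reversed_pow,
      show m + 1 + (k + 1) = m + 1 + k + 1 by ring, show m + (k + 1) = m + 1 + k by ring,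
      show m + k + 2 = m + 1 + k + 1 by ring, show m + k + 1 = m + 1 + k by ring]
    ring
  have h2 : ∀ l ∈ Finset.range (m + 1),
      (M ^ l * transmittedVariation P S S' (M ^ (k + 1)) * M ^ (m + 1 - 1 - l)).trace =
      2 * ((M ^ (m + 1 + k + 1)).trace - (M ^ (m + 1 + k)).trace) := by
    intro l hl
    rw [Finset.mem_range] at hl
    rw [trace_mul_comm, ← mul_assoc, ← pow_add, show m + 1 - 1 - l + l = m by omega, key]
  rw [trace_sum, Finset.sum_congr rfl h2]
  simp
  ring

end ScatteringData
end TraceIdentities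

/-! ### Loop equations -/

section LoopEquation

open Matrix

variable {n : Type*} [Fintype n] [DecidableEq n]

theorem IsDerivative.multiset_prod {ι : Type*} [DecidableEq ι] {f : ι → Observable n}
    {D : ι → Matrix n n (Observable n) → Observable n} (h : ∀ i, IsDerivative (f i) (D i))
    (s : Multiset ι) :
    IsDerivative (s.map f).prod
      (fun A => (s.map fun i => ((s.erase i).map f).prod * D i A).sum) := by
  induction s using Multiset.induction_on with
  | empty => simpa using IsDerivative.const (n := n) 1
  | cons a s ih =>
    rw [Multiset.map_cons, Multiset.prod_cons]
    convert (h a).mul ih using 2 with A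
    rw [Multiset.map_cons, Multiset.sum_cons, Multiset.erase_cons_head, mul_comm (D a A),
      ← Multiset.sum_map_mul_left]
    congr 2
    refine Multiset.map_congr rfl fun j hj => ?_
    by_cases hij : a = j
    · subst hij
      rw [Multiset.erase_cons_head, ← mul_assoc, ← Multiset.prod_cons, ← Multiset.map_cons,
        Multiset.cons_erase hj]
    · rw [Multiset.erase_cons_tail _ (fun h => hij h), Multiset.map_cons, Multiset.prod_cons,
        mul_assoc]

variable (n) in
/-- The matrix `S = Uᵀ U` of observables. -/
noncomputable def scatMatrix : Matrix n n (Observable n) := (coordMatrix n)ᵀ * coordMatrix n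

variable (n) in
/-- The entrywise conjugate of `S = Uᵀ U`, which is also its inverse. -/
noncomputable def scatConjMatrix : Matrix n n (Observable n) :=
  (coordConjMatrix n)ᵀ * coordConjMatrix n

theorem transpose_coordConjMatrix_mul_coordMatrix :
    (coordConjMatrix n)ᵀ * coordMatrix n = 1 := by
  ext i j U
  have h := congrFun (congrFun (Matrix.mem_unitaryGroup_iff'.1 U.2) i) j
  rw [Matrix.mul_apply] at h
  simpa [Matrix.mul_apply, coordConjMatrix, coordMatrix, ContinuousMap.sum_apply, Matrix.one_apply,
    apply_ite (fun f : Observable n => f U)] using h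

theorem coordMatrix_mul_transpose_coordConjMatrix :
    coordMatrix n * (coordConjMatrix n)ᵀ = 1 :=
  mul_eq_one_comm.1 transpose_coordConjMatrix_mul_coordMatrix

theorem transpose_coordMatrix_mul_coordConjMatrix :
    (coordMatrix n)ᵀ * coordConjMatrix n = 1 := by
  have := congrArg transpose (transpose_coordConjMatrix_mul_coordMatrix (n := n))
  rwa [transpose_mul, transpose_transpose, transpose_one] at this

theorem coordConjMatrix_mul_transpose_coordMatrix :
    coordConjMatrix n * (coordMatrix n)ᵀ = 1 :=
  mul_eq_one_comm.1 transpose_coordMatrix_mul_coordConjMatrix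

theorem constMatrix_eq_mapMatrix (A : Matrix n n ℂ) :
    constMatrix A = (algebraMap ℂ (Observable n)).mapMatrix A := rfl

theorem scatteringData_scatMatrix {P : Matrix n n ℂ} (hP : P * P = P) (hPT : Pᵀ = P) :
    ScatteringData (constMatrix P) (scatMatrix n) (scatConjMatrix n) where
  proj_mul_proj := by
    rw [constMatrix_eq_mapMatrix, ← map_mul, hP]
  transpose_proj := by rw [constMatrix, ← transpose_map, hPT]
  transpose_scat := by rw [scatMatrix, transpose_mul, transpose_transpose]
  transpose_inv := by rw [scatConjMatrix, transpose_mul, transpose_transpose]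
  inv_mul := by
    rw [scatMatrix, scatConjMatrix, Matrix.mul_assoc, ← Matrix.mul_assoc (coordConjMatrix n),
      coordConjMatrix_mul_transpose_coordMatrix, Matrix.one_mul,
      transpose_coordConjMatrix_mul_coordMatrix]
  mul_inv := by
    rw [scatMatrix, scatConjMatrix, Matrix.mul_assoc, ← Matrix.mul_assoc (coordMatrix n),
      coordMatrix_mul_transpose_coordConjMatrix, Matrix.one_mul,
      transpose_coordMatrix_mul_coordConjMatrix]

theorem isMatrixDerivative_scatMatrix :
    IsMatrixDerivative (scatMatrix n) (fun A => Aᵀ * scatMatrix n + scatMatrix n * A) := by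
  convert! isMatrixDerivative_coordMatrix.transpose.mul isMatrixDerivative_coordMatrix using 2
    with A
  rw [scatMatrix, transpose_mul]
  noncomm_ring

theorem isMatrixDerivative_scatConjMatrix :
    IsMatrixDerivative (scatConjMatrix n)
      (fun A => -(A * scatConjMatrix n) - scatConjMatrix n * Aᵀ) := by
  convert! isMatrixDerivative_coordConjMatrix.transpose.mul isMatrixDerivative_coordConjMatrix
    using 2 with A
  rw [scatConjMatrix, transpose_neg, transpose_mul, transpose_transpose]
  noncomm_ring

/-- The product `P Q` of the two projections which govern transmission. -/
noncomputable def transmittedProduct (P : Matrix n n ℂ) : Matrix n n (Observable n) :=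
  constMatrix P * transmittedProj (constMatrix P) (scatMatrix n) (scatConjMatrix n)

theorem isMatrixDerivative_transmittedProduct {P : Matrix n n ℂ} (hP : P * P = P) (hPT : Pᵀ = P) :
    IsMatrixDerivative (transmittedProduct P)
      (transmittedVariation (constMatrix P) (scatMatrix n) (scatConjMatrix n)) := by
  have h := scatteringData_scatMatrix hP hPT
  have h1 : IsMatrixDerivative (1 - constMatrix P) (fun _ => 0) := by
    have := IsMatrixDerivative.const (1 - P)
    rwa [constMatrix_eq_mapMatrix, map_sub, map_one] at this
  convert! (IsMatrixDerivative.const P).mul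
    ((isMatrixDerivative_scatConjMatrix.mul h1).mul isMatrixDerivative_scatMatrix) using 2 with A
  have e1 : transmittedProj (constMatrix P) (scatMatrix n) (scatConjMatrix n) *
      timeReversal (scatMatrix n) (scatConjMatrix n) A =
      scatConjMatrix n * (1 - constMatrix P) * Aᵀ * scatMatrix n := by
    rw [transmittedProj, timeReversal]
    calc _ = scatConjMatrix n * (1 - constMatrix P) * (scatMatrix n * scatConjMatrix n) * Aᵀ *
          scatMatrix n := by noncomm_ring
      _ = _ := by rw [h.mul_inv]; noncomm_ring
  have e2 : timeReversal (scatMatrix n) (scatConjMatrix n) A *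
      transmittedProj (constMatrix P) (scatMatrix n) (scatConjMatrix n) =
      scatConjMatrix n * Aᵀ * (1 - constMatrix P) * scatMatrix n := by
    rw [transmittedProj, timeReversal]
    calc _ = scatConjMatrix n * Aᵀ * (scatMatrix n * scatConjMatrix n) * (1 - constMatrix P) *
          scatMatrix n := by noncomm_ring
      _ = _ := by rw [h.mul_inv]; noncomm_ring
  rw [transmittedVariation, mul_add, add_mul, e1, e2, transmittedProj]
  noncomm_ring

/-- The complex Haar average. -/
noncomputable def complexMean : Observable n →ₗ[ℂ] ℂ where
  toFun f := ∫ U, f U ∂haarUnitary n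
  map_add' f g := integral_add (integrable_observable f) (integrable_observable g)
  map_smul' c _ := integral_const_mul c _

/-- Integration by parts: the average of the divergence of `F W` vanishes for every vector field
`W`. -/
theorem complexMean_divergence {F : Observable n} {D : Matrix n n (Observable n) → Observable n}
    (hF : IsDerivative F D) {W : Matrix n n (Observable n)}
    {DW : Matrix n n (Observable n) → Matrix n n (Observable n)} (hW : IsMatrixDerivative W DW) :
    complexMean ((∑ i, ∑ j, DW (single i j 1) i j) * F + D W) = 0 := by
  have h1 : D W = ∑ i, ∑ j, W i j * D (single i j 1) := by
    conv_lhs => rw [matrix_eq_sum_single W]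
    have hl := hF.isLinearMap
    let L : Matrix n n (Observable n) →ₗ[Observable n] Observable n := hl.mk' D
    change L _ = _
    rw [map_sum]
    refine Finset.sum_congr rfl fun i _ => ?_
    rw [map_sum]
    refine Finset.sum_congr rfl fun j _ => ?_
    rw [← smul_eq_mul (W i j), ← hl.map_smul, smul_single, smul_eq_mul, mul_one]
    rfl
  have h2 : ∀ i j, complexMean (DW (single i j 1) i j * F + W i j * D (single i j 1)) = 0 := by
    intro i j
    have h := ((hW i j).mul hF).integral_eq_zero (single i j 1)
    have hs : constMatrix (single i j (1 : ℂ)) = single i j 1 := by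
      rw [constMatrix, map_single, map_one]
    rw [hs] at h
    exact h
  rw [h1, Finset.sum_mul, ← Finset.sum_add_distrib, map_sum]
  refine Finset.sum_eq_zero fun i _ => ?_
  rw [Finset.sum_mul, ← Finset.sum_add_distrib, map_sum]
  exact Finset.sum_eq_zero fun j _ => h2 i j

/-- The trace of `(P Q) ^ k` as a complex observable. -/
noncomputable def complexTrace (P : Matrix n n ℂ) (k : ℕ) : Observable n :=
  (transmittedProduct P ^ k).trace

/-- The product of the shifted traces `p_m - c_m` over a multiset of indices `m`. -/
noncomputable def complexProd (P : Matrix n n ℂ) (c : ℕ → ℂ) (s : Multiset ℕ) : Observable n :=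
  (s.map fun m => complexTrace P m - algebraMap ℂ (Observable n) (c m)).prod

/-- Integration by parts for the vector field `(P Q) ^ (k + 1)`. -/
theorem complexMean_loop_step {P : Matrix n n ℂ} (hP : P * P = P) (hPT : Pᵀ = P) (c : ℕ → ℂ)
    (s : Multiset ℕ) (k : ℕ) :
    complexMean ((∑ i, ∑ j, (∑ l ∈ Finset.range (k + 1), transmittedProduct P ^ l *
        transmittedVariation (constMatrix P) (scatMatrix n) (scatConjMatrix n) (single i j 1) *
        transmittedProduct P ^ (k - l) : Matrix n n (Observable n)) i j) * complexProd P c s) =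
      (s.map fun m => 2 * m * complexMean (complexProd P c (s.erase m) *
        (complexTrace P (m + k) - complexTrace P (m + k + 1)))).sum := by
  have hd := isMatrixDerivative_transmittedProduct hP hPT
  have hf : ∀ m,
      IsDerivative (complexTrace P m - algebraMap ℂ (Observable n) (c m)) _ := fun m => by
    rw [sub_eq_add_neg, ← map_neg]
    exact (hd.pow m).trace.add (IsDerivative.const (-(c m)))
  have h := complexMean_divergence (IsDerivative.multiset_prod hf s) (hd.pow (k + 1))
  rw [map_add, add_eq_zero_iff_eq_neg] at h
  refine h.trans ?_
  have hval : ∀ m, _ = _ := fun m =>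
    (scatteringData_scatMatrix hP hPT).trace_pow_derivative m k
  change ∀ m, (∑ l ∈ Finset.range m, transmittedProduct P ^ l *
      transmittedVariation (constMatrix P) (scatMatrix n) (scatConjMatrix n)
        (transmittedProduct P ^ (k + 1)) * transmittedProduct P ^ (m - 1 - l)).trace =
      2 * m * (complexTrace P (m + k + 1) - complexTrace P (m + k)) at hval
  simp only [hval, add_zero]
  rw [map_multiset_sum, ← Multiset.sum_map_neg, Multiset.map_map]
  congr 1
  refine Multiset.map_congr rfl fun m _ => ?_
  have e : ((s.erase m).map fun m => complexTrace P m - algebraMap ℂ (Observable n) (c m)).prod *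
      (2 * m * (complexTrace P (m + k + 1) - complexTrace P (m + k))) =
      (-(2 * m) : ℂ) • (complexProd P c (s.erase m) *
        (complexTrace P (m + k) - complexTrace P (m + k + 1))) := by
    rw [Algebra.smul_def, complexProd]
    simp only [map_neg, map_mul, map_ofNat, map_natCast]
    ring
  rw [Function.comp_apply, e, map_smul, smul_eq_mul]
  ring

/-- The loop equations: sum the steps over the vector fields `(P Q) ^ j` with `j ≤ k`. -/
theorem complexMean_loop {P : Matrix n n ℂ} (hP : P * P = P) (hPT : Pᵀ = P) (c : ℕ → ℂ)
    (s : Multiset ℕ) (k : ℕ) :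
    complexMean ((loopTerm (Fintype.card n : Observable n) (complexTrace P) (k + 1) -
        (algebraMap ℂ _ (P.trace * (Fintype.card n - P.trace)))) * complexProd P c s) =
      (s.map fun m => 2 * m * complexMean (complexProd P c (s.erase m) *
        (complexTrace P m - complexTrace P (m + k + 1)))).sum := by
  have hsd := scatteringData_scatMatrix hP hPT
  have hN : (1 : Matrix n n (Observable n)).trace = (Fintype.card n : Observable n) := by
    rw [trace_one]
  have htr : (constMatrix P).trace = algebraMap ℂ (Observable n) P.trace := by
    rw [Matrix.trace, Matrix.trace, map_sum]
    rfl
  induction k with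
  | zero =>
    have h := complexMean_loop_step hP hPT c s 0
    have h0 := hsd.divergence_pow_zero
    rw [hN, hsd.trace_transmittedProj, hN, htr] at h0
    change ∑ i, ∑ j, (∑ l ∈ Finset.range (0 + 1), transmittedProduct P ^ l *
        transmittedVariation (constMatrix P) (scatMatrix n) (scatConjMatrix n) (single i j 1) *
        transmittedProduct P ^ (0 - l) : Matrix n n (Observable n)) i j =
      loopTerm (Fintype.card n : Observable n) (complexTrace P) 1 - _ at h0
    rw [h0] at h
    have he : algebraMap ℂ (Observable n) (P.trace * (Fintype.card n - P.trace)) =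
        algebraMap ℂ _ P.trace * (Fintype.card n - algebraMap ℂ _ P.trace) := by
      rw [map_mul, map_sub, map_natCast]
    rw [he]
    exact h
  | succ k ih =>
    have h := complexMean_loop_step hP hPT c s (k + 1)
    have h0 := hsd.divergence_pow_succ k
    rw [hN] at h0
    change ∑ i, ∑ j, (∑ l ∈ Finset.range (k + 1 + 1), transmittedProduct P ^ l *
        transmittedVariation (constMatrix P) (scatMatrix n) (scatConjMatrix n) (single i j 1) *
        transmittedProduct P ^ (k + 1 - l) : Matrix n n (Observable n)) i j =
      loopTerm (Fintype.card n : Observable n) (complexTrace P) (k + 2) -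
      loopTerm (Fintype.card n : Observable n) (complexTrace P) (k + 1) at h0
    rw [h0] at h
    have e := congrArg₂ (· + ·) ih h
    simp only [← map_add, ← add_mul, ← Multiset.sum_map_add] at e
    convert e using 2
    · congr 1
      ring
    · refine Multiset.map_congr rfl fun m _ => ?_
      rw [← mul_add, ← map_add, ← mul_add, ← add_assoc]
      congr 3
      ring

end LoopEquation

/-! ### Centred moments of the power traces -/

section CenteredMoments

open Matrix

/-- Continuous real observables on the unitary group of the cavity. -/
abbrev RealObservable (N₁ N₂ : ℕ) := C(Matrix.unitaryGroup (Fin N₁ ⊕ Fin N₂) ℂ, ℝ)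

/-- The projection onto the modes of the first lead. -/
noncomputable def leadProj (N₁ N₂ : ℕ) : Matrix (Fin N₁ ⊕ Fin N₂) (Fin N₁ ⊕ Fin N₂) ℂ :=
  fromBlocks 1 0 0 0

theorem trace_fromBlocks {m k R : Type*} [Fintype m] [Fintype k] [AddCommMonoid R]
    (A : Matrix m m R) (B : Matrix m k R) (C : Matrix k m R) (D : Matrix k k R) :
    (fromBlocks A B C D).trace = A.trace + D.trace := by
  simp [Matrix.trace, Fintype.sum_sum_type]

variable (N₁ N₂ : ℕ)

theorem leadProj_mul_self : leadProj N₁ N₂ * leadProj N₁ N₂ = leadProj N₁ N₂ := by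
  simp [leadProj, fromBlocks_multiply]

theorem transpose_leadProj : (leadProj N₁ N₂)ᵀ = leadProj N₁ N₂ := by
  simp [leadProj, fromBlocks_transpose]

theorem fromBlocks_zero_pow_succ {m k R : Type*} [Fintype m] [DecidableEq m] [Fintype k]
    [DecidableEq k] [CommRing R] (A : Matrix m m R) (B : Matrix m k R) (j : ℕ) :
    (fromBlocks A B 0 0 : Matrix (m ⊕ k) (m ⊕ k) R) ^ (j + 1) =
      fromBlocks (A ^ (j + 1)) (A ^ j * B) 0 0 := by
  induction j with
  | zero => simp
  | succ j ih => rw [pow_succ', ih, fromBlocks_multiply]; simp [pow_succ', Matrix.mul_assoc]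

/-- Only the upper row of blocks of `P Q` is nonzero, and it starts with `t† t`. -/
theorem complexTrace_leadProj_succ (k : ℕ)
    (U : Matrix.unitaryGroup (Fin N₁ ⊕ Fin N₂) ℂ) :
    complexTrace (leadProj N₁ N₂) (k + 1) U =
      (powerTrace (transmissionBlock (U.1ᵀ * U.1)) (k + 1) : ℂ) := by
  set ev : Observable (Fin N₁ ⊕ Fin N₂) →+* ℂ :=
    (ContinuousMap.evalAlgHom ℂ ℂ U : Observable (Fin N₁ ⊕ Fin N₂) →ₐ[ℂ] ℂ).toRingHom with hev
  set S : Matrix (Fin N₁ ⊕ Fin N₂) (Fin N₁ ⊕ Fin N₂) ℂ :=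
    U.1ᵀ * U.1 with hS
  have hcoord : ev.mapMatrix (coordMatrix _) = U.1 := rfl
  have hconj : ev.mapMatrix (coordConjMatrix _) = U.1.map star := rfl
  have hconst : ∀ A, ev.mapMatrix (constMatrix A) = A := fun A => rfl
  have hs : ev.mapMatrix (scatMatrix _) = S := by
    rw [scatMatrix, map_mul, hcoord, hS, ← hcoord]; rfl
  have hs' : ev.mapMatrix (scatConjMatrix _) = Sᴴ := by
    have : ev.mapMatrix (coordConjMatrix (Fin N₁ ⊕ Fin N₂))ᵀ = U.1ᴴ := rfl
    rw [scatConjMatrix, map_mul, hconj, this, hS, conjTranspose_mul]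
    rfl
  have h1 : complexTrace (leadProj N₁ N₂) (k + 1) U =
      ((leadProj N₁ N₂ * (Sᴴ * (1 - leadProj N₁ N₂) * S)) ^ (k + 1)).trace := by
    change ev (complexTrace (leadProj N₁ N₂) (k + 1)) = _
    rw [complexTrace, AddMonoidHom.map_trace]
    change (ev.mapMatrix _).trace = _
    rw [map_pow, transmittedProduct, map_mul, transmittedProj, map_mul, map_mul, map_sub, map_one,
      hconst, hs, hs']
  have h2 : leadProj N₁ N₂ * (Sᴴ * (1 - leadProj N₁ N₂) * S) =
      fromBlocks ((transmissionBlock S)ᴴ * transmissionBlock S)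
        ((transmissionBlock S)ᴴ * S.toBlocks₂₂) 0 0 := by
    conv_lhs => rw [← fromBlocks_toBlocks S]
    rw [leadProj, ← fromBlocks_one, fromBlocks_conjTranspose, sub_eq_add_neg, fromBlocks_neg,
      fromBlocks_add, fromBlocks_multiply, fromBlocks_multiply, fromBlocks_multiply]
    simp [transmissionBlock]
  rw [h1, h2, fromBlocks_zero_pow_succ, trace_fromBlocks, trace_zero, add_zero, coe_powerTrace]

theorem complexTrace_zero : complexTrace (leadProj N₁ N₂) 0 = (N₁ + N₂ : ℂ) • 1 := by
  rw [complexTrace, pow_zero, trace_one, Fintype.card_sum, Fintype.card_fin, Fintype.card_fin]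
  ext U
  simp

/-- The real observable `Tr (t† t) ^ k`, with the convention that its value at `k = 0`
is `N₁ + N₂`. -/
noncomputable def realTrace (k : ℕ) : RealObservable N₁ N₂ :=
  ⟨fun U => (complexTrace (leadProj N₁ N₂) k U).re,
    Complex.continuous_re.comp (ContinuousMap.continuous _)⟩

theorem realTrace_succ_apply (k : ℕ) (U : Matrix.unitaryGroup (Fin N₁ ⊕ Fin N₂) ℂ) :
    realTrace N₁ N₂ (k + 1) U =
      powerTrace (transmissionBlock (U.1ᵀ * U.1)) (k + 1) := by
  change (complexTrace (leadProj N₁ N₂) (k + 1) U).re = _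
  rw [complexTrace_leadProj_succ, Complex.ofReal_re]

/-- Real observables as complex ones. -/
noncomputable def complexify :
    RealObservable N₁ N₂ →+* Observable (Fin N₁ ⊕ Fin N₂) :=
  Complex.ofRealHom.compLeftContinuous _ Complex.continuous_ofReal

theorem complexify_apply (f : RealObservable N₁ N₂) (U) : complexify N₁ N₂ f U = (f U : ℂ) := rfl

theorem complexify_realTrace (k : ℕ) :
    complexify N₁ N₂ (realTrace N₁ N₂ k) = complexTrace (leadProj N₁ N₂) k := by
  ext U
  rw [complexify_apply]
  cases k with
  | zero =>
    change ((complexTrace (leadProj N₁ N₂) 0 U).re : ℂ) = _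
    rw [complexTrace_zero]
    simp
  | succ k => rw [realTrace_succ_apply, complexTrace_leadProj_succ]

theorem integrable_realObservable (f : RealObservable N₁ N₂) :
    Integrable (fun U => f U) (haarUnitary (Fin N₁ ⊕ Fin N₂)) :=
  f.continuous.integrable_of_hasCompactSupport (HasCompactSupport.of_compactSpace _)

/-- The Haar average of real observables. -/
noncomputable def haarMean : RealObservable N₁ N₂ →ₗ[ℝ] ℝ where
  toFun f := ∫ U, f U ∂haarUnitary (Fin N₁ ⊕ Fin N₂)
  map_add' f g :=
    integral_add (integrable_realObservable N₁ N₂ f) (integrable_realObservable N₁ N₂ g)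
  map_smul' c _ := integral_const_mul c _

theorem haarMean_one : haarMean N₁ N₂ 1 = 1 := by
  simp [haarMean]

theorem complexMean_complexify (f : RealObservable N₁ N₂) :
    complexMean (complexify N₁ N₂ f) = (haarMean N₁ N₂ f : ℂ) :=
  integral_ofReal

/-- The deviation of `Tr (t† t) ^ m` from its mean. -/
noncomputable def centeredTrace (m : ℕ) : RealObservable N₁ N₂ :=
  realTrace N₁ N₂ m - algebraMap ℝ _ (haarMean N₁ N₂ (realTrace N₁ N₂ m))

/-- The joint central moment of the traces `Tr (t† t) ^ m`, with `m` in a multiset. -/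
noncomputable def centralMoment (s : Multiset ℕ) : ℝ :=
  haarMean N₁ N₂ (s.map (centeredTrace N₁ N₂)).prod

/-- The loop equations for products of centred traces. -/
theorem haarMean_loop (s : Multiset ℕ) (k : ℕ) :
    haarMean N₁ N₂ ((loopTerm (algebraMap ℝ _ (N₁ + N₂ : ℝ)) (realTrace N₁ N₂) (k + 1) -
        algebraMap ℝ _ (N₁ * N₂ : ℝ)) * (s.map (centeredTrace N₁ N₂)).prod) =
      (s.map fun m => 2 * m * haarMean N₁ N₂ (((s.erase m).map (centeredTrace N₁ N₂)).prod *
        (realTrace N₁ N₂ m - realTrace N₁ N₂ (m + k + 1)))).sum := by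
  have h := complexMean_loop (leadProj_mul_self N₁ N₂) (transpose_leadProj N₁ N₂)
    (fun m => (haarMean N₁ N₂ (realTrace N₁ N₂ m) : ℂ)) s k
  have halg : ∀ x : ℝ, algebraMap ℂ (Observable (Fin N₁ ⊕ Fin N₂)) (x : ℂ) =
      complexify N₁ N₂ (algebraMap ℝ _ x) := fun x => rfl
  have hprod : ∀ t : Multiset ℕ, complexProd (leadProj N₁ N₂)
      (fun m => (haarMean N₁ N₂ (realTrace N₁ N₂ m) : ℂ)) t =
      complexify N₁ N₂ (t.map (centeredTrace N₁ N₂)).prod := by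
    intro t
    rw [complexProd, map_multiset_prod, Multiset.map_map]
    simp only [halg, ← complexify_realTrace, ← map_sub]
    rfl
  have htr : (leadProj N₁ N₂).trace = N₁ := by simp [leadProj, trace_fromBlocks]
  have hN : (leadProj N₁ N₂).trace *
      ((Fintype.card (Fin N₁ ⊕ Fin N₂) : ℂ) - (leadProj N₁ N₂).trace) =
      ((N₁ * N₂ : ℝ) : ℂ) := by
    rw [htr]
    simp
  have hloop : loopTerm (Fintype.card (Fin N₁ ⊕ Fin N₂) : Observable (Fin N₁ ⊕ Fin N₂))
      (complexTrace (leadProj N₁ N₂)) (k + 1) = complexify N₁ N₂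
        (loopTerm (algebraMap ℝ _ (N₁ + N₂ : ℝ)) (realTrace N₁ N₂) (k + 1)) := by
    simp only [loopTerm, map_add, map_mul, map_sum, complexify_realTrace, map_natCast]
    simp
  rw [hN, halg, hloop, hprod, ← map_sub, ← map_mul, complexMean_complexify] at h
  simp only [hprod, ← complexify_realTrace, ← map_sub, ← map_mul, complexMean_complexify] at h
  apply Complex.ofReal_injective
  rw [h]
  change _ = Complex.ofRealHom _
  rw [map_multiset_sum, Multiset.map_map]
  congr 1
  refine Multiset.map_congr rfl fun m _ => ?_
  simp

/-- The mean of `Tr (t† t) ^ m` per scattering channel. -/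
noncomputable def meanDensity (m : ℕ) : ℝ :=
  haarMean N₁ N₂ (realTrace N₁ N₂ m) / (N₁ + N₂)

theorem haarMean_algebraMap_mul (c : ℝ) (f : RealObservable N₁ N₂) :
    haarMean N₁ N₂ (algebraMap ℝ _ c * f) = c * haarMean N₁ N₂ f := by
  rw [← Algebra.smul_def, map_smul, smul_eq_mul]

theorem centralMoment_zero : centralMoment N₁ N₂ 0 = 1 := by
  simp [centralMoment, haarMean_one]

theorem centralMoment_singleton (m : ℕ) : centralMoment N₁ N₂ {m} = 0 := by
  have h := haarMean_algebraMap_mul N₁ N₂ (haarMean N₁ N₂ (realTrace N₁ N₂ m)) 1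
  rw [mul_one, haarMean_one, mul_one] at h
  rw [centralMoment, Multiset.map_singleton, Multiset.prod_singleton, centeredTrace, map_sub, h,
    sub_self]

/-- The loop equations in terms of the central moments, with the means `a m` still present. -/
theorem centralMoment_loop_of_mean (s : Multiset ℕ) {k : ℕ} (hk : 1 ≤ k) {a : ℕ → ℝ}
    (ha : ∀ m, a m = haarMean N₁ N₂ (realTrace N₁ N₂ m)) :
    (N₁ + N₂ + k) * centralMoment N₁ N₂ (k ::ₘ s) +
        2 * ∑ l ∈ Finset.Ico 1 k, a l * centralMoment N₁ N₂ ((k - l) ::ₘ s) +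
        ∑ l ∈ Finset.Ico 1 k, centralMoment N₁ N₂ (l ::ₘ (k - l) ::ₘ s) +
        ((N₁ + N₂ + k) * a k + ∑ l ∈ Finset.Ico 1 k, a l * a (k - l) - N₁ * N₂) *
          centralMoment N₁ N₂ s =
      (s.map fun m => 2 * m * ((a m - a (m + k)) * centralMoment N₁ N₂ (s.erase m) +
        centralMoment N₁ N₂ s - centralMoment N₁ N₂ ((m + k) ::ₘ s.erase m))).sum := by
  obtain ⟨k, rfl⟩ : ∃ j, k = j + 1 := ⟨k - 1, by omega⟩
  have h := haarMean_loop N₁ N₂ s k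
  have hx : ∀ m, realTrace N₁ N₂ m = centeredTrace N₁ N₂ m + algebraMap ℝ _ (a m) := fun m => by
    rw [centeredTrace, ha, sub_add_cancel]
  have hw : ∀ (m : ℕ) (t : Multiset ℕ),
      haarMean N₁ N₂ (centeredTrace N₁ N₂ m * (t.map (centeredTrace N₁ N₂)).prod) =
        centralMoment N₁ N₂ (m ::ₘ t) := fun m t => by
    rw [centralMoment, Multiset.map_cons, Multiset.prod_cons]
  set F := (s.map (centeredTrace N₁ N₂)).prod with hF
  have hFs : haarMean N₁ N₂ F = centralMoment N₁ N₂ s := rfl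
  have e : (loopTerm (algebraMap ℝ _ (N₁ + N₂ : ℝ)) (realTrace N₁ N₂) (k + 1) -
        algebraMap ℝ _ (N₁ * N₂ : ℝ)) * F =
      algebraMap ℝ _ (N₁ + N₂ + (k + 1 : ℕ) : ℝ) * (centeredTrace N₁ N₂ (k + 1) * F) +
      algebraMap ℝ _ ((N₁ + N₂ + (k + 1 : ℕ)) * a (k + 1) - N₁ * N₂ : ℝ) * F +
      ∑ l ∈ Finset.Ico 1 (k + 1),
        (centeredTrace N₁ N₂ l * (centeredTrace N₁ N₂ (k + 1 - l) * F) +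
        algebraMap ℝ _ (a l) * (centeredTrace N₁ N₂ (k + 1 - l) * F) +
        algebraMap ℝ _ (a (k + 1 - l)) * (centeredTrace N₁ N₂ l * F) +
        algebraMap ℝ _ (a l * a (k + 1 - l)) * F) := by
    have e1 : ∀ l ∈ Finset.Ico 1 (k + 1), realTrace N₁ N₂ l * realTrace N₁ N₂ (k + 1 - l) * F =
        (centeredTrace N₁ N₂ l * (centeredTrace N₁ N₂ (k + 1 - l) * F) +
        algebraMap ℝ _ (a l) * (centeredTrace N₁ N₂ (k + 1 - l) * F) +
        algebraMap ℝ _ (a (k + 1 - l)) * (centeredTrace N₁ N₂ l * F) +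
        algebraMap ℝ _ (a l * a (k + 1 - l)) * F) := by
      intro l _
      rw [hx, hx (k + 1 - l), map_mul]
      ring
    rw [loopTerm, sub_mul, add_mul, Finset.sum_mul, Finset.sum_congr rfl e1, hx]
    simp only [map_add, map_sub, map_mul, map_natCast]
    ring
  have hrefl : ∑ l ∈ Finset.Ico 1 (k + 1), a (k + 1 - l) * centralMoment N₁ N₂ (l ::ₘ s) =
      ∑ l ∈ Finset.Ico 1 (k + 1), a l * centralMoment N₁ N₂ ((k + 1 - l) ::ₘ s) := by
    refine Finset.sum_bij' (fun l _ => k + 1 - l) (fun l _ => k + 1 - l) ?_ ?_ ?_ ?_ ?_ <;>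
      intro l hl <;> rw [Finset.mem_Ico] at hl
    · rw [Finset.mem_Ico]; omega
    · rw [Finset.mem_Ico]; omega
    · omega
    · omega
    · rw [show k + 1 - (k + 1 - l) = l by omega]
  have hw2 : ∀ l m : ℕ, haarMean N₁ N₂ (centeredTrace N₁ N₂ l * (centeredTrace N₁ N₂ m * F)) =
      centralMoment N₁ N₂ (l ::ₘ m ::ₘ s) := fun l m => by
    rw [← hw, Multiset.map_cons, Multiset.prod_cons]
  have hsum : ∀ l, haarMean N₁ N₂ (centeredTrace N₁ N₂ l * (centeredTrace N₁ N₂ (k + 1 - l) * F) +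
        algebraMap ℝ _ (a l) * (centeredTrace N₁ N₂ (k + 1 - l) * F) +
        algebraMap ℝ _ (a (k + 1 - l)) * (centeredTrace N₁ N₂ l * F) +
        algebraMap ℝ _ (a l * a (k + 1 - l)) * F) =
      centralMoment N₁ N₂ (l ::ₘ (k + 1 - l) ::ₘ s) +
        a l * centralMoment N₁ N₂ ((k + 1 - l) ::ₘ s) +
        a (k + 1 - l) * centralMoment N₁ N₂ (l ::ₘ s) +
        a l * a (k + 1 - l) * centralMoment N₁ N₂ s := fun l => by
    rw [map_add, map_add, map_add, haarMean_algebraMap_mul, haarMean_algebraMap_mul,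
      haarMean_algebraMap_mul, hw2, hw, hw, hFs]
  rw [e, map_add, map_add, map_sum, haarMean_algebraMap_mul, haarMean_algebraMap_mul, hw, hFs,
    Finset.sum_congr rfl fun l _ => hsum l] at h
  simp only [Finset.sum_add_distrib, hrefl] at h
  have hR : ∀ m ∈ s, 2 * m * haarMean N₁ N₂ (((s.erase m).map (centeredTrace N₁ N₂)).prod *
        (realTrace N₁ N₂ m - realTrace N₁ N₂ (m + k + 1))) =
      2 * m * ((a m - a (m + (k + 1))) * centralMoment N₁ N₂ (s.erase m) +
        centralMoment N₁ N₂ s - centralMoment N₁ N₂ ((m + (k + 1)) ::ₘ s.erase m)) := by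
    intro m hm
    have e2 : ((s.erase m).map (centeredTrace N₁ N₂)).prod *
        (realTrace N₁ N₂ m - realTrace N₁ N₂ (m + k + 1)) =
        algebraMap ℝ _ (a m - a (m + (k + 1))) * ((s.erase m).map (centeredTrace N₁ N₂)).prod +
        centeredTrace N₁ N₂ m * ((s.erase m).map (centeredTrace N₁ N₂)).prod -
        centeredTrace N₁ N₂ (m + (k + 1)) * ((s.erase m).map (centeredTrace N₁ N₂)).prod := by
      rw [hx, hx (m + k + 1), map_sub, add_assoc m k 1]
      ring
    rw [e2, map_sub, map_add, haarMean_algebraMap_mul, hw, hw, Multiset.cons_erase hm]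
    rfl
  rw [Multiset.map_congr rfl hR] at h
  rw [← h]
  simp only [← Finset.sum_mul]
  push_cast
  ring

/-- The equation for the means, which couples them to the covariances. -/
theorem meanDensity_loop (hN : (N₁ + N₂ : ℝ) ≠ 0) {k : ℕ} (hk : 1 ≤ k) :
    (1 + k * (N₁ + N₂ : ℝ)⁻¹) * meanDensity N₁ N₂ k +
        ∑ l ∈ Finset.Ico 1 k, meanDensity N₁ N₂ l * meanDensity N₁ N₂ (k - l) +
        (N₁ + N₂ : ℝ)⁻¹ ^ 2 * ∑ l ∈ Finset.Ico 1 k, centralMoment N₁ N₂ {l, k - l} =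
      xiParam N₁ N₂ := by
  have h := centralMoment_loop_of_mean N₁ N₂ 0 hk
    (a := fun m => (N₁ + N₂) * meanDensity N₁ N₂ m)
    (fun m => by rw [meanDensity, mul_div_cancel₀ _ hN])
  have h0 : ∀ m : ℕ, centralMoment N₁ N₂ (m ::ₘ 0) = 0 := centralMoment_singleton N₁ N₂
  simp only [h0, centralMoment_zero, mul_zero, Finset.sum_const_zero, mul_one, Multiset.map_zero,
    Multiset.sum_zero, zero_add] at h
  have e : ∑ l ∈ Finset.Ico 1 k, (N₁ + N₂ : ℝ) * meanDensity N₁ N₂ l *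
      ((N₁ + N₂) * meanDensity N₁ N₂ (k - l)) = (N₁ + N₂ : ℝ) ^ 2 *
      ∑ l ∈ Finset.Ico 1 k, meanDensity N₁ N₂ l * meanDensity N₁ N₂ (k - l) := by
    rw [Finset.mul_sum]
    exact Finset.sum_congr rfl fun l _ => by ring
  rw [e] at h
  change ∑ l ∈ Finset.Ico 1 k, centralMoment N₁ N₂ {l, k - l} + _ = 0 at h
  rw [xiParam]
  field_simp
  linear_combination h

/-- The equation for the central moments, where the equation for the means has been used to cancel
the terms of leading order. -/
theorem centralMoment_loop (hN : (N₁ + N₂ : ℝ) ≠ 0) (s : Multiset ℕ) {k : ℕ} (hk : 1 ≤ k) :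
    (1 + k * (N₁ + N₂ : ℝ)⁻¹) * centralMoment N₁ N₂ (k ::ₘ s) +
        2 * ∑ l ∈ Finset.Ico 1 k, meanDensity N₁ N₂ l * centralMoment N₁ N₂ ((k - l) ::ₘ s) +
        (N₁ + N₂ : ℝ)⁻¹ * ∑ l ∈ Finset.Ico 1 k, (centralMoment N₁ N₂ (l ::ₘ (k - l) ::ₘ s) -
          centralMoment N₁ N₂ {l, k - l} * centralMoment N₁ N₂ s) =
      (s.map fun m => 2 * m * ((meanDensity N₁ N₂ m - meanDensity N₁ N₂ (m + k)) *
        centralMoment N₁ N₂ (s.erase m) + (N₁ + N₂ : ℝ)⁻¹ * (centralMoment N₁ N₂ s -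
        centralMoment N₁ N₂ ((m + k) ::ₘ s.erase m)))).sum := by
  have h := centralMoment_loop_of_mean N₁ N₂ s hk
    (a := fun m => (N₁ + N₂) * meanDensity N₁ N₂ m)
    (fun m => by rw [meanDensity, mul_div_cancel₀ _ hN])
  have h1 := meanDensity_loop N₁ N₂ hN hk
  have e : ∑ l ∈ Finset.Ico 1 k, (N₁ + N₂ : ℝ) * meanDensity N₁ N₂ l *
      ((N₁ + N₂) * meanDensity N₁ N₂ (k - l)) = (N₁ + N₂ : ℝ) ^ 2 *
      ∑ l ∈ Finset.Ico 1 k, meanDensity N₁ N₂ l * meanDensity N₁ N₂ (k - l) := by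
    rw [Finset.mul_sum]
    exact Finset.sum_congr rfl fun l _ => by ring
  have e2 : ∑ l ∈ Finset.Ico 1 k, (N₁ + N₂ : ℝ) * meanDensity N₁ N₂ l *
      centralMoment N₁ N₂ ((k - l) ::ₘ s) = (N₁ + N₂ : ℝ) *
      ∑ l ∈ Finset.Ico 1 k, meanDensity N₁ N₂ l * centralMoment N₁ N₂ ((k - l) ::ₘ s) := by
    rw [Finset.mul_sum]
    exact Finset.sum_congr rfl fun l _ => by ring
  have e3 : (s.map fun m => 2 * m * ((meanDensity N₁ N₂ m - meanDensity N₁ N₂ (m + k)) *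
        centralMoment N₁ N₂ (s.erase m) + (N₁ + N₂ : ℝ)⁻¹ * (centralMoment N₁ N₂ s -
        centralMoment N₁ N₂ ((m + k) ::ₘ s.erase m)))).sum = (N₁ + N₂ : ℝ)⁻¹ *
      (s.map fun m => 2 * m * (((N₁ + N₂) * meanDensity N₁ N₂ m -
        (N₁ + N₂) * meanDensity N₁ N₂ (m + k)) * centralMoment N₁ N₂ (s.erase m) +
        centralMoment N₁ N₂ s - centralMoment N₁ N₂ ((m + k) ::ₘ s.erase m))).sum := by
    rw [← Multiset.sum_map_mul_left]
    refine congrArg _ (Multiset.map_congr rfl fun m _ => ?_)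
    field_simp
    ring
  rw [e3, ← h, e, e2, Finset.sum_sub_distrib, ← Finset.sum_mul]
  rw [xiParam] at h1
  field_simp at h1 ⊢
  linear_combination (-centralMoment N₁ N₂ s) * h1

end CenteredMoments

/-! ### A priori bounds, and the moments of the circular orthogonal ensemble -/

section Bounds

open Matrix

variable (N₁ N₂ : ℕ)

theorem norm_mul_apply_le {m k p : Type*} [Fintype k] {A : Matrix m k ℂ} {B : Matrix k p ℂ}
    {a b c : ℝ} (ha : ∀ i j, ‖A i j‖ ≤ a) (hb : ∀ i j, ‖B i j‖ ≤ b) (hc : (Fintype.card k : ℝ) ≤ c)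
    (ha0 : 0 ≤ a) (hb0 : 0 ≤ b) (i : m) (j : p) : ‖(A * B) i j‖ ≤ c * (a * b) := by
  rw [mul_apply]
  refine (norm_sum_le_of_le Finset.univ fun l _ => ?_).trans
    (b := ∑ _l : k, a * b) ?_
  · rw [norm_mul]
    exact mul_le_mul (ha i l) (hb l j) (norm_nonneg _) ha0
  · rw [Finset.sum_const, nsmul_eq_mul, Finset.card_univ]
    exact mul_le_mul_of_nonneg_right hc (mul_nonneg ha0 hb0)

/-- A crude bound on the power traces, polynomial in the number of channels. -/
theorem abs_realTrace_le (k : ℕ) (hk : 1 ≤ k) (hN : 1 ≤ N₁ + N₂)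
    (U : Matrix.unitaryGroup (Fin N₁ ⊕ Fin N₂) ℂ) :
    |realTrace N₁ N₂ k U| ≤ (N₁ + N₂ : ℝ) ^ (5 * k) := by
  obtain ⟨k, rfl⟩ : ∃ j, k = j + 1 := ⟨k - 1, by omega⟩
  rw [realTrace_succ_apply]
  set N : ℝ := N₁ + N₂ with hNdef
  have h1 : (1 : ℝ) ≤ N := by rw [hNdef]; exact_mod_cast hN
  have h0 : (0 : ℝ) ≤ N := by linarith
  set S := U.1ᵀ * U.1 with hS
  have hU : ∀ i j, ‖U.1 i j‖ ≤ 1 := fun i j => entry_norm_bound_of_unitary U.2 i j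
  have hSb : ∀ i j, ‖S i j‖ ≤ N := fun i j => by
    have := norm_mul_apply_le (A := U.1ᵀ) (B := U.1) (c := N) (fun i j => hU j i) hU
      (by simp [hNdef]) zero_le_one zero_le_one i j
    simpa using this
  set X := (transmissionBlock S)ᴴ * transmissionBlock S with hX
  have hXb : ∀ i j, ‖X i j‖ ≤ N ^ 3 := fun i j => by
    have := norm_mul_apply_le (A := (transmissionBlock S)ᴴ) (B := transmissionBlock S) (c := N)
      (a := N) (b := N) (fun i j => by
        rw [conjTranspose_apply, norm_star]; exact hSb _ _) (fun i j => hSb _ _)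
      (by simp [hNdef]) h0 h0 i j
    calc _ ≤ _ := this
      _ = N ^ 3 := by ring
  have hpow : ∀ k i j, ‖(X ^ k) i j‖ ≤ N ^ (4 * k) := by
    intro k
    induction k with
    | zero =>
      intro i j
      rw [pow_zero, one_apply]
      split_ifs <;> simp
    | succ k ih =>
      intro i j
      rw [pow_succ]
      have := norm_mul_apply_le (c := N) ih hXb (by simp [hNdef]) (by positivity) (by positivity)
        i j
      calc _ ≤ _ := this
        _ = N ^ (4 * (k + 1)) := by ring
  calc |powerTrace (transmissionBlock S) (k + 1)|
      ≤ ‖(X ^ (k + 1)).trace‖ := Complex.abs_re_le_norm _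
    _ ≤ ∑ _i : Fin N₁, N ^ (4 * (k + 1)) :=
      norm_sum_le_of_le Finset.univ fun i _ => hpow (k + 1) i i
    _ = N₁ * N ^ (4 * (k + 1)) := by simp
    _ ≤ N ^ (k + 1) * N ^ (4 * (k + 1)) := by
      refine mul_le_mul_of_nonneg_right ?_ (by positivity)
      calc (N₁ : ℝ) ≤ N := by simp [hNdef]
        _ ≤ N ^ (k + 1) := le_self_pow₀ h1 (by omega)
    _ = N ^ (5 * (k + 1)) := by ring

theorem abs_haarMean_le {f : RealObservable N₁ N₂} {c : ℝ} (h : ∀ U, |f U| ≤ c) :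
    |haarMean N₁ N₂ f| ≤ c := by
  have := norm_integral_le_of_norm_le_const (μ := haarUnitary (Fin N₁ ⊕ Fin N₂))
    (f := fun U => f U) (Filter.Eventually.of_forall h)
  simpa [haarMean] using this

theorem abs_meanDensity_le (k : ℕ) (hk : 1 ≤ k) (hN : 1 ≤ N₁ + N₂) :
    |meanDensity N₁ N₂ k| ≤ (N₁ + N₂ : ℝ) ^ (5 * k) := by
  have h1 : (1 : ℝ) ≤ N₁ + N₂ := by exact_mod_cast hN
  rw [meanDensity, abs_div, abs_of_pos (by linarith : (0 : ℝ) < N₁ + N₂)]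
  exact (div_le_self (abs_nonneg _) h1).trans
    (abs_haarMean_le N₁ N₂ fun U => abs_realTrace_le N₁ N₂ k hk hN U)

theorem abs_centralMoment_le (s : Multiset ℕ) (hs : ∀ m ∈ s, 1 ≤ m) (hN : 1 ≤ N₁ + N₂) :
    |centralMoment N₁ N₂ s| ≤ 2 ^ s.card * (N₁ + N₂ : ℝ) ^ (5 * s.sum) := by
  refine abs_haarMean_le N₁ N₂ fun U => ?_
  induction s using Multiset.induction_on with
  | empty => simp
  | cons m s ih =>
    rw [Multiset.map_cons, Multiset.prod_cons, ContinuousMap.mul_apply, abs_mul,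
      Multiset.card_cons, Multiset.sum_cons, pow_succ, mul_add, pow_add]
    have hm := hs m (by simp)
    have h1 : |centeredTrace N₁ N₂ m U| ≤ 2 * (N₁ + N₂ : ℝ) ^ (5 * m) := by
      calc |realTrace N₁ N₂ m U - haarMean N₁ N₂ (realTrace N₁ N₂ m)| ≤ _ := abs_sub _ _
        _ ≤ (N₁ + N₂ : ℝ) ^ (5 * m) + (N₁ + N₂ : ℝ) ^ (5 * m) :=
          add_le_add (abs_realTrace_le N₁ N₂ m hm hN U)
            (abs_haarMean_le N₁ N₂ fun U => abs_realTrace_le N₁ N₂ m hm hN U)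
        _ = _ := by ring
    calc _ ≤ (2 * (N₁ + N₂ : ℝ) ^ (5 * m)) * (2 ^ s.card * (N₁ + N₂ : ℝ) ^ (5 * s.sum)) :=
          mul_le_mul h1 (ih fun m hm => hs m (by simp [hm])) (abs_nonneg _) (by positivity)
      _ = _ := by ring

theorem integral_scatteringLaw (f : Matrix (Fin N₁ ⊕ Fin N₂) (Fin N₁ ⊕ Fin N₂) ℂ → ℝ)
    (hf : Continuous f) :
    ∫ S, f S ∂scatteringLaw N₁ N₂ =
      ∫ U, f (U.1ᵀ * U.1) ∂haarUnitary (Fin N₁ ⊕ Fin N₂) := by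
  have hc : Continuous fun U : Matrix.unitaryGroup (Fin N₁ ⊕ Fin N₂) ℂ => U.1ᵀ * U.1 :=
    (continuous_subtype_val.matrix_transpose).matrix_mul continuous_subtype_val
  exact integral_map hc.measurable.aemeasurable hf.aestronglyMeasurable

theorem continuous_powerTrace_transmissionBlock (k : ℕ) :
    Continuous fun S : Matrix (Fin N₁ ⊕ Fin N₂) (Fin N₁ ⊕ Fin N₂) ℂ =>
      powerTrace (transmissionBlock S) k := by
  unfold powerTrace transmissionBlock toBlocks₂₁
  fun_prop

theorem autocorrelation_eq_centralMoment {n₁ n₂ : ℕ} (h₁ : 1 ≤ n₁) (h₂ : 1 ≤ n₂) :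
    autocorrelation N₁ N₂ n₁ n₂ = centralMoment N₁ N₂ {n₁, n₂} := by
  have hp : ∀ (k : ℕ), 1 ≤ k → ∀ U : Matrix.unitaryGroup (Fin N₁ ⊕ Fin N₂) ℂ,
      powerTrace (transmissionBlock (U.1ᵀ * U.1)) k = realTrace N₁ N₂ k U := by
    intro k hk U
    obtain ⟨k, rfl⟩ : ∃ j, k = j + 1 := ⟨k - 1, by omega⟩
    rw [realTrace_succ_apply]
  have hl : ∀ k, 1 ≤ k → linearMoment N₁ N₂ k = haarMean N₁ N₂ (realTrace N₁ N₂ k) := by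
    intro k hk
    rw [linearMoment, integral_scatteringLaw N₁ N₂ _
      (continuous_powerTrace_transmissionBlock N₁ N₂ k)]
    simp only [hp k hk]
    rfl
  have hn : nonlinearMoment N₁ N₂ n₁ n₂ =
      haarMean N₁ N₂ (realTrace N₁ N₂ n₁ * realTrace N₁ N₂ n₂) := by
    rw [nonlinearMoment, integral_scatteringLaw N₁ N₂
      (fun S => powerTrace (transmissionBlock S) n₁ * powerTrace (transmissionBlock S) n₂)
      ((continuous_powerTrace_transmissionBlock N₁ N₂ n₁).mul
        (continuous_powerTrace_transmissionBlock N₁ N₂ n₂))]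
    simp only [hp n₁ h₁, hp n₂ h₂]
    rfl
  rw [autocorrelation, hl n₁ h₁, hl n₂ h₂, hn, centralMoment]
  have e : (({n₁, n₂} : Multiset ℕ).map (centeredTrace N₁ N₂)).prod =
      realTrace N₁ N₂ n₁ * realTrace N₁ N₂ n₂ -
      algebraMap ℝ _ (haarMean N₁ N₂ (realTrace N₁ N₂ n₁)) * realTrace N₁ N₂ n₂ -
      algebraMap ℝ _ (haarMean N₁ N₂ (realTrace N₁ N₂ n₂)) * realTrace N₁ N₂ n₁ +
      algebraMap ℝ _ (haarMean N₁ N₂ (realTrace N₁ N₂ n₁) *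
        haarMean N₁ N₂ (realTrace N₁ N₂ n₂)) * 1 := by
    rw [map_mul]
    simp only [Multiset.insert_eq_cons, Multiset.map_cons, Multiset.map_singleton,
      Multiset.prod_cons, Multiset.prod_singleton, centeredTrace]
    ring
  rw [e, map_add, map_sub, map_sub, haarMean_algebraMap_mul, haarMean_algebraMap_mul,
    haarMean_algebraMap_mul, haarMean_one]
  ring

end Bounds

/-! ### Asymptotic expansions in the inverse number of channels -/

section Asymptotics

/-- The inverse `1 / N` of the number of channels. Families indexed by `i : ℕ × ℕ` stand for
functions of `N₁ = i.1 + 1` and `N₂ = i.2 + 1`. -/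
noncomputable def invN (i : ℕ × ℕ) : ℝ := (((i.1 + 1 : ℕ) : ℝ) + ((i.2 + 1 : ℕ) : ℝ))⁻¹

/-- The parameter `ξ` of the pair `(N₁, N₂) = (i.1 + 1, i.2 + 1)`. -/
noncomputable def xiFun (i : ℕ × ℕ) : ℝ := xiParam (i.1 + 1) (i.2 + 1)

theorem invN_pos (i : ℕ × ℕ) : 0 < invN i := by
  unfold invN; positivity

theorem invN_le_one (i : ℕ × ℕ) : invN i ≤ 1 := by
  unfold invN
  apply inv_le_one_of_one_le₀
  push_cast
  have h1 : (0 : ℝ) ≤ i.1 := by positivity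
  have h2 : (0 : ℝ) ≤ i.2 := by positivity
  linarith

theorem xiFun_nonneg (i : ℕ × ℕ) : 0 ≤ xiFun i := by
  unfold xiFun xiParam; positivity

theorem xiFun_le_one (i : ℕ × ℕ) : xiFun i ≤ 1 := by
  unfold xiFun xiParam
  apply div_le_one_of_le₀ _ (by positivity)
  have h1 : (0 : ℝ) ≤ (i.1 + 1 : ℕ) := by positivity
  have h2 : (0 : ℝ) ≤ (i.2 + 1 : ℕ) := by positivity
  nlinarith

/-- The families which are `O(N ^ (-K))`, uniformly in `N₁` and `N₂`. -/
def bigO (K : ℕ) : Submodule ℝ (ℕ × ℕ → ℝ) where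
  carrier := {f | ∃ C : ℝ, ∀ i, |f i| ≤ C * invN i ^ K}
  zero_mem' := ⟨0, fun i => by simp⟩
  add_mem' := by
    rintro f g ⟨C, hC⟩ ⟨D, hD⟩
    refine ⟨C + D, fun i => (abs_add_le _ _).trans ?_⟩
    rw [add_mul]
    exact add_le_add (hC i) (hD i)
  smul_mem' := by
    rintro c f ⟨C, hC⟩
    refine ⟨|c| * C, fun i => ?_⟩
    rw [Pi.smul_apply, smul_eq_mul, abs_mul, mul_assoc]
    exact mul_le_mul_of_nonneg_left (hC i) (abs_nonneg c)

theorem mul_mem_bigO {K L : ℕ} {f g : ℕ × ℕ → ℝ} (hf : f ∈ bigO K) (hg : g ∈ bigO L) :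
    f * g ∈ bigO (K + L) := by
  obtain ⟨C, hC⟩ := hf
  obtain ⟨D, hD⟩ := hg
  refine ⟨C * D, fun i => ?_⟩
  rw [Pi.mul_apply, abs_mul, pow_add]
  calc |f i| * |g i| ≤ (C * invN i ^ K) * (D * invN i ^ L) :=
        mul_le_mul (hC i) (hD i) (abs_nonneg _) ((abs_nonneg _).trans (hC i))
    _ = _ := by ring

theorem bigO_antitone {K L : ℕ} (h : K ≤ L) : bigO L ≤ bigO K := by
  rintro f ⟨C, hC⟩
  refine ⟨|C|, fun i => (hC i).trans ?_⟩
  exact mul_le_mul (le_abs_self C) (pow_le_pow_of_le_one (invN_pos i).le (invN_le_one i) h)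
    (pow_nonneg (invN_pos i).le _) (abs_nonneg C)

theorem invN_pow_mem_bigO (K : ℕ) : invN ^ K ∈ bigO K :=
  ⟨1, fun i => by rw [Pi.pow_apply, abs_of_nonneg (pow_nonneg (invN_pos i).le _), one_mul]⟩

/-- Polynomials in `1 / N` whose coefficients are polynomials in `ξ`, as families. -/
noncomputable def evalExpansion : ℝ[X][X] →+* (ℕ × ℕ → ℝ) :=
  Polynomial.eval₂RingHom (RingHom.pi fun i => Polynomial.evalRingHom (xiFun i)) invN

theorem eval_xiFun_mem_bigO (p : ℝ[X]) : (fun i => p.eval (xiFun i)) ∈ bigO 0 := by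
  obtain ⟨C, hC⟩ := (isCompact_Icc (a := (0 : ℝ)) (b := 1)).exists_bound_of_continuousOn
    p.continuousOn
  exact ⟨C, fun i => by simpa using hC _ ⟨xiFun_nonneg i, xiFun_le_one i⟩⟩

theorem evalExpansion_C (p : ℝ[X]) :
    evalExpansion (Polynomial.C p) = fun i => p.eval (xiFun i) := by
  rw [evalExpansion, Polynomial.coe_eval₂RingHom, Polynomial.eval₂_C]
  rfl

theorem evalExpansion_X : evalExpansion Polynomial.X = invN := by
  simp [evalExpansion]

theorem evalExpansion_mem_bigO_zero (q : ℝ[X][X]) : evalExpansion q ∈ bigO 0 := by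
  induction q using Polynomial.induction_on' with
  | add p q hp hq => rw [map_add]; exact add_mem hp hq
  | monomial n a =>
    rw [← Polynomial.C_mul_X_pow_eq_monomial, map_mul, map_pow, evalExpansion_C, evalExpansion_X]
    exact mul_mem_bigO (eval_xiFun_mem_bigO a) (bigO_antitone (Nat.zero_le n) (invN_pow_mem_bigO n))

theorem evalExpansion_mem_bigO {K : ℕ} {q : ℝ[X][X]} (h : ∀ j < K, q.coeff j = 0) :
    evalExpansion q ∈ bigO K := by
  obtain ⟨r, rfl⟩ := Polynomial.X_pow_dvd_iff.2 h
  rw [map_mul, map_pow, evalExpansion_X]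
  exact mul_mem_bigO (invN_pow_mem_bigO K) (evalExpansion_mem_bigO_zero r)

/-- The family `f` has the asymptotic expansion `c`, a formal power series in `1 / N` with
coefficients polynomial in `ξ`, with errors uniform in `N₁` and `N₂`. -/
def HasExpansion (f : ℕ × ℕ → ℝ) (c : PowerSeries ℝ[X]) : Prop :=
  ∀ K, f - evalExpansion (c.trunc K) ∈ bigO K

theorem evalExpansion_trunc_apply (c : PowerSeries ℝ[X]) (K : ℕ) (i : ℕ × ℕ) :
    evalExpansion (c.trunc K) i =
      ∑ j ∈ Finset.range K, (PowerSeries.coeff j c).eval (xiFun i) * invN i ^ j := by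
  have h : c.trunc K =
      ∑ j ∈ Finset.range K, Polynomial.monomial j (PowerSeries.coeff j c) := by
    ext1 l
    simp [PowerSeries.coeff_trunc, Polynomial.coeff_monomial]
  rw [h, map_sum, Finset.sum_apply]
  refine Finset.sum_congr rfl fun j _ => ?_
  rw [← Polynomial.C_mul_X_pow_eq_monomial, map_mul, map_pow, evalExpansion_C, evalExpansion_X]
  rfl

namespace HasExpansion

variable {f g : ℕ × ℕ → ℝ} {c d : PowerSeries ℝ[X]}

theorem mem_bigO_zero (hf : HasExpansion f c) : f ∈ bigO 0 := by
  simpa using hf 0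

theorem add (hf : HasExpansion f c) (hg : HasExpansion g d) : HasExpansion (f + g) (c + d) := by
  intro K
  rw [map_add, map_add, add_sub_add_comm]
  exact add_mem (hf K) (hg K)

theorem mul (hf : HasExpansion f c) (hg : HasExpansion g d) : HasExpansion (f * g) (c * d) := by
  intro K
  have e : f * g - evalExpansion ((c * d).trunc K) =
      (f - evalExpansion (c.trunc K)) * g +
      evalExpansion (c.trunc K) * (g - evalExpansion (d.trunc K)) +
      evalExpansion (c.trunc K * d.trunc K - (c * d).trunc K) := by
    rw [map_sub evalExpansion, map_mul evalExpansion]; ring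
  rw [e]
  refine add_mem (add_mem ?_ ?_) ?_
  · exact mul_mem_bigO (hf K) hg.mem_bigO_zero
  · have := mul_mem_bigO (evalExpansion_mem_bigO_zero (c.trunc K)) (hg K)
    rwa [zero_add] at this
  · refine evalExpansion_mem_bigO fun j hj => ?_
    rw [Polynomial.coeff_sub, PowerSeries.coeff_trunc, if_pos hj, sub_eq_zero,
      PowerSeries.coeff_mul, Polynomial.coeff_mul]
    refine Finset.sum_congr rfl fun x hx => ?_
    rw [Finset.HasAntidiagonal.mem_antidiagonal] at hx
    rw [PowerSeries.coeff_trunc, PowerSeries.coeff_trunc, if_pos (by omega), if_pos (by omega)]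

theorem of_polynomial (q : ℝ[X][X]) : HasExpansion (evalExpansion q) q := by
  intro K
  rw [← map_sub]
  refine evalExpansion_mem_bigO fun j hj => ?_
  rw [Polynomial.coeff_sub, PowerSeries.coeff_trunc, if_pos hj, Polynomial.coeff_coe, sub_self]

theorem const (a : ℝ) : HasExpansion (algebraMap ℝ _ a) (PowerSeries.C (Polynomial.C a)) := by
  have := of_polynomial (Polynomial.C (Polynomial.C a))
  rw [evalExpansion_C, Polynomial.coe_C] at this
  convert this using 1
  ext i
  simp

theorem invN : HasExpansion invN PowerSeries.X := by
  have := of_polynomial Polynomial.X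
  rwa [evalExpansion_X, Polynomial.coe_X] at this

theorem xiFun : HasExpansion xiFun (PowerSeries.C Polynomial.X) := by
  have := of_polynomial (Polynomial.C Polynomial.X)
  rw [evalExpansion_C, Polynomial.coe_C] at this
  simpa using this

theorem sub (hf : HasExpansion f c) (hg : HasExpansion g d) : HasExpansion (f - g) (c - d) := by
  have := hf.add ((const (-1)).mul hg)
  convert this using 1
  · rw [map_neg, map_one, neg_one_mul, sub_eq_add_neg]
  · rw [map_neg, map_neg, map_one, map_one, neg_one_mul, sub_eq_add_neg]

theorem sum {κ : Type*} {s : Finset κ} {f : κ → ℕ × ℕ → ℝ} {c : κ → PowerSeries ℝ[X]}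
    (h : ∀ a ∈ s, HasExpansion (f a) (c a)) : HasExpansion (∑ a ∈ s, f a) (∑ a ∈ s, c a) := by
  classical
  induction s using Finset.induction_on with
  | empty =>
    have := const 0
    simpa using this
  | insert a s ha ih =>
    rw [Finset.sum_insert ha, Finset.sum_insert ha]
    exact (h a (by simp)).add (ih fun b hb => h b (by simp [hb]))

end HasExpansion

/-- A polynomial in `ξ` which is `O(1 / N)` vanishes: let `N → ∞` at a fixed ratio of `N₁` to
`N₂`, and use that `ξ` takes infinitely many values. -/
theorem eq_zero_of_eval_xiFun_mem_bigO_one {p : ℝ[X]}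
    (h : (fun i => p.eval (xiFun i)) ∈ bigO 1) : p = 0 := by
  obtain ⟨C, hC⟩ := h
  have hroot : ∀ a : ℕ, p.IsRoot (xiFun (a, 0)) := by
    intro a
    have hx : ∀ m : ℕ, xiFun ((a + 1) * (m + 1) - 1, m) = xiFun (a, 0) := by
      intro m
      have e : (a + 1) * (m + 1) - 1 + 1 = (a + 1) * (m + 1) := Nat.sub_add_cancel (by nlinarith)
      simp only [xiFun, xiParam, e]
      push_cast
      have h1 : ((a : ℝ) + 1) * (m + 1) + (m + 1) ≠ 0 := by positivity
      have h2 : ((a : ℝ) + 1) + (0 + 1) ≠ 0 := by positivity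
      field_simp
    have hN : ∀ m : ℕ, ChaoticTransport.invN ((a + 1) * (m + 1) - 1, m) ≤ 1 / ((m : ℝ) + 1) := by
      intro m
      unfold ChaoticTransport.invN
      rw [one_div]
      apply inv_anti₀ (by positivity)
      push_cast
      have : (0 : ℝ) ≤ ((a + 1) * (m + 1) - 1 : ℕ) := by positivity
      linarith
    have hb : ∀ m : ℕ, |p.eval (xiFun (a, 0))| ≤ |C| * (1 / ((m : ℝ) + 1)) := by
      intro m
      have := hC ((a + 1) * (m + 1) - 1, m)
      beta_reduce at this
      rw [hx m, pow_one] at this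
      exact this.trans (mul_le_mul (le_abs_self C) (hN m) (invN_pos _).le (abs_nonneg C))
    have hlim := (tendsto_one_div_add_atTop_nhds_zero_nat (𝕜 := ℝ)).const_mul |C|
    rw [mul_zero] at hlim
    exact abs_nonpos_iff.1 (ge_of_tendsto' hlim hb)
  apply Polynomial.eq_zero_of_infinite_isRoot
  refine Set.infinite_of_injective_forall_mem (f := fun a : ℕ => xiFun (a, 0)) ?_ hroot
  have hanti : StrictAnti fun a : ℕ => xiFun (a, 0) := by
    apply strictAnti_nat_of_succ_lt
    intro a
    simp only [xiFun, xiParam]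
    push_cast
    rw [div_lt_div_iff₀ (by positivity) (by positivity)]
    have : (0 : ℝ) ≤ a := by positivity
    nlinarith [this, sq_nonneg (a : ℝ)]
  exact hanti.injective

theorem coeff_eq_zero_of_evalExpansion_mem_bigO {K : ℕ} {c : PowerSeries ℝ[X]}
    (h : evalExpansion (c.trunc K) ∈ bigO K) : ∀ j < K, PowerSeries.coeff j c = 0 := by
  intro j
  induction j using Nat.strong_induction_on with
  | _ j ih =>
    intro hj
    have h1 : evalExpansion (c.trunc (j + 1)) ∈ bigO (j + 1) := by
      have h2 : evalExpansion (c.trunc K - c.trunc (j + 1)) ∈ bigO (j + 1) :=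
        evalExpansion_mem_bigO fun l hl => by
          rw [Polynomial.coeff_sub, PowerSeries.coeff_trunc, PowerSeries.coeff_trunc,
            if_pos (by omega), if_pos hl, sub_self]
      have := sub_mem (bigO_antitone (show j + 1 ≤ K by omega) h) h2
      rwa [← map_sub, sub_sub_cancel] at this
    apply eq_zero_of_eval_xiFun_mem_bigO_one
    obtain ⟨C, hC⟩ := h1
    refine ⟨C, fun i => ?_⟩
    have h3 := hC i
    rw [evalExpansion_trunc_apply, Finset.sum_range_succ, Finset.sum_eq_zero, zero_add, abs_mul,
      abs_of_pos (pow_pos (invN_pos i) _), pow_succ, mul_comm, ← mul_assoc, mul_comm C, mul_assoc,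
      mul_le_mul_iff_of_pos_left (pow_pos (invN_pos i) _)] at h3
    · simpa using h3
    · intro l hl
      rw [Finset.mem_range] at hl
      rw [ih l hl (hl.trans hj), Polynomial.eval_zero, zero_mul]

/-- Asymptotic expansions are unique. -/
theorem HasExpansion.unique {f : ℕ × ℕ → ℝ} {c d : PowerSeries ℝ[X]} (hc : HasExpansion f c)
    (hd : HasExpansion f d) : c = d := by
  rw [← sub_eq_zero]
  ext1 j
  have h : evalExpansion ((c - d).trunc (j + 1)) ∈ bigO (j + 1) := by
    have := sub_mem (hd (j + 1)) (hc (j + 1))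
    rwa [sub_sub_sub_cancel_left, ← map_sub, ← map_sub] at this
  rw [coeff_eq_zero_of_evalExpansion_mem_bigO h j (Nat.lt_succ_self j), map_zero]

/-- Expansions to every finite order fit together to a single series. -/
theorem exists_hasExpansion {f : ℕ × ℕ → ℝ}
    (h : ∀ K, ∃ c : PowerSeries ℝ[X], f - evalExpansion (c.trunc K) ∈ bigO K) :
    ∃ c, HasExpansion f c := by
  choose c hc using h
  refine ⟨PowerSeries.mk fun j => PowerSeries.coeff j (c (j + 1)), fun K => ?_⟩
  have hcoh : ∀ j < K, PowerSeries.coeff j (c (j + 1)) = PowerSeries.coeff j (c K) := by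
    intro j hj
    have h1 : evalExpansion ((c K).trunc K - (c K).trunc (j + 1)) ∈ bigO (j + 1) :=
      evalExpansion_mem_bigO fun l hl => by
        rw [Polynomial.coeff_sub, PowerSeries.coeff_trunc, PowerSeries.coeff_trunc,
          if_pos (by omega), if_pos hl, sub_self]
    have h2 : evalExpansion ((c (j + 1) - c K).trunc (j + 1)) ∈ bigO (j + 1) := by
      have := add_mem (sub_mem (bigO_antitone (show j + 1 ≤ K by omega) (hc K)) (hc (j + 1))) h1
      convert this using 1
      rw [map_sub, map_sub, map_sub]
      ring
    have := coeff_eq_zero_of_evalExpansion_mem_bigO h2 j (Nat.lt_succ_self j)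
    rwa [map_sub, sub_eq_zero] at this
  convert hc K using 3
  ext1 j
  rw [PowerSeries.coeff_trunc, PowerSeries.coeff_trunc]
  split_ifs with hj
  · rw [PowerSeries.coeff_mk, hcoh j hj]
  · rfl

/-- The algebra of families with an asymptotic expansion. -/
noncomputable def expandable : Subalgebra ℝ (ℕ × ℕ → ℝ) where
  carrier := {f | ∃ c, HasExpansion f c}
  mul_mem' := fun ⟨c, hc⟩ ⟨d, hd⟩ => ⟨c * d, hc.mul hd⟩
  add_mem' := fun ⟨c, hc⟩ ⟨d, hd⟩ => ⟨c + d, hc.add hd⟩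
  algebraMap_mem' a := ⟨_, HasExpansion.const a⟩

theorem invN_mem_expandable : invN ∈ expandable := ⟨_, HasExpansion.invN⟩

theorem xiFun_mem_expandable : xiFun ∈ expandable := ⟨_, HasExpansion.xiFun⟩

/-- The sums `e + u / N` with `e` expandable and `u` in a given module. -/
def expandableAdd (V : Submodule expandable (ℕ × ℕ → ℝ)) :
    Submodule expandable (ℕ × ℕ → ℝ) where
  carrier := {f | ∃ e ∈ expandable, ∃ u ∈ V, f = e + invN * u}
  zero_mem' := ⟨0, zero_mem _, 0, zero_mem _, by simp⟩
  add_mem' := by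
    rintro _ _ ⟨e, he, u, hu, rfl⟩ ⟨e', he', u', hu', rfl⟩
    exact ⟨e + e', add_mem he he', u + u', add_mem hu hu', by ring⟩
  smul_mem' := by
    rintro c _ ⟨e, he, u, hu, rfl⟩
    refine ⟨c.1 * e, mul_mem c.2 he, c • u, V.smul_mem c hu, ?_⟩
    rw [Subalgebra.smul_def, Subalgebra.smul_def, smul_eq_mul, smul_eq_mul]
    ring

/-- If the members of `V` grow at most polynomially, and if each of them is expandable up to
`1 / N` times a member of `V`, then they are expandable: iterate the decomposition until the
remainder is small. -/
theorem le_expandable_of_le_expandableAdd {V : Submodule expandable (ℕ × ℕ → ℝ)} {L : ℕ}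
    (hL : ∀ v ∈ V, invN ^ L * v ∈ bigO 0) (hV : V ≤ expandableAdd V) :
    ∀ v ∈ V, v ∈ expandable := by
  intro v hv
  have hiter : ∀ a : ℕ, ∃ e ∈ expandable, ∃ u ∈ V, v = e + invN ^ a * u := by
    intro a
    induction a with
    | zero => exact ⟨0, zero_mem _, v, hv, by simp⟩
    | succ a ih =>
      obtain ⟨e, he, u, hu, h⟩ := ih
      obtain ⟨e', he', u', hu', h'⟩ := hV hu
      refine ⟨e + invN ^ a * e', add_mem he (mul_mem (pow_mem invN_mem_expandable a) he'), u', hu',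
        ?_⟩
      rw [h, h']
      ring
  apply exists_hasExpansion
  intro K
  obtain ⟨e, ⟨c, hc⟩, u, hu, h⟩ := hiter (K + L)
  refine ⟨c, ?_⟩
  have e1 : v - evalExpansion (c.trunc K) =
      (e - evalExpansion (c.trunc K)) + invN ^ K * (invN ^ L * u) := by
    rw [h]; ring
  rw [e1]
  exact add_mem (hc K) (mul_mem_bigO (invN_pow_mem_bigO K) (hL u hu))

end Asymptotics

/-! ### Existence of the expansions of the moments -/

section Expandability

/-- The densities of the means, as families. -/
noncomputable def meanFun (m : ℕ) (i : ℕ × ℕ) : ℝ := meanDensity (i.1 + 1) (i.2 + 1) m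

/-- The central moments, as families. -/
noncomputable def centralFun (s : Multiset ℕ) (i : ℕ × ℕ) : ℝ :=
  centralMoment (i.1 + 1) (i.2 + 1) s

theorem centralFun_zero : centralFun 0 = 1 := funext fun _ => centralMoment_zero _ _

theorem centralFun_singleton (m : ℕ) : centralFun {m} = 0 :=
  funext fun _ => centralMoment_singleton _ _ m

theorem meanFun_loop {k : ℕ} (hk : 1 ≤ k) :
    (1 + (k : ℕ × ℕ → ℝ) * invN) * meanFun k +
        ∑ l ∈ Finset.Ico 1 k, meanFun l * meanFun (k - l) +
        invN ^ 2 * ∑ l ∈ Finset.Ico 1 k, centralFun {l, k - l} = xiFun := by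
  ext i
  have h := meanDensity_loop (i.1 + 1) (i.2 + 1) (by positivity) hk
  simpa [invN, meanFun, centralFun, xiFun, Finset.sum_apply] using h

theorem centralFun_loop (s : Multiset ℕ) {k : ℕ} (hk : 1 ≤ k) :
    (1 + (k : ℕ × ℕ → ℝ) * invN) * centralFun (k ::ₘ s) +
        2 * ∑ l ∈ Finset.Ico 1 k, meanFun l * centralFun ((k - l) ::ₘ s) +
        invN * ∑ l ∈ Finset.Ico 1 k, (centralFun (l ::ₘ (k - l) ::ₘ s) -
          centralFun {l, k - l} * centralFun s) =
      (s.map fun m : ℕ => 2 * (m : ℕ × ℕ → ℝ) * ((meanFun m - meanFun (m + k)) *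
        centralFun (s.erase m) + invN * (centralFun s -
        centralFun ((m + k) ::ₘ s.erase m)))).sum := by
  ext i
  have h := centralMoment_loop (i.1 + 1) (i.2 + 1) (by positivity) s hk
  have hR : ∀ f : ℕ → ℕ × ℕ → ℝ, (s.map f).sum i = (s.map fun m => f m i).sum := fun f => by
    have := map_multiset_sum (Pi.evalAddMonoidHom (fun _ : ℕ × ℕ => ℝ) i) (s.map f)
    rwa [Multiset.map_map] at this
  rw [hR]
  simpa [invN, meanFun, centralFun, Finset.sum_apply] using h

theorem invN_pow_mul_pow (n : ℕ) (i : ℕ × ℕ) :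
    invN i ^ n * (((i.1 + 1 : ℕ) : ℝ) + ((i.2 + 1 : ℕ) : ℝ)) ^ n = 1 := by
  rw [← mul_pow, invN, inv_mul_cancel₀ (by positivity), one_pow]

theorem invN_pow_mul_meanFun_mem_bigO {k : ℕ} (hk : 1 ≤ k) :
    invN ^ (5 * k) * meanFun k ∈ bigO 0 := by
  refine ⟨1, fun i => ?_⟩
  rw [Pi.mul_apply, Pi.pow_apply, abs_mul, abs_of_pos (pow_pos (invN_pos i) _),
    pow_zero, mul_one, ← invN_pow_mul_pow (5 * k) i]
  exact mul_le_mul_of_nonneg_left (abs_meanDensity_le _ _ k hk (by omega))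
    (pow_pos (invN_pos i) _).le

theorem invN_pow_mul_centralFun_mem_bigO {s : Multiset ℕ} (hs : ∀ m ∈ s, 1 ≤ m) :
    invN ^ (5 * s.sum) * centralFun s ∈ bigO 0 := by
  refine ⟨2 ^ s.card, fun i => ?_⟩
  rw [Pi.mul_apply, Pi.pow_apply, abs_mul, abs_of_pos (pow_pos (invN_pos i) _),
    pow_zero, ← invN_pow_mul_pow (5 * s.sum) i, ← mul_assoc, mul_comm (2 ^ s.card), mul_assoc]
  exact mul_le_mul_of_nonneg_left (abs_centralMoment_le _ _ s hs (by omega))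
    (pow_pos (invN_pos i) _).le

theorem natCast_mem_expandable (m : ℕ) : (m : ℕ × ℕ → ℝ) ∈ expandable :=
  natCast_mem _ m

/-- The module over the expandable families spanned by the unknowns of weight `d`: the mean of index
`d`, and the central moments with indices of sum `d`. -/
noncomputable def weightModule (d : ℕ) : Submodule expandable (ℕ × ℕ → ℝ) :=
  Submodule.span expandable
    ({meanFun d} ∪ {f | ∃ s : Multiset ℕ, (∀ m ∈ s, 1 ≤ m) ∧ s.sum = d ∧ f = centralFun s})

theorem expandable_le_bigO {f : ℕ × ℕ → ℝ} (hf : f ∈ expandable) : f ∈ bigO 0 := by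
  obtain ⟨c, hc⟩ := hf
  exact hc.mem_bigO_zero

theorem invN_pow_mul_mem_bigO_of_mem_weightModule {d : ℕ} (hd : 1 ≤ d) :
    ∀ v ∈ weightModule d, invN ^ (5 * d) * v ∈ bigO 0 := by
  intro v hv
  induction hv using Submodule.span_induction with
  | mem f hf =>
    rcases hf with hf | ⟨s, hs, hsd, rfl⟩
    · rw [Set.mem_singleton_iff.1 hf]
      exact invN_pow_mul_meanFun_mem_bigO hd
    · rw [← hsd]
      exact invN_pow_mul_centralFun_mem_bigO hs
  | zero => rw [mul_zero]; exact zero_mem _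
  | add f g _ _ hf hg => rw [mul_add]; exact add_mem hf hg
  | smul c f _ hf =>
    rw [Subalgebra.smul_def, smul_eq_mul, mul_left_comm]
    exact mul_mem_bigO (expandable_le_bigO c.2) hf

theorem mem_expandableAdd_of_mem {V : Submodule expandable (ℕ × ℕ → ℝ)} {f : ℕ × ℕ → ℝ}
    (hf : f ∈ expandable) : f ∈ expandableAdd V :=
  ⟨f, hf, 0, zero_mem _, by simp⟩

theorem invN_mul_mem_expandableAdd {V : Submodule expandable (ℕ × ℕ → ℝ)} {f : ℕ × ℕ → ℝ}
    (hf : f ∈ V) : invN * f ∈ expandableAdd V :=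
  ⟨0, zero_mem _, f, hf, by simp⟩

theorem mul_mem_submodule {V : Submodule expandable (ℕ × ℕ → ℝ)} {c f : ℕ × ℕ → ℝ}
    (hc : c ∈ expandable) (hf : f ∈ V) : c * f ∈ V :=
  V.smul_mem ⟨c, hc⟩ hf

/-- In the loop equations of weight `d`, the unknowns of weight `d` other than the leading one occur
with a factor `1 / N`, or are the mean of weight `d`, for which the same is true. -/
theorem weightModule_le_expandableAdd {d : ℕ} (hd : 1 ≤ d)
    (hmean : ∀ k, 1 ≤ k → k < d → meanFun k ∈ expandable)
    (hcent : ∀ s : Multiset ℕ, (∀ m ∈ s, 1 ≤ m) → s.sum < d → centralFun s ∈ expandable) :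
    weightModule d ≤ expandableAdd (weightModule d) := by
  have hmeanV : meanFun d ∈ weightModule d := Submodule.subset_span (Or.inl rfl)
  have hcentV : ∀ s : Multiset ℕ, (∀ m ∈ s, 1 ≤ m) → s.sum = d → centralFun s ∈ weightModule d :=
    fun s h1 h2 => Submodule.subset_span (Or.inr ⟨s, h1, h2, rfl⟩)
  have hmeanW : meanFun d ∈ expandableAdd (weightModule d) := by
    have e : meanFun d = xiFun - invN * ((d : ℕ × ℕ → ℝ) * meanFun d) -
        ∑ l ∈ Finset.Ico 1 d, meanFun l * meanFun (d - l) -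
        ∑ l ∈ Finset.Ico 1 d, invN * (invN * centralFun {l, d - l}) := by
      rw [← meanFun_loop hd, Finset.mul_sum]
      simp only [← mul_assoc, ← pow_two]
      ring
    rw [e]
    refine sub_mem (sub_mem (sub_mem ?_ ?_) ?_) ?_
    · exact mem_expandableAdd_of_mem xiFun_mem_expandable
    · exact invN_mul_mem_expandableAdd (mul_mem_submodule (natCast_mem_expandable d) hmeanV)
    · refine sum_mem fun l hl => mem_expandableAdd_of_mem ?_
      rw [Finset.mem_Ico] at hl
      exact mul_mem (hmean l hl.1 hl.2) (hmean (d - l) (by omega) (by omega))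
    · refine sum_mem fun l hl => invN_mul_mem_expandableAdd
        (mul_mem_submodule invN_mem_expandable (hcentV _ ?_ ?_))
      · rw [Finset.mem_Ico] at hl
        simp only [Multiset.insert_eq_cons, Multiset.mem_cons, Multiset.mem_singleton]
        rintro m (rfl | rfl) <;> omega
      · rw [Finset.mem_Ico] at hl
        simp only [Multiset.insert_eq_cons, Multiset.sum_cons, Multiset.sum_singleton]
        omega
  refine Submodule.span_le.2 ?_
  rintro f (hf | ⟨s, hs, hsd, rfl⟩)
  · rw [Set.mem_singleton_iff.1 hf]
    exact hmeanW
  obtain ⟨k, hks⟩ : ∃ k, k ∈ s := by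
    by_contra hcon
    rw [Multiset.eq_zero_of_forall_notMem (not_exists.1 hcon), Multiset.sum_zero] at hsd
    omega
  obtain ⟨t, rfl⟩ := Multiset.exists_cons_of_mem hks
  have hk : 1 ≤ k := hs k (by simp)
  have ht : ∀ m ∈ t, 1 ≤ m := fun m hm => hs m (by simp [hm])
  rw [Multiset.sum_cons] at hsd
  rcases Multiset.empty_or_exists_mem t with rfl | ⟨m₀, hm₀⟩
  · have := centralFun_singleton k
    rw [← Multiset.cons_zero] at this
    rw [this]
    exact zero_mem _
  have htsum : 1 ≤ t.sum :=
    (ht m₀ hm₀).trans (Multiset.single_le_sum (fun _ _ => Nat.zero_le _) _ hm₀)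
  have e : centralFun (k ::ₘ t) =
      (t.map fun m : ℕ => 2 * (m : ℕ × ℕ → ℝ) * ((meanFun m - meanFun (m + k)) *
        centralFun (t.erase m) + invN * (centralFun t -
        centralFun ((m + k) ::ₘ t.erase m)))).sum -
      invN * ((k : ℕ × ℕ → ℝ) * centralFun (k ::ₘ t)) -
      2 * ∑ l ∈ Finset.Ico 1 k, meanFun l * centralFun ((k - l) ::ₘ t) -
      ∑ l ∈ Finset.Ico 1 k, (invN * centralFun (l ::ₘ (k - l) ::ₘ t) -
        invN * (centralFun {l, k - l} * centralFun t)) := by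
    rw [← centralFun_loop t hk]
    simp only [← mul_sub, ← Finset.mul_sum]
    ring
  rw [SetLike.mem_coe, e]
  refine sub_mem (sub_mem (sub_mem ?_ ?_) ?_) ?_
  · refine multiset_sum_mem _ fun f hf => ?_
    obtain ⟨m, hm, rfl⟩ := Multiset.mem_map.1 hf
    have hm1 := ht m hm
    have hsum : m + (t.erase m).sum = t.sum := by
      rw [← Multiset.sum_cons, Multiset.cons_erase hm]
    have hpos : ∀ j ∈ t.erase m, 1 ≤ j := fun j hj => ht j (Multiset.mem_of_mem_erase hj)
    have hE := hcent (t.erase m) hpos (by omega)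
    refine mul_mem_submodule (mul_mem (natCast_mem_expandable 2) (natCast_mem_expandable m)) ?_
    rw [sub_mul, mul_sub]
    refine add_mem (sub_mem ?_ ?_) (sub_mem ?_ ?_)
    · exact mem_expandableAdd_of_mem (mul_mem (hmean m hm1 (by omega)) hE)
    · rw [mul_comm]
      refine mul_mem_submodule hE ?_
      rcases (show m + k ≤ d by omega).lt_or_eq with hlt | heq
      · exact mem_expandableAdd_of_mem (hmean _ (by omega) hlt)
      · rw [heq]
        exact hmeanW
    · exact mem_expandableAdd_of_mem (mul_mem invN_mem_expandable (hcent t ht (by omega)))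
    · refine invN_mul_mem_expandableAdd (hcentV _ ?_ ?_)
      · intro j hj
        rcases Multiset.mem_cons.1 hj with rfl | hj
        · omega
        · exact hpos j hj
      · rw [Multiset.sum_cons]
        omega
  · exact invN_mul_mem_expandableAdd (mul_mem_submodule (natCast_mem_expandable k)
      (hcentV _ hs (by rw [Multiset.sum_cons]; exact hsd)))
  · refine mem_expandableAdd_of_mem (mul_mem (natCast_mem_expandable 2) (sum_mem fun l hl => ?_))
    rw [Finset.mem_Ico] at hl
    refine mul_mem (hmean l hl.1 (by omega)) (hcent _ ?_ ?_)
    · intro j hj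
      rcases Multiset.mem_cons.1 hj with rfl | hj
      · omega
      · exact ht j hj
    · rw [Multiset.sum_cons]
      omega
  · refine sum_mem fun l hl => ?_
    rw [Finset.mem_Ico] at hl
    refine sub_mem (invN_mul_mem_expandableAdd (hcentV _ ?_ ?_)) (mem_expandableAdd_of_mem
      (mul_mem invN_mem_expandable (mul_mem (hcent _ ?_ ?_) (hcent t ht (by omega)))))
    · intro j hj
      rcases Multiset.mem_cons.1 hj with rfl | hj
      · omega
      · rcases Multiset.mem_cons.1 hj with rfl | hj
        · omega
        · exact ht j hj
    · rw [Multiset.sum_cons, Multiset.sum_cons]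
      omega
    · simp only [Multiset.insert_eq_cons, Multiset.mem_cons, Multiset.mem_singleton]
      rintro m (rfl | rfl) <;> omega
    · simp only [Multiset.insert_eq_cons, Multiset.sum_cons, Multiset.sum_singleton]
      omega

/-- The means and the central moments have asymptotic expansions, by induction on the weight. -/
theorem mem_expandable_of_weight_le (d : ℕ) :
    (∀ k, 1 ≤ k → k ≤ d → meanFun k ∈ expandable) ∧
      ∀ s : Multiset ℕ, (∀ m ∈ s, 1 ≤ m) → s.sum ≤ d → centralFun s ∈ expandable := by
  induction d with
  | zero =>
    refine ⟨fun k h1 h2 => by omega, fun s hs h0 => ?_⟩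
    rcases Multiset.empty_or_exists_mem s with rfl | ⟨m, hm⟩
    · rw [centralFun_zero]
      exact one_mem _
    · have := Multiset.single_le_sum (fun _ _ => Nat.zero_le _) _ hm
      have := hs m hm
      omega
  | succ d ih =>
    have hle := le_expandable_of_le_expandableAdd
      (invN_pow_mul_mem_bigO_of_mem_weightModule (d := d + 1) (by omega))
      (weightModule_le_expandableAdd (by omega) (fun k h1 h2 => ih.1 k h1 (by omega))
        (fun s hs h => ih.2 s hs (by omega)))
    refine ⟨fun k h1 h2 => ?_, fun s hs h => ?_⟩
    · rcases h2.lt_or_eq with h2 | rfl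
      · exact ih.1 k h1 (by omega)
      · exact hle _ (Submodule.subset_span (Or.inl rfl))
    · rcases h.lt_or_eq with h2 | h2
      · exact ih.2 s hs (by omega)
      · exact hle _ (Submodule.subset_span (Or.inr ⟨s, hs, h2, rfl⟩))

end Expandability

/-! ### Loop equations for the coefficients of the expansions -/

section Coefficients

/-- The asymptotic expansion of a family, if there is one, and an arbitrary series otherwise. -/
noncomputable def expansionOf (f : ℕ × ℕ → ℝ) : PowerSeries ℝ[X] :=
  Classical.epsilon (HasExpansion f)

theorem hasExpansion_meanFun {k : ℕ} (hk : 1 ≤ k) :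
    HasExpansion (meanFun k) (expansionOf (meanFun k)) :=
  Classical.epsilon_spec ((mem_expandable_of_weight_le k).1 k hk le_rfl)

theorem hasExpansion_centralFun {s : Multiset ℕ} (hs : ∀ m ∈ s, 1 ≤ m) :
    HasExpansion (centralFun s) (expansionOf (centralFun s)) :=
  Classical.epsilon_spec ((mem_expandable_of_weight_le s.sum).2 s hs le_rfl)

theorem HasExpansion.natCast (m : ℕ) : HasExpansion (m : ℕ × ℕ → ℝ) (m : PowerSeries ℝ[X]) := by
  have := HasExpansion.const m
  rwa [map_natCast, map_natCast, map_natCast] at this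

theorem HasExpansion.multiset_sum {κ : Type*} {s : Multiset κ} {f : κ → ℕ × ℕ → ℝ}
    {c : κ → PowerSeries ℝ[X]} (h : ∀ a ∈ s, HasExpansion (f a) (c a)) :
    HasExpansion (s.map f).sum (s.map c).sum := by
  induction s using Multiset.induction_on with
  | empty => simpa using HasExpansion.natCast 0
  | cons a s ih =>
    rw [Multiset.map_cons, Multiset.map_cons, Multiset.sum_cons, Multiset.sum_cons]
    exact (h a (by simp)).add (ih fun b hb => h b (by simp [hb]))

/-- The expansion of the mean of `Tr (t† t) ^ k`, divided by `N`. -/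
noncomputable def meanSeries (k : ℕ) : PowerSeries ℝ[X] := expansionOf (meanFun k)

/-- The expansion of a central moment. -/
noncomputable def centralSeries (s : Multiset ℕ) : PowerSeries ℝ[X] := expansionOf (centralFun s)

theorem centralSeries_zero : centralSeries 0 = 1 := by
  have h := hasExpansion_centralFun (s := 0) (by simp)
  have h1 := HasExpansion.natCast 1
  rw [Nat.cast_one, Nat.cast_one, ← centralFun_zero] at h1
  exact h.unique h1

theorem centralSeries_singleton {m : ℕ} (hm : 1 ≤ m) : centralSeries {m} = 0 := by
  have h := hasExpansion_centralFun (s := {m}) (by simpa using hm)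
  have h1 := HasExpansion.natCast 0
  rw [Nat.cast_zero, Nat.cast_zero, ← centralFun_singleton m] at h1
  exact h.unique h1

theorem forall_mem_pair {a b : ℕ} (ha : 1 ≤ a) (hb : 1 ≤ b) :
    ∀ m ∈ ({a, b} : Multiset ℕ), 1 ≤ m := by
  simp only [Multiset.insert_eq_cons, Multiset.mem_cons, Multiset.mem_singleton]
  rintro m (rfl | rfl) <;> assumption

theorem forall_mem_cons {a : ℕ} {s : Multiset ℕ} (ha : 1 ≤ a) (hs : ∀ m ∈ s, 1 ≤ m) :
    ∀ m ∈ a ::ₘ s, 1 ≤ m := by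
  intro m hm
  rcases Multiset.mem_cons.1 hm with rfl | hm
  exacts [ha, hs m hm]

theorem meanSeries_loop {k : ℕ} (hk : 1 ≤ k) :
    (1 + (k : PowerSeries ℝ[X]) * PowerSeries.X) * meanSeries k +
        ∑ l ∈ Finset.Ico 1 k, meanSeries l * meanSeries (k - l) +
        PowerSeries.X ^ 2 * ∑ l ∈ Finset.Ico 1 k, centralSeries {l, k - l} =
      PowerSeries.C Polynomial.X := by
  refine HasExpansion.unique (f := xiFun) ?_ HasExpansion.xiFun
  rw [← meanFun_loop hk, pow_two, pow_two]
  have h1 := HasExpansion.natCast 1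
  rw [Nat.cast_one, Nat.cast_one] at h1
  refine (((h1.add ((HasExpansion.natCast k).mul .invN)).mul (hasExpansion_meanFun hk)).add
    (HasExpansion.sum fun l hl => ?_)).add
      ((HasExpansion.invN.mul .invN).mul (HasExpansion.sum fun l hl => ?_)) <;>
    rw [Finset.mem_Ico] at hl
  · exact (hasExpansion_meanFun hl.1).mul (hasExpansion_meanFun (by omega))
  · exact hasExpansion_centralFun (forall_mem_pair hl.1 (by omega))

theorem centralSeries_loop {s : Multiset ℕ} (hs : ∀ m ∈ s, 1 ≤ m) {k : ℕ} (hk : 1 ≤ k) :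
    (1 + (k : PowerSeries ℝ[X]) * PowerSeries.X) * centralSeries (k ::ₘ s) +
        2 * ∑ l ∈ Finset.Ico 1 k, meanSeries l * centralSeries ((k - l) ::ₘ s) +
        PowerSeries.X * ∑ l ∈ Finset.Ico 1 k, (centralSeries (l ::ₘ (k - l) ::ₘ s) -
          centralSeries {l, k - l} * centralSeries s) =
      (s.map fun m : ℕ => 2 * (m : PowerSeries ℝ[X]) * ((meanSeries m - meanSeries (m + k)) *
        centralSeries (s.erase m) + PowerSeries.X * (centralSeries s -
        centralSeries ((m + k) ::ₘ s.erase m)))).sum := by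
  have h1 := HasExpansion.natCast 1
  rw [Nat.cast_one, Nat.cast_one] at h1
  have h2 := HasExpansion.natCast 2
  rw [Nat.cast_ofNat, Nat.cast_ofNat] at h2
  refine HasExpansion.unique (((h1.add ((HasExpansion.natCast k).mul .invN)).mul
    (hasExpansion_centralFun (forall_mem_cons hk hs))).add
    (h2.mul (HasExpansion.sum fun l hl => ?_)) |>.add (HasExpansion.invN.mul
      (HasExpansion.sum fun l hl => ?_))) (centralFun_loop s hk ▸ HasExpansion.multiset_sum
      fun m hm => ?_)
  · rw [Finset.mem_Ico] at hl
    exact (hasExpansion_meanFun hl.1).mul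
      (hasExpansion_centralFun (forall_mem_cons (by omega) hs))
  · rw [Finset.mem_Ico] at hl
    exact (hasExpansion_centralFun (forall_mem_cons hl.1 (forall_mem_cons (by omega) hs))).sub
      ((hasExpansion_centralFun (forall_mem_pair hl.1 (by omega))).mul (hasExpansion_centralFun hs))
  · have hm1 := hs m hm
    have he : ∀ j ∈ s.erase m, 1 ≤ j := fun j hj => hs j (Multiset.mem_of_mem_erase hj)
    exact (h2.mul (HasExpansion.natCast m)).mul
      ((((hasExpansion_meanFun hm1).sub (hasExpansion_meanFun (by omega))).mul
        (hasExpansion_centralFun he)).add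
      (HasExpansion.invN.mul ((hasExpansion_centralFun hs).sub
        (hasExpansion_centralFun (forall_mem_cons (by omega) he)))))

/-- The coefficient of `N ^ (-j)` in the expansion of the mean density. -/
noncomputable def meanCoeff (j k : ℕ) : ℝ[X] := PowerSeries.coeff j (meanSeries k)

/-- The coefficient of `N ^ (-j)` in the expansion of the covariance. -/
noncomputable def covCoeff (j k m : ℕ) : ℝ[X] := PowerSeries.coeff j (centralSeries {k, m})

theorem coeff_zero_mul_eq {R : Type*} [CommSemiring R] (a b : PowerSeries R) :
    PowerSeries.coeff 0 (a * b) = PowerSeries.coeff 0 a * PowerSeries.coeff 0 b := by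
  simp

theorem coeff_one_mul_eq {R : Type*} [CommSemiring R] (a b : PowerSeries R) :
    PowerSeries.coeff 1 (a * b) = PowerSeries.coeff 0 a * PowerSeries.coeff 1 b +
      PowerSeries.coeff 1 a * PowerSeries.coeff 0 b := by
  rw [PowerSeries.coeff_mul, Finset.Nat.antidiagonal_succ]
  simp

theorem coeff_natCast_one (k : ℕ) :
    PowerSeries.coeff 1 ((k : PowerSeries ℝ[X])) = 0 := by
  rw [← map_natCast (PowerSeries.C (R := ℝ[X])), PowerSeries.coeff_C]
  simp

theorem coeff_natCast_zero (k : ℕ) :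
    PowerSeries.coeff 0 ((k : PowerSeries ℝ[X])) = k := by
  rw [← map_natCast (PowerSeries.C (R := ℝ[X])), PowerSeries.coeff_C]
  simp

theorem coeff_two_one : PowerSeries.coeff 1 (2 : PowerSeries ℝ[X]) = 0 :=
  coeff_natCast_one 2

theorem coeff_two_zero : PowerSeries.coeff 0 (2 : PowerSeries ℝ[X]) = 2 :=
  coeff_natCast_zero 2

theorem meanCoeff_zero_loop {k : ℕ} (hk : 1 ≤ k) :
    meanCoeff 0 k + ∑ l ∈ Finset.Ico 1 k, meanCoeff 0 l * meanCoeff 0 (k - l) = Polynomial.X := by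
  have h := congrArg (PowerSeries.coeff 0) (meanSeries_loop hk)
  simpa [meanCoeff, add_mul, mul_assoc, PowerSeries.coeff_zero_mul_X] using h

theorem meanCoeff_one_loop {k : ℕ} (hk : 1 ≤ k) :
    meanCoeff 1 k + k * meanCoeff 0 k + ∑ l ∈ Finset.Ico 1 k,
      (meanCoeff 0 l * meanCoeff 1 (k - l) + meanCoeff 1 l * meanCoeff 0 (k - l)) = 0 := by
  have h := congrArg (PowerSeries.coeff 1) (meanSeries_loop hk)
  simp only [map_add, coeff_one_mul_eq, coeff_zero_mul_eq, pow_two, add_mul, one_mul, map_sum,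
    coeff_natCast_one, coeff_natCast_zero, PowerSeries.coeff_zero_X, PowerSeries.coeff_one_X,
    PowerSeries.coeff_C,
    one_ne_zero, if_false, mul_zero, zero_mul, mul_one, add_zero, zero_add] at h
  exact h

/-- Third central moments are `O(1 / N)`. -/
theorem coeff_zero_centralSeries_triple {k m n : ℕ} (hk : 1 ≤ k) (hm : 1 ≤ m) (hn : 1 ≤ n) :
    PowerSeries.coeff 0 (centralSeries (k ::ₘ {m, n})) = 0 := by
  induction k using Nat.strong_induction_on with
  | _ k ih =>
    have h := congrArg (PowerSeries.coeff 0) (centralSeries_loop (forall_mem_pair hm hn) hk)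
    have e1 : (({m, n} : Multiset ℕ).erase m) = {n} := by
      rw [Multiset.insert_eq_cons, Multiset.erase_cons_head]
    have e2 : (({m, n} : Multiset ℕ).erase n) = {m} := by
      rw [Multiset.pair_comm, Multiset.insert_eq_cons, Multiset.erase_cons_head]
    rw [Multiset.insert_eq_cons m, Multiset.map_cons, Multiset.map_singleton, Multiset.sum_cons,
      Multiset.sum_singleton, ← Multiset.insert_eq_cons m, e1, e2, centralSeries_singleton hm,
      centralSeries_singleton hn] at h
    have hsum : PowerSeries.coeff 0 (∑ l ∈ Finset.Ico 1 k,
        meanSeries l * centralSeries ((k - l) ::ₘ {m, n})) = 0 := by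
      rw [map_sum]
      refine Finset.sum_eq_zero fun l hl => ?_
      rw [Finset.mem_Ico] at hl
      rw [coeff_zero_mul_eq, ih (k - l) (by omega) (by omega), mul_zero]
    simp only [map_add, coeff_zero_mul_eq, add_mul, one_mul, PowerSeries.coeff_zero_X, mul_zero,
      zero_mul, add_zero, zero_add, hsum] at h
    exact h

/-- The equation for the covariances: the central moments of single traces vanish, and only third
central moments couple to it from above. -/
theorem covSeries_loop {k m : ℕ} (hk : 1 ≤ k) (hm : 1 ≤ m) :
    (1 + (k : PowerSeries ℝ[X]) * PowerSeries.X) * centralSeries {k, m} +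
        2 * ∑ l ∈ Finset.Ico 1 k, meanSeries l * centralSeries {k - l, m} +
        PowerSeries.X * ∑ l ∈ Finset.Ico 1 k, centralSeries (l ::ₘ (k - l) ::ₘ {m}) =
      2 * (m : PowerSeries ℝ[X]) * (meanSeries m - meanSeries (m + k)) := by
  have h := centralSeries_loop (s := {m}) (by simpa using hm) hk
  rw [Multiset.map_singleton, Multiset.sum_singleton, Multiset.erase_singleton, centralSeries_zero,
    Multiset.cons_zero, centralSeries_singleton hm, centralSeries_singleton (by omega)] at h
  simp only [mul_zero, sub_zero, add_zero, mul_one] at h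
  exact h

theorem covCoeff_zero_loop {k m : ℕ} (hk : 1 ≤ k) (hm : 1 ≤ m) :
    covCoeff 0 k m + 2 * ∑ l ∈ Finset.Ico 1 k, meanCoeff 0 l * covCoeff 0 (k - l) m =
      2 * m * (meanCoeff 0 m - meanCoeff 0 (m + k)) := by
  have h := congrArg (PowerSeries.coeff 0) (covSeries_loop hk hm)
  simp only [map_add, map_sub, map_sum, coeff_zero_mul_eq, add_mul, one_mul, coeff_natCast_zero,
    coeff_two_zero, PowerSeries.coeff_zero_X, mul_zero, zero_mul, add_zero] at h
  exact h

theorem covCoeff_one_loop {k m : ℕ} (hk : 1 ≤ k) (hm : 1 ≤ m) :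
    covCoeff 1 k m + k * covCoeff 0 k m + 2 * ∑ l ∈ Finset.Ico 1 k,
      (meanCoeff 0 l * covCoeff 1 (k - l) m + meanCoeff 1 l * covCoeff 0 (k - l) m) =
      2 * m * (meanCoeff 1 m - meanCoeff 1 (m + k)) := by
  have h := congrArg (PowerSeries.coeff 1) (covSeries_loop hk hm)
  have h0 : ∑ l ∈ Finset.Ico 1 k,
      PowerSeries.coeff 0 (centralSeries (l ::ₘ (k - l) ::ₘ {m})) = 0 := by
    refine Finset.sum_eq_zero fun l hl => ?_
    rw [Finset.mem_Ico] at hl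
    exact coeff_zero_centralSeries_triple hl.1 (by omega) hm
  simp only [map_add, map_sub, map_sum, coeff_one_mul_eq, coeff_zero_mul_eq, add_mul, one_mul,
    coeff_natCast_zero, coeff_natCast_one, coeff_two_zero, coeff_two_one, PowerSeries.coeff_zero_X,
    PowerSeries.coeff_one_X, mul_zero, zero_mul, mul_one, add_zero, zero_add, h0] at h
  exact h

end Coefficients

/-! ### Power series with coefficients of polynomial growth -/

section PolynomialGrowth

/-- Power series with coefficients of at most polynomial growth. -/
def HasPolyGrowth (f : PowerSeries ℝ) : Prop :=
  ∃ (C : ℝ) (L : ℕ), ∀ n, |PowerSeries.coeff n f| ≤ C * ((n : ℝ) + 1) ^ L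

namespace HasPolyGrowth

variable {f g : PowerSeries ℝ}

theorem exists_common (hf : HasPolyGrowth f) (hg : HasPolyGrowth g) :
    ∃ (C : ℝ) (L : ℕ), 0 ≤ C ∧ (∀ n, |PowerSeries.coeff n f| ≤ C * ((n : ℝ) + 1) ^ L) ∧
      ∀ n, |PowerSeries.coeff n g| ≤ C * ((n : ℝ) + 1) ^ L := by
  obtain ⟨C, L, hC⟩ := hf
  obtain ⟨D, K, hD⟩ := hg
  refine ⟨max |C| |D|, max L K, le_max_of_le_left (abs_nonneg C), fun n => (hC n).trans ?_,
    fun n => (hD n).trans ?_⟩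
  · exact mul_le_mul ((le_abs_self C).trans (le_max_left _ _))
      (pow_le_pow_right₀ (by linarith [n.cast_nonneg (α := ℝ)]) (le_max_left _ _)) (by positivity)
      (by positivity)
  · exact mul_le_mul ((le_abs_self D).trans (le_max_right _ _))
      (pow_le_pow_right₀ (by linarith [n.cast_nonneg (α := ℝ)]) (le_max_right _ _)) (by positivity)
      (by positivity)

theorem add (hf : HasPolyGrowth f) (hg : HasPolyGrowth g) : HasPolyGrowth (f + g) := by
  obtain ⟨C, L, -, h1, h2⟩ := hf.exists_common hg
  refine ⟨C + C, L, fun n => ?_⟩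
  rw [map_add, add_mul]
  exact (abs_add_le _ _).trans (add_le_add (h1 n) (h2 n))

theorem mul (hf : HasPolyGrowth f) (hg : HasPolyGrowth g) : HasPolyGrowth (f * g) := by
  obtain ⟨C, L, h0, h1, h2⟩ := hf.exists_common hg
  refine ⟨C * C, L + L + 1, fun n => ?_⟩
  rw [PowerSeries.coeff_mul]
  have hb : ∀ p ∈ Finset.HasAntidiagonal.antidiagonal n,
      |PowerSeries.coeff p.1 f * PowerSeries.coeff p.2 g| ≤ C * C * ((n : ℝ) + 1) ^ (L + L) := by
    intro p hp
    rw [Finset.HasAntidiagonal.mem_antidiagonal] at hp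
    have e1 : (p.1 : ℝ) ≤ n := by exact_mod_cast (by omega : p.1 ≤ n)
    have e2 : (p.2 : ℝ) ≤ n := by exact_mod_cast (by omega : p.2 ≤ n)
    rw [abs_mul]
    calc _ ≤ (C * ((p.1 : ℝ) + 1) ^ L) * (C * ((p.2 : ℝ) + 1) ^ L) :=
          mul_le_mul (h1 _) (h2 _) (abs_nonneg _) (by positivity)
      _ ≤ (C * ((n : ℝ) + 1) ^ L) * (C * ((n : ℝ) + 1) ^ L) := by gcongr
      _ = _ := by ring
  refine (Finset.abs_sum_le_sum_abs _ _).trans ((Finset.sum_le_sum hb).trans (le_of_eq ?_))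
  rw [Finset.sum_const, Finset.Nat.card_antidiagonal, nsmul_eq_mul]
  push_cast
  ring

theorem C (c : ℝ) : HasPolyGrowth (PowerSeries.C c) := by
  refine ⟨|c|, 0, fun n => ?_⟩
  rw [PowerSeries.coeff_C]
  split_ifs <;> simp

theorem X : HasPolyGrowth PowerSeries.X := by
  refine ⟨1, 0, fun n => ?_⟩
  rw [PowerSeries.coeff_X]
  split_ifs <;> simp

theorem one : HasPolyGrowth 1 := by
  simpa using C 1

theorem neg (hf : HasPolyGrowth f) : HasPolyGrowth (-f) := by
  obtain ⟨C, L, h⟩ := hf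
  exact ⟨C, L, fun n => by rw [map_neg, abs_neg]; exact h n⟩

theorem sub (hf : HasPolyGrowth f) (hg : HasPolyGrowth g) : HasPolyGrowth (f - g) := by
  rw [sub_eq_add_neg]
  exact hf.add hg.neg

theorem summable_norm (hf : HasPolyGrowth f) {s : ℝ} (hs : |s| < 1) :
    Summable fun n => ‖PowerSeries.coeff n f * s ^ n‖ := by
  obtain ⟨C, L, h⟩ := hf
  have h1 := summable_pow_mul_geometric_of_norm_lt_one (R := ℝ) L (r := |s|) (by simpa using hs)
  have h0 := summable_pow_mul_geometric_of_norm_lt_one (R := ℝ) 0 (r := |s|) (by simpa using hs)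
  have hsum := (h1.add h0).mul_left (|C| * 2 ^ L)
  refine Summable.of_nonneg_of_le (fun n => norm_nonneg _) (fun n => ?_) hsum
  rw [norm_mul, norm_pow, Real.norm_eq_abs, Real.norm_eq_abs, pow_zero, ← add_mul, ← mul_assoc]
  refine mul_le_mul_of_nonneg_right ((h n).trans ?_) (by positivity)
  rw [mul_assoc]
  refine mul_le_mul (le_abs_self C) ?_ (by positivity) (abs_nonneg C)
  rcases Nat.eq_zero_or_pos n with rfl | hn
  · have h2 : (1 : ℝ) ≤ 2 ^ L := one_le_pow₀ (by norm_num)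
    have h3 : (0 : ℝ) ≤ ((0 : ℕ) : ℝ) ^ L := by positivity
    simp only [Nat.cast_zero, zero_add, one_pow] at h3 ⊢
    nlinarith
  · have hn1 : (1 : ℝ) ≤ n := by exact_mod_cast hn
    calc ((n : ℝ) + 1) ^ L ≤ (2 * n) ^ L := by gcongr; linarith
      _ = 2 ^ L * (n : ℝ) ^ L := by rw [mul_pow]
      _ ≤ _ := by gcongr; linarith

end HasPolyGrowth

/-- The sum of a power series at a real number; only used where the series converges absolutely. -/
noncomputable def evalSeries (f : PowerSeries ℝ) (s : ℝ) : ℝ :=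
  ∑' n, PowerSeries.coeff n f * s ^ n

section EvalSeries

variable {f g : PowerSeries ℝ} {s : ℝ}

theorem HasPolyGrowth.hasSum (hf : HasPolyGrowth f) (hs : |s| < 1) :
    HasSum (fun n => PowerSeries.coeff n f * s ^ n) (evalSeries f s) :=
  (hf.summable_norm hs).of_norm.hasSum

theorem evalSeries_sub (hf : HasPolyGrowth f) (hg : HasPolyGrowth g) (hs : |s| < 1) :
    evalSeries (f - g) s = evalSeries f s - evalSeries g s := by
  refine ((hf.sub hg).hasSum hs).unique ?_
  simpa only [map_sub, sub_mul] using (hf.hasSum hs).sub (hg.hasSum hs)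

theorem evalSeries_neg (hf : HasPolyGrowth f) (hs : |s| < 1) :
    evalSeries (-f) s = -evalSeries f s := by
  refine (hf.neg.hasSum hs).unique ?_
  simpa only [map_neg, neg_mul] using (hf.hasSum hs).neg

theorem evalSeries_mul (hf : HasPolyGrowth f) (hg : HasPolyGrowth g) (hs : |s| < 1) :
    evalSeries (f * g) s = evalSeries f s * evalSeries g s := by
  rw [evalSeries, evalSeries, evalSeries, tsum_mul_tsum_eq_tsum_sum_antidiagonal_of_summable_norm
    (hf.summable_norm hs) (hg.summable_norm hs)]
  refine tsum_congr fun n => ?_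
  rw [PowerSeries.coeff_mul, Finset.sum_mul]
  refine Finset.sum_congr rfl fun p hp => ?_
  rw [Finset.HasAntidiagonal.mem_antidiagonal] at hp
  rw [← hp, pow_add]
  ring

theorem evalSeries_C (c : ℝ) : evalSeries (PowerSeries.C c) s = c := by
  rw [evalSeries, tsum_eq_single 0]
  · simp
  · intro n hn
    rw [PowerSeries.coeff_C, if_neg hn, zero_mul]

theorem evalSeries_one : evalSeries 1 s = 1 := by
  simpa using evalSeries_C (s := s) 1

theorem evalSeries_X : evalSeries PowerSeries.X s = s := by
  rw [evalSeries, tsum_eq_single 1]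
  · simp
  · intro n hn
    rw [PowerSeries.coeff_X, if_neg hn, zero_mul]

end EvalSeries

/-! ### The power series of `(1 - X) ^ (-1 / 2)` -/

/-- The power series of `(1 - X) ^ (-1 / 2)`, with coefficients `(2 n choose n) / 4 ^ n`. -/
noncomputable def invSqrtSeries : PowerSeries ℝ :=
  PowerSeries.mk fun n => (Nat.centralBinom n : ℝ) / 4 ^ n

theorem coeff_invSqrtSeries_succ (n : ℕ) :
    2 * ((n : ℝ) + 1) * PowerSeries.coeff (n + 1) invSqrtSeries =
      (2 * n + 1) * PowerSeries.coeff n invSqrtSeries := by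
  rw [invSqrtSeries, PowerSeries.coeff_mk, PowerSeries.coeff_mk, pow_succ]
  have h : ((n : ℝ) + 1) * Nat.centralBinom (n + 1) = 2 * (2 * n + 1) * Nat.centralBinom n := by
    exact_mod_cast Nat.succ_mul_centralBinom_succ n
  field_simp
  linear_combination 2 * h

theorem coeff_invSqrtSeries_pos (n : ℕ) : 0 < PowerSeries.coeff n invSqrtSeries := by
  rw [invSqrtSeries, PowerSeries.coeff_mk]
  have : 0 < (Nat.centralBinom n : ℝ) := by exact_mod_cast Nat.centralBinom_pos n
  positivity

theorem coeff_invSqrtSeries_succ_le (n : ℕ) :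
    PowerSeries.coeff (n + 1) invSqrtSeries ≤ PowerSeries.coeff n invSqrtSeries := by
  have h1 := coeff_invSqrtSeries_succ n
  have h2 := coeff_invSqrtSeries_pos n
  have h3 : (0 : ℝ) ≤ n := by positivity
  nlinarith

theorem coeff_zero_invSqrtSeries : PowerSeries.coeff 0 invSqrtSeries = 1 := by
  simp [invSqrtSeries]

theorem coeff_invSqrtSeries_le_one (n : ℕ) : PowerSeries.coeff n invSqrtSeries ≤ 1 := by
  induction n with
  | zero => exact coeff_zero_invSqrtSeries.le
  | succ n ih => exact (coeff_invSqrtSeries_succ_le n).trans ih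

/-- The coefficient recursion says `2 (1 - X) B' = B`, hence `B ^ 2 (1 - X)` has derivative zero. -/
theorem invSqrtSeries_sq : invSqrtSeries ^ 2 * (1 - PowerSeries.X) = 1 := by
  have hode : 2 * ((1 - PowerSeries.X) * PowerSeries.derivative ℝ invSqrtSeries) =
      invSqrtSeries := by
    rw [← map_ofNat (PowerSeries.C (R := ℝ)) 2]
    ext n
    rw [PowerSeries.coeff_C_mul, sub_mul, one_mul, map_sub, PowerSeries.coeff_derivative]
    cases n with
    | zero =>
      have := coeff_invSqrtSeries_succ 0
      simp at this ⊢
      linarith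
    | succ n =>
      rw [PowerSeries.coeff_succ_X_mul, PowerSeries.coeff_derivative]
      have := coeff_invSqrtSeries_succ (n + 1)
      push_cast at this ⊢
      linarith
  apply PowerSeries.derivative.ext
  · rw [Derivation.leibniz, Derivation.leibniz_pow, map_sub, PowerSeries.derivative_X]
    simp only [Derivation.map_one_eq_zero, smul_eq_mul, nsmul_eq_mul, zero_sub]
    push_cast
    linear_combination invSqrtSeries * hode
  · have h : PowerSeries.constantCoeff invSqrtSeries = 1 := by
      rw [← PowerSeries.coeff_zero_eq_constantCoeff_apply, coeff_zero_invSqrtSeries]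
    simp [h]

theorem hasPolyGrowth_invSqrtSeries : HasPolyGrowth invSqrtSeries :=
  ⟨1, 0, fun n => by
    rw [abs_of_pos (coeff_invSqrtSeries_pos n), pow_zero, mul_one]
    exact coeff_invSqrtSeries_le_one n⟩

theorem hasPolyGrowth_rescale {f : PowerSeries ℝ} (hf : HasPolyGrowth f) {a : ℝ} (ha : |a| ≤ 1) :
    HasPolyGrowth (PowerSeries.rescale a f) := by
  obtain ⟨C, L, h⟩ := hf
  refine ⟨C, L, fun n => ?_⟩
  rw [PowerSeries.coeff_rescale, abs_mul, abs_pow]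
  exact (mul_le_of_le_one_left (abs_nonneg _) (pow_le_one₀ (abs_nonneg a) ha)).trans (h n)

theorem evalSeries_rescale (f : PowerSeries ℝ) (a s : ℝ) :
    evalSeries (PowerSeries.rescale a f) s = evalSeries f (a * s) := by
  refine tsum_congr fun n => ?_
  rw [PowerSeries.coeff_rescale, mul_pow]
  ring

/-- The sign of the square root is determined by the monotonicity of the coefficients: they make the
partial sums of `(1 - s) B(s)` nonnegative. -/
theorem evalSeries_invSqrtSeries {s : ℝ} (hs : |s| < 1) :
    evalSeries invSqrtSeries s = 1 / √(1 - s) := by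
  have hs1 : 0 < 1 - s := by linarith [(abs_lt.1 hs).2]
  have hg := hasPolyGrowth_invSqrtSeries
  have h1 : HasPolyGrowth (1 - PowerSeries.X) := HasPolyGrowth.one.sub .X
  have hev1 : evalSeries (1 - PowerSeries.X) s = 1 - s := by
    rw [evalSeries_sub .one .X hs, evalSeries_one, evalSeries_X]
  have hsq : evalSeries invSqrtSeries s ^ 2 * (1 - s) = 1 := by
    have := congrArg (evalSeries · s) invSqrtSeries_sq
    beta_reduce at this
    rwa [pow_two, evalSeries_mul (hg.mul hg) h1 hs, evalSeries_mul hg hg hs, hev1, evalSeries_one,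
      ← pow_two] at this
  have hnonneg : 0 ≤ (1 - s) * evalSeries invSqrtSeries s := by
    rw [← hev1, ← evalSeries_mul h1 hg hs]
    have hpart : ∀ N, PowerSeries.coeff N invSqrtSeries ≤ ∑ n ∈ Finset.range (N + 1),
        PowerSeries.coeff n ((1 - PowerSeries.X) * invSqrtSeries) * s ^ n := by
      intro N
      induction N with
      | zero => simp [sub_mul]
      | succ N ih =>
        rw [Finset.sum_range_succ]
        have hc : PowerSeries.coeff (N + 1) ((1 - PowerSeries.X) * invSqrtSeries) =
            PowerSeries.coeff (N + 1) invSqrtSeries - PowerSeries.coeff N invSqrtSeries := by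
          rw [sub_mul, one_mul, map_sub, PowerSeries.coeff_succ_X_mul]
        have hle := coeff_invSqrtSeries_succ_le N
        have hp : s ^ (N + 1) ≤ 1 :=
          (le_abs_self _).trans (by rw [abs_pow]; exact pow_le_one₀ (abs_nonneg s) hs.le)
        rw [hc]
        nlinarith
    have hlim := ((h1.mul hg).hasSum hs).tendsto_sum_nat.comp (Filter.tendsto_add_atTop_nat 1)
    exact ge_of_tendsto' hlim fun N => (coeff_invSqrtSeries_pos N).le.trans (hpart N)
  have hb : 0 ≤ evalSeries invSqrtSeries s := nonneg_of_mul_nonneg_right hnonneg hs1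
  have hb2 : evalSeries invSqrtSeries s ^ 2 = (1 - s)⁻¹ := eq_inv_of_mul_eq_one_left hsq
  rw [← Real.sqrt_sq hb, hb2, Real.sqrt_inv, one_div]

end PolynomialGrowth

/-! ### Solution of the loop equations in formal power series -/

section FormalSolution

/-- The Euler operator `X * d / dX` on power series. -/
noncomputable def eulerOp (f : PowerSeries ℝ) : PowerSeries ℝ :=
  PowerSeries.X * PowerSeries.derivative ℝ f

theorem coeff_eulerOp (f : PowerSeries ℝ) (n : ℕ) :
    PowerSeries.coeff n (eulerOp f) = n * PowerSeries.coeff n f := by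
  cases n with
  | zero => simp [eulerOp]
  | succ n =>
    rw [eulerOp, PowerSeries.coeff_succ_X_mul, PowerSeries.coeff_derivative]
    push_cast
    ring

theorem eulerOp_mul (f g : PowerSeries ℝ) :
    eulerOp (f * g) = eulerOp f * g + f * eulerOp g := by
  rw [eulerOp, eulerOp, eulerOp, Derivation.leibniz, smul_eq_mul, smul_eq_mul]
  ring

theorem eulerOp_add (f g : PowerSeries ℝ) : eulerOp (f + g) = eulerOp f + eulerOp g := by
  rw [eulerOp, eulerOp, eulerOp, map_add, mul_add]

theorem eulerOp_sub (f g : PowerSeries ℝ) : eulerOp (f - g) = eulerOp f - eulerOp g := by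
  rw [eulerOp, eulerOp, eulerOp, map_sub, mul_sub]

theorem eulerOp_C (c : ℝ) : eulerOp (PowerSeries.C c) = 0 := by
  ext n
  rw [coeff_eulerOp, PowerSeries.coeff_C]
  split_ifs with h <;> simp [h]

theorem eulerOp_one : eulerOp 1 = 0 := by
  simpa using eulerOp_C 1

theorem eulerOp_X : eulerOp PowerSeries.X = PowerSeries.X := by
  rw [eulerOp, PowerSeries.derivative_X, mul_one]

theorem HasPolyGrowth.eulerOp {f : PowerSeries ℝ} (hf : HasPolyGrowth f) :
    HasPolyGrowth (eulerOp f) := by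
  obtain ⟨C, L, h⟩ := hf
  refine ⟨C, L + 1, fun n => ?_⟩
  rw [coeff_eulerOp, abs_mul, Nat.abs_cast, pow_succ, ← mul_assoc, mul_comm]
  exact mul_le_mul (h n) (by linarith) (by positivity) ((abs_nonneg _).trans (h n))

/-- The power series with coefficients `f k` for `k ≥ 1` and no constant term. -/
noncomputable def seriesOf (f : ℕ → ℝ) : PowerSeries ℝ :=
  PowerSeries.mk fun k => if k = 0 then 0 else f k

theorem coeff_zero_seriesOf (f : ℕ → ℝ) : PowerSeries.coeff 0 (seriesOf f) = 0 := by
  rw [seriesOf, PowerSeries.coeff_mk, if_pos rfl]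

theorem coeff_seriesOf (f : ℕ → ℝ) {k : ℕ} (hk : 1 ≤ k) :
    PowerSeries.coeff k (seriesOf f) = f k := by
  rw [seriesOf, PowerSeries.coeff_mk, if_neg (by omega)]

theorem coeff_seriesOf_mul (f g : ℕ → ℝ) (k : ℕ) :
    PowerSeries.coeff k (seriesOf f * seriesOf g) = ∑ l ∈ Finset.Ico 1 k, f l * g (k - l) := by
  rw [PowerSeries.coeff_mul, Finset.Nat.sum_antidiagonal_eq_sum_range_succ
    (fun i j => PowerSeries.coeff i (seriesOf f) * PowerSeries.coeff j (seriesOf g))]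
  symm
  refine Finset.sum_subset_zero_on_sdiff (fun l hl => ?_) (fun l hl => ?_) fun l hl => ?_
  · rw [Finset.mem_Ico] at hl
    exact Finset.mem_range.2 (by omega)
  · rw [Finset.mem_sdiff, Finset.mem_range, Finset.mem_Ico] at hl
    rcases Nat.eq_zero_or_pos l with rfl | h
    · rw [coeff_zero_seriesOf, zero_mul]
    · rw [show k - l = 0 by omega, coeff_zero_seriesOf, mul_zero]
  · rw [Finset.mem_Ico] at hl
    rw [coeff_seriesOf f hl.1, coeff_seriesOf g (by omega)]

/-- Equality of series is checked on the positive coefficients if there are no constant terms. -/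
theorem ext_of_pos {f g : PowerSeries ℝ} (h0 : PowerSeries.coeff 0 f = PowerSeries.coeff 0 g)
    (h : ∀ k, 1 ≤ k → PowerSeries.coeff k f = PowerSeries.coeff k g) : f = g := by
  ext k
  rcases Nat.eq_zero_or_pos k with rfl | hk
  exacts [h0, h k hk]

/-- The generating series of the `j`-th coefficients of the means, at a real `ξ`. -/
noncomputable def meanGen (j : ℕ) (ξ : ℝ) : PowerSeries ℝ :=
  seriesOf fun k => (meanCoeff j k).eval ξ

/-- The generating series, in the first index, of the `j`-th coefficients of the covariances. -/
noncomputable def covGen (j m : ℕ) (ξ : ℝ) : PowerSeries ℝ :=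
  seriesOf fun k => (covCoeff j k m).eval ξ

/-- The source term of the loop equation for the covariances. Its constant term vanishes, and so
does the whole series for `m = 0`. -/
noncomputable def sourceGen (g : PowerSeries ℝ) (m : ℕ) : PowerSeries ℝ :=
  PowerSeries.mk fun k => 2 * m * (PowerSeries.coeff m g - PowerSeries.coeff (k + m) g)

theorem coeff_ofNat_mul (k : ℕ) (f : PowerSeries ℝ) :
    PowerSeries.coeff k (2 * f) = 2 * PowerSeries.coeff k f := by
  rw [← map_ofNat (PowerSeries.C (R := ℝ)) 2, PowerSeries.coeff_C_mul]

theorem coeff_zero_seriesOf_mul (f : ℕ → ℝ) (g : PowerSeries ℝ) :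
    PowerSeries.coeff 0 (seriesOf f * g) = 0 := by
  rw [coeff_zero_mul_eq, coeff_zero_seriesOf, zero_mul]

variable (ξ : ℝ)

theorem meanGen_zero_eq :
    (1 - PowerSeries.X) * (meanGen 0 ξ + meanGen 0 ξ * meanGen 0 ξ) =
      PowerSeries.C ξ * PowerSeries.X := by
  have h : meanGen 0 ξ + meanGen 0 ξ * meanGen 0 ξ = seriesOf fun _ => ξ := by
    refine ext_of_pos ?_ fun k hk => ?_
    · rw [meanGen, map_add, coeff_zero_seriesOf_mul, coeff_zero_seriesOf, coeff_zero_seriesOf,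
        add_zero]
    · rw [map_add, meanGen, coeff_seriesOf_mul, coeff_seriesOf _ hk, coeff_seriesOf _ hk]
      simpa [Polynomial.eval_finsetSum] using congrArg (Polynomial.eval ξ) (meanCoeff_zero_loop hk)
  rw [h]
  ext k
  rw [sub_mul, one_mul, map_sub, PowerSeries.coeff_C_mul, PowerSeries.coeff_X]
  rcases k with _ | _ | k
  · simp [seriesOf]
  · simp [seriesOf]
  · rw [PowerSeries.coeff_succ_X_mul, coeff_seriesOf _ (by omega), coeff_seriesOf _ (by omega)]
    simp

theorem meanGen_one_eq :
    meanGen 1 ξ + eulerOp (meanGen 0 ξ) + 2 * (meanGen 0 ξ * meanGen 1 ξ) = 0 := by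
  refine ext_of_pos ?_ fun k hk => ?_
  · rw [map_add, map_add, coeff_ofNat_mul, coeff_eulerOp, meanGen, meanGen, coeff_zero_seriesOf_mul,
      coeff_zero_seriesOf]
    simp
  · rw [two_mul, map_add, map_add, map_add, coeff_eulerOp, map_zero]
    nth_rewrite 3 [mul_comm]
    rw [meanGen, meanGen, coeff_seriesOf_mul, coeff_seriesOf_mul, coeff_seriesOf _ hk,
      coeff_seriesOf _ hk]
    simpa [Polynomial.eval_finsetSum, Finset.sum_add_distrib] using
      congrArg (Polynomial.eval ξ) (meanCoeff_one_loop hk)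

theorem covGen_zero_eq {m : ℕ} (hm : 1 ≤ m) :
    (1 + 2 * meanGen 0 ξ) * covGen 0 m ξ = sourceGen (meanGen 0 ξ) m := by
  rw [add_mul, one_mul, mul_assoc]
  refine ext_of_pos ?_ fun k hk => ?_
  · rw [map_add, coeff_ofNat_mul, covGen, meanGen, coeff_zero_seriesOf_mul, coeff_zero_seriesOf,
      sourceGen, PowerSeries.coeff_mk]
    simp
  · rw [map_add, coeff_ofNat_mul, sourceGen, PowerSeries.coeff_mk, meanGen, covGen,
      coeff_seriesOf_mul, coeff_seriesOf _ hk, coeff_seriesOf _ hm, coeff_seriesOf _ (by omega),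
      add_comm k m]
    simpa [Polynomial.eval_finsetSum] using congrArg (Polynomial.eval ξ) (covCoeff_zero_loop hk hm)

theorem covGen_one_eq {m : ℕ} (hm : 1 ≤ m) :
    (1 + 2 * meanGen 0 ξ) * covGen 1 m ξ + eulerOp (covGen 0 m ξ) +
      2 * (meanGen 1 ξ * covGen 0 m ξ) = sourceGen (meanGen 1 ξ) m := by
  rw [add_mul, one_mul, mul_assoc]
  refine ext_of_pos ?_ fun k hk => ?_
  · rw [map_add, map_add, map_add, coeff_ofNat_mul, coeff_ofNat_mul, coeff_eulerOp, covGen, covGen,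
      meanGen, meanGen, coeff_zero_seriesOf_mul, coeff_zero_seriesOf_mul, coeff_zero_seriesOf,
      coeff_zero_seriesOf, sourceGen, PowerSeries.coeff_mk]
    simp
  · rw [map_add, map_add, map_add, coeff_ofNat_mul, coeff_ofNat_mul, coeff_eulerOp, sourceGen,
      PowerSeries.coeff_mk, meanGen, meanGen, covGen, covGen, coeff_seriesOf_mul,
      coeff_seriesOf_mul, coeff_seriesOf _ hk, coeff_seriesOf _ hk, coeff_seriesOf _ hm,
      coeff_seriesOf _ (by omega), add_comm k m]
    have h := congrArg (Polynomial.eval ξ) (covCoeff_one_loop hk hm)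
    simp [Polynomial.eval_finsetSum, Finset.sum_add_distrib] at h
    linear_combination h

/-- The power series of `(1 - (1 - 4 ξ) X) ^ (-1 / 2)`. -/
noncomputable def xiSeries : PowerSeries ℝ := PowerSeries.rescale (1 - 4 * ξ) invSqrtSeries

theorem xiSeries_sq : xiSeries ξ ^ 2 * (1 - PowerSeries.C (1 - 4 * ξ) * PowerSeries.X) = 1 := by
  have h := congrArg (PowerSeries.rescale (1 - 4 * ξ)) invSqrtSeries_sq
  rwa [map_mul, map_pow, map_sub, map_one, PowerSeries.rescale_X] at h

/-- The quadratic equation for the resolvent series, with the branch fixed by the constant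
term. -/
theorem one_add_two_mul_meanGen_zero :
    1 + 2 * meanGen 0 ξ =
      (1 - PowerSeries.C (1 - 4 * ξ) * PowerSeries.X) * (invSqrtSeries * xiSeries ξ) := by
  set W := (1 - PowerSeries.C (1 - 4 * ξ) * PowerSeries.X) * (invSqrtSeries * xiSeries ξ) with hW
  have hB := invSqrtSeries_sq
  have hA := xiSeries_sq ξ
  have hM := meanGen_zero_eq ξ
  have hC : PowerSeries.C (1 - 4 * ξ) = 1 - 4 * PowerSeries.C ξ := by
    rw [map_sub, map_mul, map_one, map_ofNat]
  have hsq : (1 + 2 * meanGen 0 ξ) ^ 2 * (1 - PowerSeries.X) = W ^ 2 * (1 - PowerSeries.X) := by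
    rw [hW]
    rw [hC] at hA ⊢
    set Q := 1 - (1 - 4 * PowerSeries.C ξ) * PowerSeries.X with hQ
    linear_combination 4 * hM - Q ^ 2 * xiSeries ξ ^ 2 * hB - Q * hA + hQ
  have hX : (1 - PowerSeries.X : PowerSeries ℝ) ≠ 0 := right_ne_zero_of_mul_eq_one hB
  have hprod : (1 + 2 * meanGen 0 ξ - W) * (1 + 2 * meanGen 0 ξ + W) = 0 := by
    linear_combination mul_right_cancel₀ hX hsq
  refine sub_eq_zero.1 ((mul_eq_zero.1 hprod).resolve_right fun h => ?_)
  have h0 := congrArg (PowerSeries.coeff 0) h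
  rw [hW, map_add, map_add, coeff_ofNat_mul, meanGen, coeff_zero_seriesOf, coeff_zero_mul_eq,
    coeff_zero_mul_eq, xiSeries, PowerSeries.coeff_rescale, coeff_zero_invSqrtSeries] at h0
  norm_num at h0

theorem invSqrtSeries_ne_zero : invSqrtSeries ≠ 0 := by
  intro h
  have := coeff_invSqrtSeries_pos 0
  simp [h] at this

/-- The derivative of the resolvent series, from the derivative of its quadratic equation. -/
theorem eulerOp_meanGen_zero :
    eulerOp (meanGen 0 ξ) =
      PowerSeries.C ξ * PowerSeries.X * (invSqrtSeries ^ 3 * xiSeries ξ) := by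
  have hB := invSqrtSeries_sq
  have hA := xiSeries_sq ξ
  have hM := meanGen_zero_eq ξ
  have hY := one_add_two_mul_meanGen_zero ξ
  have hd := congrArg eulerOp hM
  rw [eulerOp_mul, eulerOp_mul, eulerOp_add, eulerOp_mul, eulerOp_sub, eulerOp_one, eulerOp_X,
    eulerOp_C] at hd
  set Q := 1 - PowerSeries.C (1 - 4 * ξ) * PowerSeries.X with hQ
  set B := invSqrtSeries
  set A := xiSeries ξ
  set M := meanGen 0 ξ
  have h1 : (1 - PowerSeries.X) ^ 2 * (1 + 2 * M) * eulerOp M =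
      PowerSeries.C ξ * PowerSeries.X := by
    linear_combination (1 - PowerSeries.X) * hd + PowerSeries.X * hM
  rw [hY] at h1
  have h2 : eulerOp M = (1 - PowerSeries.X) ^ 2 * (Q * (B * A)) * eulerOp M * (B ^ 3 * A) := by
    linear_combination (-1 : PowerSeries ℝ) * eulerOp M *
      ((B ^ 2 * (1 - PowerSeries.X) + 1) * (A ^ 2 * Q) * hB + hA)
  rw [h2, h1]

/-- The subleading means are rational: the square roots cancel. -/
theorem meanGen_one :
    meanGen 1 ξ = -(PowerSeries.C ξ * PowerSeries.X * (invSqrtSeries ^ 2 * xiSeries ξ ^ 2)) := by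
  have hB := invSqrtSeries_sq
  have hA := xiSeries_sq ξ
  have hY := one_add_two_mul_meanGen_zero ξ
  have h1 := meanGen_one_eq ξ
  rw [eulerOp_meanGen_zero] at h1
  set Q := 1 - PowerSeries.C (1 - 4 * ξ) * PowerSeries.X with hQ
  have h2 : Q * (invSqrtSeries * xiSeries ξ) * meanGen 1 ξ =
      -(PowerSeries.C ξ * PowerSeries.X * (invSqrtSeries ^ 3 * xiSeries ξ)) := by
    rw [← hY]
    linear_combination h1
  have h3 : invSqrtSeries * meanGen 1 ξ =
      invSqrtSeries *
        -(PowerSeries.C ξ * PowerSeries.X * (invSqrtSeries ^ 2 * xiSeries ξ ^ 2)) := by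
    linear_combination xiSeries ξ * h2 - invSqrtSeries * meanGen 1 ξ * hA
  exact mul_left_cancel₀ invSqrtSeries_ne_zero h3

/-- The subleading covariances, solved in terms of the source terms: the operator on the left hand
side of the loop equations is multiplication by an explicit invertible series. -/
theorem covGen_one {m : ℕ} (hm : 1 ≤ m) :
    covGen 1 m ξ =
      PowerSeries.C (4 * ξ) * PowerSeries.X * xiSeries ξ ^ 4 * sourceGen (meanGen 0 ξ) m -
      (1 - PowerSeries.X) * xiSeries ξ ^ 2 * eulerOp (sourceGen (meanGen 0 ξ) m) +
      (1 - PowerSeries.X) * (invSqrtSeries * xiSeries ξ) * sourceGen (meanGen 1 ξ) m := by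
  have hB := invSqrtSeries_sq
  have hA := xiSeries_sq ξ
  have hY := one_add_two_mul_meanGen_zero ξ
  have h0 := covGen_zero_eq ξ hm
  have h1 := covGen_one_eq ξ hm
  have hd := congrArg eulerOp h0
  have hE := meanGen_one_eq ξ
  have hM := meanGen_one ξ
  have hC : PowerSeries.C (4 * ξ) = 4 * PowerSeries.C ξ := by
    rw [map_mul, map_ofNat]
  rw [eulerOp_mul, eulerOp_add, eulerOp_one, two_mul, eulerOp_add] at hd
  rw [hC]
  set Q := 1 - PowerSeries.C (1 - 4 * ξ) * PowerSeries.X with hQ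
  set R0 := sourceGen (meanGen 0 ξ) m
  set R1 := sourceGen (meanGen 1 ξ) m
  set B := invSqrtSeries
  set A := xiSeries ξ
  set M := meanGen 0 ξ
  set M1 := meanGen 1 ξ
  set C0 := covGen 0 m ξ
  set C1 := covGen 1 m ξ
  set T := PowerSeries.X (R := ℝ)
  have h2 : (1 + 2 * M) ^ 2 * C1 = (1 + 2 * M) * R1 - eulerOp R0 - 4 * M1 * R0 := by
    linear_combination (1 + 2 * M) * h1 - hd - 4 * M1 * h0 + 2 * C0 * hE
  rw [hY, hM] at h2
  have h3 : (Q * (B * A)) ^ 2 * ((1 - T) * A ^ 2) = 1 := by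
    linear_combination A ^ 4 * Q ^ 2 * hB + (A ^ 2 * Q + 1) * hA
  linear_combination (1 - T) * A ^ 2 * h2 - C1 * h3 + (1 - T) * A * B * R1 * hA +
    4 * PowerSeries.C ξ * T * A ^ 4 * R0 * hB

end FormalSolution

/-! ### Double series -/

section DoubleSeries

open Finset.HasAntidiagonal (antidiagonal)

variable {s u : ℝ}

/-- A summable double family may be summed along the antidiagonals. -/
theorem hasSum_of_antidiagonal {F : ℕ × ℕ → ℝ} (hF : Summable F) {a : ℝ}
    (h : HasSum (fun n => ∑ p ∈ antidiagonal n, F p) a) : HasSum F a := by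
  obtain ⟨b, hb⟩ := hF
  have h1 := (Finset.HasAntidiagonal.sigmaAntidiagonalEquivProd (A := ℕ)).hasSum_iff.2 hb
  have h2 := h1.sigma fun n => (antidiagonal n).hasSum F
  rwa [h.unique h2]

theorem summable_of_abs_le {c : ℕ × ℕ → ℝ} (hs : |s| < 1) (hu : |u| < 1)
    (h : ∃ (C : ℝ) (L : ℕ), ∀ p, |c p| ≤ C * (((p.1 : ℝ) + 1) ^ L * ((p.2 : ℝ) + 1) ^ L)) :
    Summable fun p : ℕ × ℕ => c p * (s ^ p.1 * u ^ p.2) := by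
  obtain ⟨C, L, h⟩ := h
  have hg : HasPolyGrowth (PowerSeries.mk fun n => ((n : ℝ) + 1) ^ L) :=
    ⟨1, L, fun n => by rw [PowerSeries.coeff_mk, one_mul, abs_of_nonneg (by positivity)]⟩
  have hsum := ((hg.summable_norm hs).mul_of_nonneg (hg.summable_norm hu)
    (fun _ => norm_nonneg _) (fun _ => norm_nonneg _)).mul_left C
  refine Summable.of_norm_bounded hsum fun p => ?_
  simp only [PowerSeries.coeff_mk, norm_mul, norm_pow, Real.norm_eq_abs]
  rw [abs_of_nonneg (by positivity : (0 : ℝ) ≤ (p.1 : ℝ) + 1),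
    abs_of_nonneg (by positivity : (0 : ℝ) ≤ (p.2 : ℝ) + 1)]
  calc |c p| * (|s| ^ p.1 * |u| ^ p.2)
      ≤ C * (((p.1 : ℝ) + 1) ^ L * ((p.2 : ℝ) + 1) ^ L) * (|s| ^ p.1 * |u| ^ p.2) :=
        mul_le_mul_of_nonneg_right (h p) (by positivity)
    _ = _ := by ring

/-- Multiplying the rows of a double series by a fixed power series in the first variable. -/
theorem hasSum_mul_rows {f : PowerSeries ℝ} (hf : HasPolyGrowth f) (hs : |s| < 1)
    {R : ℕ → PowerSeries ℝ} {a : ℝ}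
    (hR : HasSum (fun p : ℕ × ℕ => PowerSeries.coeff p.1 (R p.2) * (s ^ p.1 * u ^ p.2)) a) :
    HasSum (fun p : ℕ × ℕ => PowerSeries.coeff p.1 (f * R p.2) * (s ^ p.1 * u ^ p.2))
      (evalSeries f s * a) := by
  have h1 := (hf.hasSum hs).mul hR (summable_mul_of_summable_norm (hf.summable_norm hs)
    hR.summable.norm)
  let e : (Σ p : ℕ × ℕ, antidiagonal p.1) ≃ ℕ × ℕ × ℕ :=
    { toFun := fun x => (x.2.1.1, x.2.1.2, x.1.2)
      invFun := fun y => ⟨(y.1 + y.2.1, y.2.2), ⟨(y.1, y.2.1), by simp⟩⟩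
      left_inv := by
        rintro ⟨⟨k, m⟩, ⟨i, j⟩, h⟩
        obtain rfl : i + j = k := Finset.HasAntidiagonal.mem_antidiagonal.1 h
        rfl
      right_inv := fun _ => rfl }
  have h2 := (e.hasSum_iff.2 h1).sigma fun p => hasSum_fintype _
  refine h2.congr_fun fun p => ?_
  rw [PowerSeries.coeff_mul, Finset.sum_mul, ← Finset.sum_coe_sort]
  refine Finset.sum_congr rfl fun x _ => ?_
  have hx := Finset.HasAntidiagonal.mem_antidiagonal.1 x.2
  have hp : s ^ p.1 = s ^ x.1.1 * s ^ x.1.2 := by rw [← pow_add, hx]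
  simp only [Function.comp_apply, e, Equiv.coe_fn_mk]
  rw [hp]
  ring

/-- The antidiagonal sums of `m * s ^ k * u ^ m`. -/
theorem sum_antidiagonal_snd (n : ℕ) :
    (s - u) ^ 2 * ∑ p ∈ antidiagonal n, (p.2 : ℝ) * (s ^ p.1 * u ^ p.2) =
      s * u * s ^ n - s * u * u ^ n - u * (s - u) * (n * u ^ n) := by
  induction n with
  | zero => simp
  | succ n ih =>
    rw [Finset.Nat.sum_antidiagonal_succ]
    have h : ∑ p ∈ antidiagonal n, (p.2 : ℝ) * (s ^ (p.1 + 1) * u ^ p.2) =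
        s * ∑ p ∈ antidiagonal n, (p.2 : ℝ) * (s ^ p.1 * u ^ p.2) := by
      rw [Finset.mul_sum]
      exact Finset.sum_congr rfl fun p _ => by ring
    rw [h]
    push_cast
    linear_combination s * ih

/-- The antidiagonal sums of `k * m * s ^ k * u ^ m`. -/
theorem sum_antidiagonal_fst_mul_snd (n : ℕ) :
    (s - u) ^ 3 * ∑ p ∈ antidiagonal n, (p.1 : ℝ) * p.2 * (s ^ p.1 * u ^ p.2) =
      (s - u) * (s * u) * (s ^ n + n * s ^ n - u ^ n - n * u ^ n) -
        2 * s * (s * u * s ^ n - s * u * u ^ n - u * (s - u) * (n * u ^ n)) := by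
  induction n with
  | zero => simp
  | succ n ih =>
    rw [Finset.Nat.sum_antidiagonal_succ]
    have h : ∑ p ∈ antidiagonal n, ((p.1 + 1 : ℕ) : ℝ) * p.2 * (s ^ (p.1 + 1) * u ^ p.2) =
        s * ∑ p ∈ antidiagonal n, (p.1 : ℝ) * p.2 * (s ^ p.1 * u ^ p.2) +
        s * ∑ p ∈ antidiagonal n, (p.2 : ℝ) * (s ^ p.1 * u ^ p.2) := by
      rw [Finset.mul_sum, Finset.mul_sum, ← Finset.sum_add_distrib]
      exact Finset.sum_congr rfl fun p _ => by push_cast; ring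
    rw [h]
    push_cast
    linear_combination s * ih + s * (s - u) * sum_antidiagonal_snd (s := s) (u := u) n

/-- Polynomial growth in `k + m` is controlled by a product, since `k + m + 1 ≤ (k + 1) (m + 1)`. -/
theorem exists_abs_coeff_add_le {g : PowerSeries ℝ} (hg : HasPolyGrowth g) :
    ∃ (C : ℝ) (L : ℕ), ∀ p : ℕ × ℕ, |(p.1 + 1 : ℝ) * (p.2 + 1) * PowerSeries.coeff (p.1 + p.2) g| ≤
      C * (((p.1 : ℝ) + 1) ^ L * ((p.2 : ℝ) + 1) ^ L) := by
  obtain ⟨C, L, h⟩ := hg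
  have hC : 0 ≤ C := by simpa using (abs_nonneg _).trans (h 0)
  refine ⟨C, L + 1, fun p => ?_⟩
  rw [abs_mul, abs_of_nonneg (by positivity)]
  have h1 : (((p.1 + p.2 : ℕ) : ℝ) + 1) ≤ ((p.1 : ℝ) + 1) * ((p.2 : ℝ) + 1) := by
    push_cast
    nlinarith [mul_nonneg (p.1.cast_nonneg (α := ℝ)) (p.2.cast_nonneg (α := ℝ))]
  calc ((p.1 : ℝ) + 1) * (p.2 + 1) * |PowerSeries.coeff (p.1 + p.2) g|
      ≤ ((p.1 : ℝ) + 1) * (p.2 + 1) * (C * (((p.1 : ℝ) + 1) * ((p.2 : ℝ) + 1)) ^ L) := by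
        refine mul_le_mul_of_nonneg_left ((h _).trans ?_) (by positivity)
        gcongr
    _ = _ := by rw [mul_pow]; ring

/-- The sum of `m * g (k + m) * s ^ k * u ^ m`. -/
theorem hasSum_snd_mul_coeff_add {g : PowerSeries ℝ} (hg : HasPolyGrowth g) (hs : |s| < 1)
    (hu : |u| < 1) (hne : s ≠ u) :
    HasSum (fun p : ℕ × ℕ => p.2 * PowerSeries.coeff (p.1 + p.2) g * (s ^ p.1 * u ^ p.2))
      ((s * u * evalSeries g s - s * u * evalSeries g u -
        u * (s - u) * evalSeries (eulerOp g) u) / (s - u) ^ 2) := by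
  have hsu : s - u ≠ 0 := sub_ne_zero.2 hne
  refine hasSum_of_antidiagonal (summable_of_abs_le hs hu ?_) ?_
  · obtain ⟨C, L, h⟩ := exists_abs_coeff_add_le hg
    refine ⟨C, L, fun p => le_trans ?_ (h p)⟩
    rw [abs_mul, abs_mul, Nat.abs_cast,
      abs_of_nonneg (by positivity : (0 : ℝ) ≤ (p.1 + 1) * (p.2 + 1))]
    have : (0 : ℝ) ≤ (p.1 : ℝ) * p.2 := by positivity
    gcongr
    nlinarith [p.1.cast_nonneg (α := ℝ)]
  · have h := ((((hg.hasSum hs).mul_left (s * u)).sub ((hg.hasSum hu).mul_left (s * u))).sub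
      ((hg.eulerOp.hasSum hu).mul_left (u * (s - u)))).div_const ((s - u) ^ 2)
    refine h.congr_fun fun n => ?_
    have hn : ∑ p ∈ antidiagonal n,
        (p.2 : ℝ) * PowerSeries.coeff (p.1 + p.2) g * (s ^ p.1 * u ^ p.2) =
        PowerSeries.coeff n g * ∑ p ∈ antidiagonal n, (p.2 : ℝ) * (s ^ p.1 * u ^ p.2) := by
      rw [Finset.mul_sum]
      refine Finset.sum_congr rfl fun p hp => ?_
      rw [Finset.HasAntidiagonal.mem_antidiagonal.1 hp]
      ring
    rw [hn, coeff_eulerOp, eq_div_iff (pow_ne_zero 2 hsu)]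
    linear_combination PowerSeries.coeff n g * sum_antidiagonal_snd (s := s) (u := u) n

/-- The sum of `k * m * g (k + m) * s ^ k * u ^ m`. -/
theorem hasSum_fst_mul_snd_mul_coeff_add {g : PowerSeries ℝ} (hg : HasPolyGrowth g) (hs : |s| < 1)
    (hu : |u| < 1) (hne : s ≠ u) :
    HasSum (fun p : ℕ × ℕ =>
        p.1 * p.2 * PowerSeries.coeff (p.1 + p.2) g * (s ^ p.1 * u ^ p.2))
      (((s - u) * (s * u) * (evalSeries g s + evalSeries (eulerOp g) s - evalSeries g u -
          evalSeries (eulerOp g) u) -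
        2 * s * (s * u * evalSeries g s - s * u * evalSeries g u -
        u * (s - u) * evalSeries (eulerOp g) u)) / (s - u) ^ 3) := by
  have hsu : s - u ≠ 0 := sub_ne_zero.2 hne
  refine hasSum_of_antidiagonal (summable_of_abs_le hs hu ?_) ?_
  · obtain ⟨C, L, h⟩ := exists_abs_coeff_add_le hg
    refine ⟨C, L, fun p => le_trans ?_ (h p)⟩
    rw [abs_mul, abs_mul ((_ + 1) * _), abs_of_nonneg (by positivity : (0 : ℝ) ≤ p.1 * p.2),
      abs_of_nonneg (by positivity : (0 : ℝ) ≤ (p.1 + 1) * (p.2 + 1))]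
    gcongr <;> linarith
  · have h := (((((hg.hasSum hs).add (hg.eulerOp.hasSum hs)).sub (hg.hasSum hu)).sub
      (hg.eulerOp.hasSum hu)).mul_left ((s - u) * (s * u))).sub
      (((((hg.hasSum hs).mul_left (s * u)).sub ((hg.hasSum hu).mul_left (s * u))).sub
      ((hg.eulerOp.hasSum hu).mul_left (u * (s - u)))).mul_left (2 * s)) |>.div_const ((s - u) ^ 3)
    refine h.congr_fun fun n => ?_
    have hn : ∑ p ∈ antidiagonal n,
        (p.1 : ℝ) * p.2 * PowerSeries.coeff (p.1 + p.2) g * (s ^ p.1 * u ^ p.2) =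
        PowerSeries.coeff n g * ∑ p ∈ antidiagonal n, (p.1 : ℝ) * p.2 * (s ^ p.1 * u ^ p.2) := by
      rw [Finset.mul_sum]
      refine Finset.sum_congr rfl fun p hp => ?_
      rw [Finset.HasAntidiagonal.mem_antidiagonal.1 hp]
      ring
    rw [hn, coeff_eulerOp, eq_div_iff (pow_ne_zero 3 hsu)]
    linear_combination PowerSeries.coeff n g * sum_antidiagonal_fst_mul_snd (s := s) (u := u) n

end DoubleSeries

/-! ### The sum of the second term -/

section SecondTerm

variable {s u ξ : ℝ}

theorem hasSum_sourceGen {g : PowerSeries ℝ} (hg : HasPolyGrowth g) (hs : |s| < 1)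
    (hu : |u| < 1) (hne : s ≠ u) :
    HasSum (fun p : ℕ × ℕ => PowerSeries.coeff p.1 (sourceGen g p.2) * (s ^ p.1 * u ^ p.2))
      (2 * ((1 - s)⁻¹ * evalSeries (eulerOp g) u -
        (s * u * evalSeries g s - s * u * evalSeries g u -
        u * (s - u) * evalSeries (eulerOp g) u) / (s - u) ^ 2)) := by
  have h1 := hasSum_geometric_of_norm_lt_one (K := ℝ) (ξ := s) hs
  have h2 := hg.eulerOp.hasSum hu
  have h := ((h1.mul h2 (summable_mul_of_summable_norm h1.summable.norm
    h2.summable.norm)).sub (hasSum_snd_mul_coeff_add hg hs hu hne)).mul_left 2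
  refine h.congr_fun fun p => ?_
  rw [sourceGen, PowerSeries.coeff_mk, coeff_eulerOp]
  ring

theorem hasSum_eulerOp_sourceGen {g : PowerSeries ℝ} (hg : HasPolyGrowth g) (hs : |s| < 1)
    (hu : |u| < 1) (hne : s ≠ u) :
    HasSum (fun p : ℕ × ℕ =>
        PowerSeries.coeff p.1 (eulerOp (sourceGen g p.2)) * (s ^ p.1 * u ^ p.2))
      (2 * (s / (1 - s) ^ 2 * evalSeries (eulerOp g) u -
        ((s - u) * (s * u) * (evalSeries g s + evalSeries (eulerOp g) s - evalSeries g u -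
          evalSeries (eulerOp g) u) -
        2 * s * (s * u * evalSeries g s - s * u * evalSeries g u -
        u * (s - u) * evalSeries (eulerOp g) u)) / (s - u) ^ 3)) := by
  have h1 := hasSum_coe_mul_geometric_of_norm_lt_one (𝕜 := ℝ) (r := s) hs
  have h2 := hg.eulerOp.hasSum hu
  have h := ((h1.mul h2 (summable_mul_of_summable_norm h1.summable.norm
    h2.summable.norm)).sub (hasSum_fst_mul_snd_mul_coeff_add hg hs hu hne)).mul_left 2
  refine h.congr_fun fun p => ?_
  rw [coeff_eulerOp, sourceGen, PowerSeries.coeff_mk, coeff_eulerOp]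
  ring

theorem hasPolyGrowth_xiSeries (h0 : 0 < ξ) (h1 : ξ ≤ 1 / 4) : HasPolyGrowth (xiSeries ξ) :=
  hasPolyGrowth_rescale hasPolyGrowth_invSqrtSeries (abs_le.2 ⟨by linarith, by linarith⟩)

theorem meanGen_zero_eq_half_mul (ξ : ℝ) :
    meanGen 0 ξ = PowerSeries.C (1 / 2) *
      ((1 - PowerSeries.C (1 - 4 * ξ) * PowerSeries.X) * (invSqrtSeries * xiSeries ξ) - 1) := by
  have h2 : PowerSeries.C (1 / 2 : ℝ) * 2 = 1 := by
    rw [← map_ofNat (PowerSeries.C (R := ℝ)) 2, ← map_mul]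
    norm_num
  rw [← one_add_two_mul_meanGen_zero]
  linear_combination -meanGen 0 ξ * h2

theorem hasPolyGrowth_meanGen_zero (h0 : 0 < ξ) (h1 : ξ ≤ 1 / 4) :
    HasPolyGrowth (meanGen 0 ξ) := by
  rw [meanGen_zero_eq_half_mul]
  exact (HasPolyGrowth.C _).mul (((HasPolyGrowth.one.sub ((HasPolyGrowth.C _).mul .X)).mul
    (hasPolyGrowth_invSqrtSeries.mul (hasPolyGrowth_xiSeries h0 h1))).sub .one)

theorem hasPolyGrowth_meanGen_one (h0 : 0 < ξ) (h1 : ξ ≤ 1 / 4) :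
    HasPolyGrowth (meanGen 1 ξ) := by
  have hB := hasPolyGrowth_invSqrtSeries
  have hA := hasPolyGrowth_xiSeries h0 h1
  rw [meanGen_one, pow_two, pow_two]
  exact (((HasPolyGrowth.C _).mul .X).mul ((hB.mul hB).mul (hA.mul hA))).neg

/-- The value of `(1 - X) ^ (-1 / 2) * (1 - (1 - 4 ξ) X) ^ (-1 / 2)`. -/
noncomputable def radical (ξ s : ℝ) : ℝ := 1 / (√(1 - s) * √(1 - s + 4 * ξ * s))

theorem evalSeries_xiSeries (h0 : 0 < ξ) (h1 : ξ ≤ 1 / 4) (hs : |s| < 1) :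
    evalSeries (xiSeries ξ) s = 1 / √(1 - s + 4 * ξ * s) := by
  have h : |(1 - 4 * ξ) * s| < 1 := by
    rw [abs_mul]
    exact (mul_le_of_le_one_left (abs_nonneg s) (abs_le.2 ⟨by linarith, by linarith⟩)).trans_lt hs
  rw [xiSeries, evalSeries_rescale, evalSeries_invSqrtSeries h]
  congr 2
  ring

theorem one_sub_pos (hs : |s| < 1) : 0 < 1 - s := by linarith [(abs_lt.1 hs).2]

theorem one_sub_add_pos (h0 : 0 < ξ) (h1 : ξ ≤ 1 / 4) (hs : |s| < 1) :
    0 < 1 - s + 4 * ξ * s := by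
  have := abs_lt.1 hs
  nlinarith

/-- The two square roots combined, and their squares. -/
theorem evalSeries_values (h0 : 0 < ξ) (h1 : ξ ≤ 1 / 4) (hs : |s| < 1) :
    evalSeries invSqrtSeries s * evalSeries (xiSeries ξ) s = radical ξ s ∧
      evalSeries invSqrtSeries s ^ 2 = (1 - s)⁻¹ ∧
      evalSeries (xiSeries ξ) s ^ 2 = (1 - s + 4 * ξ * s)⁻¹ := by
  rw [evalSeries_xiSeries h0 h1 hs, evalSeries_invSqrtSeries hs, div_pow, div_pow,
    Real.sq_sqrt (one_sub_pos hs).le, Real.sq_sqrt (one_sub_add_pos h0 h1 hs).le, radical]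
  refine ⟨by rw [div_mul_div_comm, one_mul], by simp, by simp⟩

theorem evalSeries_one_sub_C_mul_X (a : ℝ) (hs : |s| < 1) :
    evalSeries (1 - PowerSeries.C a * PowerSeries.X) s = 1 - a * s := by
  rw [evalSeries_sub .one ((HasPolyGrowth.C _).mul .X) hs, evalSeries_mul (.C _) .X hs,
    evalSeries_one, evalSeries_C, evalSeries_X]

theorem evalSeries_one_sub_X (hs : |s| < 1) : evalSeries (1 - PowerSeries.X) s = 1 - s := by
  rw [evalSeries_sub .one .X hs, evalSeries_one, evalSeries_X]

theorem evalSeries_meanGen_zero (h0 : 0 < ξ) (h1 : ξ ≤ 1 / 4) (hs : |s| < 1) :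
    evalSeries (meanGen 0 ξ) s = ((1 - s + 4 * ξ * s) * radical ξ s - 1) / 2 := by
  have hB := hasPolyGrowth_invSqrtSeries
  have hA := hasPolyGrowth_xiSeries h0 h1
  have hQ : HasPolyGrowth (1 - PowerSeries.C (1 - 4 * ξ) * PowerSeries.X) :=
    HasPolyGrowth.one.sub ((HasPolyGrowth.C _).mul .X)
  rw [meanGen_zero_eq_half_mul, evalSeries_mul (.C _) ((hQ.mul (hB.mul hA)).sub .one) hs,
    evalSeries_sub (hQ.mul (hB.mul hA)) .one hs, evalSeries_mul hQ (hB.mul hA) hs,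
    evalSeries_mul hB hA hs, (evalSeries_values h0 h1 hs).1, evalSeries_one_sub_C_mul_X _ hs,
    evalSeries_one, evalSeries_C]
  ring

theorem evalSeries_eulerOp_meanGen_zero (h0 : 0 < ξ) (h1 : ξ ≤ 1 / 4) (hs : |s| < 1) :
    evalSeries (eulerOp (meanGen 0 ξ)) s = ξ * s * radical ξ s / (1 - s) := by
  have hB := hasPolyGrowth_invSqrtSeries
  have hA := hasPolyGrowth_xiSeries h0 h1
  have hX : HasPolyGrowth (PowerSeries.C ξ * PowerSeries.X) := (HasPolyGrowth.C _).mul .X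
  have h : eulerOp (meanGen 0 ξ) = PowerSeries.C ξ * PowerSeries.X *
      (invSqrtSeries * invSqrtSeries * (invSqrtSeries * xiSeries ξ)) := by
    rw [eulerOp_meanGen_zero]
    ring
  obtain ⟨hv1, hv2, -⟩ := evalSeries_values h0 h1 hs
  rw [h, evalSeries_mul hX ((hB.mul hB).mul (hB.mul hA)) hs, evalSeries_mul (.C _) .X hs,
    evalSeries_mul (hB.mul hB) (hB.mul hA) hs, evalSeries_mul hB hB hs, evalSeries_mul hB hA hs,
    hv1, ← pow_two, hv2, evalSeries_C, evalSeries_X]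
  ring

theorem evalSeries_meanGen_one (h0 : 0 < ξ) (h1 : ξ ≤ 1 / 4) (hs : |s| < 1) :
    evalSeries (meanGen 1 ξ) s = -(ξ * s) / ((1 - s) * (1 - s + 4 * ξ * s)) := by
  have hB := hasPolyGrowth_invSqrtSeries
  have hA := hasPolyGrowth_xiSeries h0 h1
  have hX : HasPolyGrowth (PowerSeries.C ξ * PowerSeries.X) := (HasPolyGrowth.C _).mul .X
  obtain ⟨-, hv2, hv3⟩ := evalSeries_values h0 h1 hs
  rw [meanGen_one, pow_two, pow_two, evalSeries_neg (hX.mul ((hB.mul hB).mul (hA.mul hA))) hs,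
    evalSeries_mul hX ((hB.mul hB).mul (hA.mul hA)) hs, evalSeries_mul (.C _) .X hs,
    evalSeries_mul (hB.mul hB) (hA.mul hA) hs, evalSeries_mul hB hB hs, evalSeries_mul hA hA hs,
    ← pow_two, ← pow_two, hv2, hv3, evalSeries_C, evalSeries_X, ← mul_inv, div_eq_mul_inv, neg_mul]

/-- Apply the Euler operator to the equation `(1 - X) (1 - (1 - 4 ξ) X) M = -ξ X`. -/
theorem evalSeries_eulerOp_meanGen_one (h0 : 0 < ξ) (h1 : ξ ≤ 1 / 4) (hs : |s| < 1) :
    evalSeries (eulerOp (meanGen 1 ξ)) s =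
      -(ξ * s) * (1 - (1 - 4 * ξ) * s ^ 2) / ((1 - s) * (1 - s + 4 * ξ * s)) ^ 2 := by
  have hP := hasPolyGrowth_meanGen_one h0 h1
  set L : PowerSeries ℝ := 1 - PowerSeries.X with hL
  set Q : PowerSeries ℝ := 1 - PowerSeries.C (1 - 4 * ξ) * PowerSeries.X with hQ
  have hLg : HasPolyGrowth L := HasPolyGrowth.one.sub .X
  have hQg : HasPolyGrowth Q := HasPolyGrowth.one.sub ((HasPolyGrowth.C _).mul .X)
  have hZg : HasPolyGrowth (PowerSeries.C (2 - 4 * ξ) - PowerSeries.C (2 * (1 - 4 * ξ)) *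
      PowerSeries.X) := (HasPolyGrowth.C _).sub ((HasPolyGrowth.C _).mul .X)
  have heq : L * Q * meanGen 1 ξ = -(PowerSeries.C ξ * PowerSeries.X) := by
    rw [meanGen_one]
    linear_combination -(PowerSeries.C ξ * PowerSeries.X) *
      (xiSeries ξ ^ 2 * Q * invSqrtSeries_sq + xiSeries_sq ξ)
  have hd := congrArg eulerOp heq
  rw [eulerOp_mul, eulerOp_mul, hL, hQ, eulerOp_sub, eulerOp_sub, eulerOp_one, eulerOp_mul,
    eulerOp_C, eulerOp_X, ← neg_mul, ← map_neg, eulerOp_mul, eulerOp_C, eulerOp_X, ← hL, ← hQ] at hd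
  have hd2 : L * Q * eulerOp (meanGen 1 ξ) = PowerSeries.X *
      (PowerSeries.C (2 - 4 * ξ) - PowerSeries.C (2 * (1 - 4 * ξ)) * PowerSeries.X) * meanGen 1 ξ -
      PowerSeries.C ξ * PowerSeries.X := by
    rw [hL, hQ] at hd ⊢
    simp only [map_sub, map_mul, map_neg, map_one, map_ofNat] at hd ⊢
    linear_combination hd
  have hv := congrArg (evalSeries · s) hd2
  beta_reduce at hv
  rw [evalSeries_mul (hLg.mul hQg) hP.eulerOp hs, evalSeries_mul hLg hQg hs,
    evalSeries_one_sub_X hs, evalSeries_one_sub_C_mul_X _ hs,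
    evalSeries_sub ((HasPolyGrowth.X.mul hZg).mul hP) ((HasPolyGrowth.C _).mul .X) hs,
    evalSeries_mul (HasPolyGrowth.X.mul hZg) hP hs, evalSeries_mul .X hZg hs,
    evalSeries_sub (.C _) ((HasPolyGrowth.C _).mul .X) hs, evalSeries_mul (.C _) .X hs,
    evalSeries_mul (.C _) .X hs, evalSeries_C, evalSeries_C, evalSeries_C, evalSeries_X,
    evalSeries_meanGen_one h0 h1 hs] at hv
  have e1 := (one_sub_pos hs).ne'
  have e2 := (one_sub_add_pos h0 h1 hs).ne'
  rw [show 1 - (1 - 4 * ξ) * s = 1 - s + 4 * ξ * s by ring] at hv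
  set D := 1 - s + 4 * ξ * s with hD
  field_simp at hv ⊢
  linear_combination hv - ξ * s * (1 - s) * hD

section Identities

variable {D E w : ℝ}

/-- The contribution of the square roots in the first variable to the second term. Here
`D = 1 - s + 4 ξ s`, `E = 1 - u + 4 ξ u` and `w = s - u`. -/
theorem secondTerm_identity_fst (hD : D = 1 - s + 4 * ξ * s) (hE : E = 1 - u + 4 * ξ * u)
    (hw : w = s - u) (hs : 1 - s ≠ 0) (hu : 1 - u ≠ 0) (hD0 : D ≠ 0) (hE0 : E ≠ 0) (hw0 : w ≠ 0) :
    ((u + s) * (1 - s) * (1 - u) ^ 2 + 8 * u ^ 2 * ξ * (s ^ 2 + u * s + 1)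
      - 2 * ξ * (9 * u ^ 2 * s + 4 * u * s ^ 2 - 3 * u * s + 3 * u ^ 3 - s ^ 2)
      + 8 * u ^ 2 * ξ ^ 2 * (u + 3 * s - 2 * u * s - 2 * s ^ 2))
      * (u * s / ((-w) ^ 3 * E ^ 2)) =
    4 * ξ * s / D ^ 2 * (2 * (-(s * u * (D / 2)) / w ^ 2)) -
    (1 - s) / D * (2 * (-(w * (s * u) * (D / 2 + ξ * s / (1 - s)) -
      2 * s * (s * u * (D / 2))) / w ^ 3)) +
    (1 - s) * (2 * ((1 - s)⁻¹ * (-(ξ * u) * (1 - (1 - 4 * ξ) * u ^ 2) / ((1 - u) * E) ^ 2) -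
      (s * u * (-(ξ * s) / ((1 - s) * D)) - s * u * (-(ξ * u) / ((1 - u) * E)) -
      u * w * (-(ξ * u) * (1 - (1 - 4 * ξ) * u ^ 2) / ((1 - u) * E) ^ 2)) / w ^ 2)) := by
  field_simp
  subst hD hE hw
  ring

/-- The contribution of the square roots in the second variable to the second term. -/
theorem secondTerm_identity_snd (hD : D = 1 - s + 4 * ξ * s) (hE : E = 1 - u + 4 * ξ * u)
    (hw : w = s - u) (hs : 1 - s ≠ 0) (hu : 1 - u ≠ 0) (hD0 : D ≠ 0) (hw0 : w ≠ 0) :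
    ((s + u) * (1 - u) * (1 - s) ^ 2 + 8 * s ^ 2 * ξ * (u ^ 2 + s * u + 1)
      - 2 * ξ * (9 * s ^ 2 * u + 4 * s * u ^ 2 - 3 * s * u + 3 * s ^ 3 - u ^ 2)
      + 8 * s ^ 2 * ξ ^ 2 * (s + 3 * u - 2 * s * u - 2 * u ^ 2))
      * (s * u / (w ^ 3 * D ^ 2)) =
    4 * ξ * s / D ^ 2 * (2 * ((1 - s)⁻¹ * (ξ * u / (1 - u)) -
      (-(s * u * (E / 2)) - u * w * (ξ * u / (1 - u))) / w ^ 2)) -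
    (1 - s) / D * (2 * (s / (1 - s) ^ 2 * (ξ * u / (1 - u)) -
      (w * (s * u) * (-(E / 2) - ξ * u / (1 - u)) -
      2 * s * (-(s * u * (E / 2)) - u * w * (ξ * u / (1 - u)))) / w ^ 3)) := by
  field_simp
  subst hD hE hw
  ring

end Identities

/-- The generating function of the subleading covariances, assembled from the sums of the source
terms. -/
theorem secondTerm_eq (h0 : 0 < ξ) (h1 : ξ ≤ 1 / 4) (hs : |s| < 1) (hu : |u| < 1) (hne : s ≠ u) :
    secondTermHalf ξ s u + secondTermHalf ξ u s =
      4 * ξ * s / (1 - s + 4 * ξ * s) ^ 2 *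
        (2 * ((1 - s)⁻¹ * evalSeries (eulerOp (meanGen 0 ξ)) u -
        (s * u * evalSeries (meanGen 0 ξ) s - s * u * evalSeries (meanGen 0 ξ) u -
        u * (s - u) * evalSeries (eulerOp (meanGen 0 ξ)) u) / (s - u) ^ 2)) -
      (1 - s) / (1 - s + 4 * ξ * s) *
        (2 * (s / (1 - s) ^ 2 * evalSeries (eulerOp (meanGen 0 ξ)) u -
        ((s - u) * (s * u) * (evalSeries (meanGen 0 ξ) s + evalSeries (eulerOp (meanGen 0 ξ)) s -
          evalSeries (meanGen 0 ξ) u - evalSeries (eulerOp (meanGen 0 ξ)) u) -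
        2 * s * (s * u * evalSeries (meanGen 0 ξ) s - s * u * evalSeries (meanGen 0 ξ) u -
        u * (s - u) * evalSeries (eulerOp (meanGen 0 ξ)) u)) / (s - u) ^ 3)) +
      (1 - s) * radical ξ s *
        (2 * ((1 - s)⁻¹ * evalSeries (eulerOp (meanGen 1 ξ)) u -
        (s * u * evalSeries (meanGen 1 ξ) s - s * u * evalSeries (meanGen 1 ξ) u -
        u * (s - u) * evalSeries (eulerOp (meanGen 1 ξ)) u) / (s - u) ^ 2)) := by
  have hhalf : ∀ x y : ℝ, secondTermHalf ξ x y =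
      ((x + y) * (1 - y) * (1 - x) ^ 2 + 8 * x ^ 2 * ξ * (y ^ 2 + x * y + 1)
      - 2 * ξ * (9 * x ^ 2 * y + 4 * x * y ^ 2 - 3 * x * y + 3 * x ^ 3 - y ^ 2)
      + 8 * x ^ 2 * ξ ^ 2 * (x + 3 * y - 2 * x * y - 2 * y ^ 2))
      * (x * y / ((x - y) ^ 3 * (1 - x + 4 * ξ * x) ^ 2) * radical ξ y) := by
    intro x y
    rw [secondTermHalf, radical, div_mul_div_comm, mul_one]
    simp only [mul_assoc]
  have es := (one_sub_pos hs).ne'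
  have eu := (one_sub_pos hu).ne'
  have es2 := (one_sub_add_pos h0 h1 hs).ne'
  have eu2 := (one_sub_add_pos h0 h1 hu).ne'
  have hsu : s - u ≠ 0 := sub_ne_zero.2 hne
  have hus : u - s = -(s - u) := by ring
  rw [hhalf, hhalf, evalSeries_meanGen_zero h0 h1 hs, evalSeries_meanGen_zero h0 h1 hu,
    evalSeries_eulerOp_meanGen_zero h0 h1 hs, evalSeries_eulerOp_meanGen_zero h0 h1 hu,
    evalSeries_meanGen_one h0 h1 hs, evalSeries_meanGen_one h0 h1 hu,
    evalSeries_eulerOp_meanGen_one h0 h1 hu, hus]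
  have id1 := secondTerm_identity_fst (s := s) (u := u) (ξ := ξ) rfl rfl rfl es eu es2 eu2 hsu
  have id2 := secondTerm_identity_snd (s := s) (u := u) (ξ := ξ) rfl rfl rfl es eu es2 hsu
  generalize 1 - s + 4 * ξ * s = D at *
  generalize 1 - u + 4 * ξ * u = E at *
  generalize s - u = w at *
  linear_combination radical ξ s * id1 + radical ξ u * id2

/-- The rows of the double series of subleading covariances are obtained from the source terms by
multiplication with fixed power series. -/
theorem hasSum_covGen_one (h0 : 0 < ξ) (h1 : ξ ≤ 1 / 4) (hs : |s| < 1) {a b c : ℝ}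
    (ha : HasSum (fun p : ℕ × ℕ =>
      PowerSeries.coeff p.1 (sourceGen (meanGen 0 ξ) p.2) * (s ^ p.1 * u ^ p.2)) a)
    (hb : HasSum (fun p : ℕ × ℕ =>
      PowerSeries.coeff p.1 (eulerOp (sourceGen (meanGen 0 ξ) p.2)) * (s ^ p.1 * u ^ p.2)) b)
    (hc : HasSum (fun p : ℕ × ℕ =>
      PowerSeries.coeff p.1 (sourceGen (meanGen 1 ξ) p.2) * (s ^ p.1 * u ^ p.2)) c) :
    HasSum (fun p : ℕ × ℕ =>
        if p.2 = 0 then 0 else PowerSeries.coeff p.1 (covGen 1 p.2 ξ) * (s ^ p.1 * u ^ p.2))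
      (4 * ξ * s / (1 - s + 4 * ξ * s) ^ 2 * a - (1 - s) / (1 - s + 4 * ξ * s) * b +
        (1 - s) * radical ξ s * c) := by
  have hB := hasPolyGrowth_invSqrtSeries
  have hA := hasPolyGrowth_xiSeries h0 h1
  have hL : HasPolyGrowth (1 - PowerSeries.X) := HasPolyGrowth.one.sub .X
  have hX : HasPolyGrowth (PowerSeries.C (4 * ξ) * PowerSeries.X) := (HasPolyGrowth.C _).mul .X
  have hA2 : HasPolyGrowth (xiSeries ξ ^ 2) := by
    rw [pow_two]
    exact hA.mul hA
  have hA4 : HasPolyGrowth (xiSeries ξ ^ 4) := by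
    rw [show xiSeries ξ ^ 4 = xiSeries ξ ^ 2 * xiSeries ξ ^ 2 by ring]
    exact hA2.mul hA2
  obtain ⟨hv1, -, hv3⟩ := evalSeries_values h0 h1 hs
  have e2 : evalSeries (xiSeries ξ ^ 2) s = (1 - s + 4 * ξ * s)⁻¹ := by
    rw [pow_two, evalSeries_mul hA hA hs, ← pow_two, hv3]
  have e4 : evalSeries (xiSeries ξ ^ 4) s = ((1 - s + 4 * ξ * s) ^ 2)⁻¹ := by
    rw [show xiSeries ξ ^ 4 = xiSeries ξ ^ 2 * xiSeries ξ ^ 2 by ring, evalSeries_mul hA2 hA2 hs,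
      e2, ← pow_two, inv_pow]
  have t1 := hasSum_mul_rows (R := sourceGen (meanGen 0 ξ)) (hX.mul hA4) hs ha
  have t2 := hasSum_mul_rows (R := fun m => eulerOp (sourceGen (meanGen 0 ξ) m))
    (hL.mul hA2) hs hb
  have t3 := hasSum_mul_rows (R := sourceGen (meanGen 1 ξ)) (hL.mul (hB.mul hA)) hs hc
  rw [evalSeries_mul hX hA4 hs, evalSeries_mul (.C _) .X hs, e4, evalSeries_C, evalSeries_X,
    ← div_eq_mul_inv] at t1
  rw [evalSeries_mul hL hA2 hs, e2, evalSeries_one_sub_X hs, ← div_eq_mul_inv] at t2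
  rw [evalSeries_mul hL (hB.mul hA) hs, evalSeries_mul hB hA hs, hv1,
    evalSeries_one_sub_X hs] at t3
  refine ((t1.sub t2).add t3).congr_fun fun p => ?_
  obtain ⟨k, m⟩ := p
  dsimp only
  rw [← sub_mul, ← add_mul, ← map_sub, ← map_add]
  split_ifs with hm
  · have hzero : ∀ g : PowerSeries ℝ, sourceGen g m = 0 := fun g => by
      ext k
      rw [sourceGen, PowerSeries.coeff_mk, hm, Nat.cast_zero, mul_zero, zero_mul, map_zero]
    simp [hzero, eulerOp]
  · rw [covGen_one ξ (Nat.one_le_iff_ne_zero.2 hm)]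

/-- The double power series of the subleading covariances converges to the algebraic function of the
second term. -/
theorem hasSum_covCoeff_one (h0 : 0 < ξ) (h1 : ξ ≤ 1 / 4) (hs : |s| < 1) (hu : |u| < 1)
    (hne : s ≠ u) :
    HasSum (fun n : ℕ × ℕ =>
        (covCoeff 1 (n.1 + 1) (n.2 + 1)).eval ξ * s ^ (n.1 + 1) * u ^ (n.2 + 1))
      (secondTermHalf ξ s u + secondTermHalf ξ u s) := by
  have hM0 := hasPolyGrowth_meanGen_zero h0 h1
  have t := hasSum_covGen_one h0 h1 hs (hasSum_sourceGen hM0 hs hu hne)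
    (hasSum_eulerOp_sourceGen hM0 hs hu hne)
    (hasSum_sourceGen (hasPolyGrowth_meanGen_one h0 h1) hs hu hne)
  rw [← secondTerm_eq h0 h1 hs hu hne] at t
  have hinj : Function.Injective fun n : ℕ × ℕ => (n.1 + 1, n.2 + 1) := by
    rintro ⟨a, b⟩ ⟨c, d⟩ h
    simpa using h
  -- the coefficients vanish on the two coordinate axes
  refine ((hinj.hasSum_iff ?_).2 t).congr_fun fun n => ?_
  · rintro ⟨_ | k, _ | m⟩ hp
    · simp
    · simp [covGen, coeff_zero_seriesOf]
    · simp
    · exact absurd ⟨(k, m), rfl⟩ hp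
  · rw [Function.comp_apply, if_neg (Nat.succ_ne_zero _), covGen,
      coeff_seriesOf _ (Nat.le_add_left 1 _), mul_assoc]

end SecondTerm

/-! ### Coefficients of low degree -/

section LowOrder

open Polynomial (X)

theorem meanCoeff_0_1 : meanCoeff 0 1 = X := by
  have h := meanCoeff_zero_loop (k := 1) (by norm_num)
  simp at h
  linear_combination h

theorem meanCoeff_0_2 : meanCoeff 0 2 = X - X ^ 2 := by
  have h := meanCoeff_zero_loop (k := 2) (by norm_num)
  simp [meanCoeff_0_1] at h
  linear_combination h

theorem meanCoeff_0_3 : meanCoeff 0 3 = X - 2 * X ^ 2 + 2 * X ^ 3 := by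
  have h := meanCoeff_zero_loop (k := 3) (by norm_num)
  simp [Finset.sum_Ico_eq_sum_range, Finset.sum_range_succ, meanCoeff_0_1, meanCoeff_0_2] at h
  linear_combination h

theorem meanCoeff_0_4 : meanCoeff 0 4 = X - 3 * X ^ 2 + 6 * X ^ 3 - 5 * X ^ 4 := by
  have h := meanCoeff_zero_loop (k := 4) (by norm_num)
  simp [Finset.sum_Ico_eq_sum_range, Finset.sum_range_succ, meanCoeff_0_1, meanCoeff_0_2,
    meanCoeff_0_3] at h
  linear_combination h

theorem meanCoeff_1_1 : meanCoeff 1 1 = -X := by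
  have h := meanCoeff_one_loop (k := 1) (by norm_num)
  simp [meanCoeff_0_1] at h
  linear_combination h

theorem meanCoeff_1_2 : meanCoeff 1 2 = -2 * X + 4 * X ^ 2 := by
  have h := meanCoeff_one_loop (k := 2) (by norm_num)
  simp [meanCoeff_0_1, meanCoeff_0_2, meanCoeff_1_1] at h
  linear_combination h

theorem meanCoeff_1_3 : meanCoeff 1 3 = -3 * X + 12 * X ^ 2 - 16 * X ^ 3 := by
  have h := meanCoeff_one_loop (k := 3) (by norm_num)
  simp [Finset.sum_Ico_eq_sum_range, Finset.sum_range_succ, meanCoeff_0_1, meanCoeff_0_2,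
    meanCoeff_0_3, meanCoeff_1_1, meanCoeff_1_2] at h
  linear_combination h

theorem meanCoeff_1_4 : meanCoeff 1 4 = -4 * X + 24 * X ^ 2 - 64 * X ^ 3 + 64 * X ^ 4 := by
  have h := meanCoeff_one_loop (k := 4) (by norm_num)
  simp [Finset.sum_Ico_eq_sum_range, Finset.sum_range_succ, meanCoeff_0_1, meanCoeff_0_2,
    meanCoeff_0_3, meanCoeff_0_4, meanCoeff_1_1, meanCoeff_1_2, meanCoeff_1_3] at h
  linear_combination h

theorem covCoeff_0_1_1 : covCoeff 0 1 1 = 2 * X ^ 2 := by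
  have h := covCoeff_zero_loop (k := 1) (m := 1) (by norm_num) (by norm_num)
  simp [meanCoeff_0_1, meanCoeff_0_2] at h
  linear_combination h

theorem covCoeff_1_1_1 : covCoeff 1 1 1 = 2 * X - 10 * X ^ 2 := by
  have h := covCoeff_one_loop (k := 1) (m := 1) (by norm_num) (by norm_num)
  simp [meanCoeff_1_1, meanCoeff_1_2, covCoeff_0_1_1] at h
  linear_combination h

theorem covCoeff_0_1_2 : covCoeff 0 1 2 = 4 * X ^ 2 - 8 * X ^ 3 := by
  have h := covCoeff_zero_loop (k := 1) (m := 2) (by norm_num) (by norm_num)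
  simp [meanCoeff_0_2, meanCoeff_0_3] at h
  linear_combination h

theorem covCoeff_1_1_2 : covCoeff 1 1 2 = 4 * X - 36 * X ^ 2 + 72 * X ^ 3 := by
  have h := covCoeff_one_loop (k := 1) (m := 2) (by norm_num) (by norm_num)
  simp [meanCoeff_1_2, meanCoeff_1_3, covCoeff_0_1_2] at h
  linear_combination h

theorem covCoeff_0_1_3 : covCoeff 0 1 3 = 6 * X ^ 2 - 24 * X ^ 3 + 30 * X ^ 4 := by
  have h := covCoeff_zero_loop (k := 1) (m := 3) (by norm_num) (by norm_num)
  simp [meanCoeff_0_3, meanCoeff_0_4] at h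
  linear_combination h

theorem covCoeff_1_1_3 : covCoeff 1 1 3 = 6 * X - 78 * X ^ 2 + 312 * X ^ 3 - 414 * X ^ 4 := by
  have h := covCoeff_one_loop (k := 1) (m := 3) (by norm_num) (by norm_num)
  simp [meanCoeff_1_3, meanCoeff_1_4, covCoeff_0_1_3] at h
  linear_combination h

theorem covCoeff_0_2_2 : covCoeff 0 2 2 = 8 * X ^ 2 - 32 * X ^ 3 + 36 * X ^ 4 := by
  have h := covCoeff_zero_loop (k := 2) (m := 2) (by norm_num) (by norm_num)
  simp [meanCoeff_0_1, meanCoeff_0_2, meanCoeff_0_4, covCoeff_0_1_2] at h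
  linear_combination h

theorem covCoeff_1_2_2 : covCoeff 1 2 2 = 8 * X - 104 * X ^ 2 + 400 * X ^ 3 - 488 * X ^ 4 := by
  have h := covCoeff_one_loop (k := 2) (m := 2) (by norm_num) (by norm_num)
  simp [meanCoeff_0_1, meanCoeff_1_1, meanCoeff_1_2, meanCoeff_1_4, covCoeff_0_1_2,
    covCoeff_0_2_2, covCoeff_1_1_2] at h
  linear_combination h

theorem covCoeff_comm (j k m : ℕ) : covCoeff j k m = covCoeff j m k := by
  rw [covCoeff, covCoeff, Multiset.pair_comm]

end LowOrder

/-! ### The expansion of the autocorrelation -/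

/-- The term with index `j` is of order `N ^ (1 - j)`, hence the shift of the index. -/
theorem isAutocorrelationExpansion_centralSeries :
    IsAutocorrelationExpansion fun j n₁ n₂ =>
      PowerSeries.coeff (j - 1) (centralSeries {n₁, n₂}) := by
  intro n₁ n₂ h₁ h₂ K
  obtain ⟨C, hC⟩ := hasExpansion_centralFun (forall_mem_pair h₁ h₂) K
  refine ⟨C, fun N₁ N₂ hN₁ hN₂ => ?_⟩
  obtain ⟨a, rfl⟩ := Nat.exists_eq_add_of_le' hN₁
  obtain ⟨b, rfl⟩ := Nat.exists_eq_add_of_le' hN₂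
  have h := hC (a, b)
  rw [Pi.sub_apply, evalExpansion_trunc_apply, centralFun,
    ← autocorrelation_eq_centralMoment _ _ h₁ h₂] at h
  simpa only [invN, inv_pow, ← div_eq_mul_inv, xiFun, centralSeries, Nat.add_sub_cancel] using h

end ChaoticTransport

theorem mainTheorem4 :
    ∃ P : ℕ → ℕ → ℕ → ℝ[X],
      ChaoticTransport.IsAutocorrelationExpansion P ∧
      (∀ ξ s₁ s₂ : ℝ, 0 < ξ → ξ ≤ 1 / 4 → |s₁| < 1 → |s₂| < 1 → s₁ ≠ s₂ →
        HasSum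
          (fun n : ℕ × ℕ =>
            (P 2 (n.1 + 1) (n.2 + 1)).eval ξ * s₁ ^ (n.1 + 1) * s₂ ^ (n.2 + 1))
          (ChaoticTransport.secondTermHalf ξ s₁ s₂ + ChaoticTransport.secondTermHalf ξ s₂ s₁)) ∧
      P 2 1 1 = 2 * Polynomial.X * (1 - 5 * Polynomial.X) ∧
      (P 2 1 2 = 4 * Polynomial.X * (1 - 9 * Polynomial.X + 18 * Polynomial.X ^ 2) ∧
        P 2 2 1 = 4 * Polynomial.X * (1 - 9 * Polynomial.X + 18 * Polynomial.X ^ 2)) ∧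
      P 2 2 2 = 8 * Polynomial.X *
        (1 - 13 * Polynomial.X + 50 * Polynomial.X ^ 2 - 61 * Polynomial.X ^ 3) ∧
      (P 2 1 3 = 6 * Polynomial.X *
          (1 - 13 * Polynomial.X + 52 * Polynomial.X ^ 2 - 69 * Polynomial.X ^ 3) ∧
        P 2 3 1 = 6 * Polynomial.X *
          (1 - 13 * Polynomial.X + 52 * Polynomial.X ^ 2 - 69 * Polynomial.X ^ 3)) := by
  refine ⟨_, ChaoticTransport.isAutocorrelationExpansion_centralSeries,
    fun ξ s₁ s₂ h0 h1 hs hu hne => ChaoticTransport.hasSum_covCoeff_one h0 h1 hs hu hne, ?_⟩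
  change ChaoticTransport.covCoeff 1 1 1 = _ ∧ (ChaoticTransport.covCoeff 1 1 2 = _ ∧
    ChaoticTransport.covCoeff 1 2 1 = _) ∧ ChaoticTransport.covCoeff 1 2 2 = _ ∧
    ChaoticTransport.covCoeff 1 1 3 = _ ∧ ChaoticTransport.covCoeff 1 3 1 = _
  rw [ChaoticTransport.covCoeff_comm 1 2 1, ChaoticTransport.covCoeff_comm 1 3 1,
    ChaoticTransport.covCoeff_1_1_1, ChaoticTransport.covCoeff_1_1_2,
    ChaoticTransport.covCoeff_1_2_2, ChaoticTransport.covCoeff_1_1_3]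
  refine ⟨by ring, ⟨by ring, by ring⟩, by ring, by ring, by ring⟩
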